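/- Let $s\in(0,1)$. For $\beta\in\mathbb R$ let $(x_+)^\beta=x^\beta$ for $x>0$ and $(x_+)^\beta=0$ for $x\le 0$. Put $$c_{1,s}=\frac{s4^s\Gamma(\frac12+s)}{\sqrt\pi\,\Gamma(1-s)},\qquad a_s=\frac{c_{1,s}}{2s},\qquad \overline\kappa_s=\frac{\Gamma(1-s)}{2^{2s-1}\Gamma(s)},\qquad C_s(\beta)=\frac{\Gamma(\beta+1)}{\Gamma(\beta-2s+1)}\,\frac{\sin(\pi(\beta-s))}{\sin(\pi(\beta-2s))},$$ where $C_s$ is extended by continuity to the points $\beta>-1$ with $\beta-2s\in\{-1,-2\}$. Let $(-\Delta)^su(x)=c_{1,s}\,\mathrm{p.v.}\!\int_{\mathbb R}\frac{u(x)-u(y)}{|x-y|^{1+2s}}\,dy$. **Generalized sense.** For each $R>0$ let $\chi_R\in C_c^\infty(-2R,2R)$ with $0\le\chi_R\le1$ and $\chi_R=1$ on $(-R,R)$. For $k\in\{0,1,2,\dots\}$ and $u$ with $\int_{\mathbb R}\frac{|u(x)|}{1+|x|^{1+2s+k}}dx<\infty$, we say that $(-\Delta)^su\overset{k}{=}f$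 in $\Omega\subset\mathbb R$ if there are polynomials $p_R$ of degree at most $k-1$ and functions $f_R$ such that $(-\Delta)^s(u\chi_R)=f_R+p_R$ pointwise in $\Omega\cap(-R/2,R/2)$ and $f_R\to f$ as $R\to\infty$, uniformly on $\Omega\cap(-M,M)$ for every $M>0$. **(1)** Let $\beta>-1$ with $\beta-2s\notin\{0,1,2,\dots\}$. There is a unique function $v_\beta$ on $\{(x,t):t\ge0\}$ that is $\beta$-homogeneous, continuous away from the origin, of class $C^2$ in $\{t>0\}$, and satisfies $$\mathrm{div}(t^{1-2s}\nabla v_\beta)=0\ \text{ in }\{t>0\},\qquad v_\beta(x,0)=(x_+)^\beta\ \text{ for } x\in\mathbb R .$$ Moreover, for every $x>0$, $$-\lim_{t\to0^+}t^{1-2s}\partial_tv_\beta(x,t)=\overline\kappa_s\,C_s(\beta)\,x^{\beta-2s},$$ and, for every family $(\chi_R)$ as above and every integer $k\ge0$ with $k>\beta-2s$, $$(-\Delta)^s(x_+)^\beta\overset{k}{=}C_s(\beta)\,x^{\beta-2s}\quad\text{in }(0,\infty).$$ **(2)** For such $\beta$, the function $v=v_\beta$ solves the extended regional problem $$\mathrm{div}(t^{1-2s}\nabla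 v)=0\ \text{ in }\{t>0\},\qquad -\lim_{t\to0^+}t^{1-2s}\partial_tv(x,t)=\overline\kappa_s\frac{a_s}{x^{2s}}v(x,0)\ \text{ for }x>0,\qquad v(x,0)=0\ \text{ for }x\le0,$$ if and only if $\beta\ne2s-2$ and $$\frac{\Gamma(\beta+1)}{\Gamma(\beta-2s+1)\Gamma(2s)}=\frac1\pi\,\frac{\sin(\pi(\beta-2s))\sin(\pi s)}{\sin(\pi(\beta-s))},\tag{E}$$ where $1/\Gamma=0$ at the poles of $\Gamma$, and (E) is regarded as not satisfied where the denominator $\sin(\pi(\beta-s))$ vanishes. **(3)** Consider the eigenvalue problem for $\psi\in H^1((0,\pi);\sin(\theta)^{1-2s}d\theta)$, $$-(\sin(\theta)^{1-2s}\psi')'=\lambda\sin(\theta)^{1-2s}\psi\ \text{ in }(0,\pi),\qquad -\lim_{\theta\to0^+}\sin(\theta)^{1-2s}\psi'(\theta)=\overline\kappa_sa_s\psi(0),\qquad\psi(\pi)=0,$$ with eigenfunctions $\psi$ continuous on $[0,\pi]$ and $C^2$ in $(0,\pi)$. The numbers $\beta=\frac{2s-1}2+\sqrt{\lambda+\left(\frac{2s-1}2\right)^2}$,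 with $\lambda$ an eigenvalue, are exactly the solutions $\beta\ge\max\{2s-1,0\}$ of (E). -/

import Mathlib

open Real Set Filter Topology MeasureTheory
open scoped ContDiff

noncomputable section

/-- The truncated power `(x_+)^β`: `x ^ β` for `x > 0` and `0` for `x ≤ 0` (also when `β ≤ 0`). -/
def posPow (β x : ℝ) : ℝ := if 0 < x then x ^ β else 0

/-- The normalising constant `c_{1,s}` of the one-dimensional fractional Laplacian. -/
def fracConst (s : ℝ) : ℝ :=
  s * (4 : ℝ) ^ s * Gamma (1 / 2 + s) / (π ^ (1 / 2 : ℝ) * Gamma (1 - s))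

/-- `a_s = c_{1,s} / (2 s)`. -/
def killConst (s : ℝ) : ℝ := fracConst s / (2 * s)

/-- The extension constant `κ_s = Γ(1-s) / (2^{2s-1} Γ(s))`. -/
def extConst (s : ℝ) : ℝ := Gamma (1 - s) / ((2 : ℝ) ^ (2 * s - 1) * Gamma s)

/-- The expression `Γ(β+1)/Γ(β-2s+1) * sin(π(β-s))/sin(π(β-2s))`, as written
(meaningful when `β - 2s` is not an integer). -/
def powQuot (s β : ℝ) : ℝ :=
  Gamma (β + 1) / Gamma (β - 2 * s + 1) * (sin (π * (β - s)) / sin (π * (β - 2 * s)))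

/-- The exponent equation. Both sides vanish when `β - 2s` is a negative integer: `Gamma` is `0` at
its poles, so that division by it agrees with the usual convention `1/Γ = 0` there. -/
def ExponentEq (s β : ℝ) : Prop :=
  Gamma (β + 1) / (Gamma (β - 2 * s + 1) * Gamma (2 * s)) =
    1 / π * (sin (π * (β - 2 * s)) * sin (π * s) / sin (π * (β - s)))

/-! ### The extended problem in the half-plane -/

/-- The open half-plane `{(x, t) : t > 0}`. -/
def openHalfPlane : Set (ℝ × ℝ) := {p | 0 < p.2}

/-- The closed half-plane `{(x, t) : t ≥ 0}`. -/
def closedHalfPlane : Set (ℝ × ℝ) := {p | 0 ≤ p.2}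

/-- `div (t^{1-2s} ∇ v) = 0` in the open half-plane, for `v` of class `C²` there. -/
def IsDegHarmonic (s : ℝ) (v : ℝ × ℝ → ℝ) : Prop :=
  ContDiffOn ℝ 2 v openHalfPlane ∧
  ∀ x t : ℝ, 0 < t →
    deriv (fun ξ => t ^ (1 - 2 * s) * deriv (fun η => v (η, t)) ξ) x +
      deriv (fun τ => τ ^ (1 - 2 * s) * deriv (fun σ => v (x, σ)) τ) t = 0

/-- `- lim_{t → 0⁺} t^{1-2s} ∂_t v (x, t) = L`. -/
def HasConormal (s : ℝ) (v : ℝ × ℝ → ℝ) (x L : ℝ) : Prop :=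
  Tendsto (fun t => -(t ^ (1 - 2 * s) * deriv (fun τ => v (x, τ)) t)) (𝓝[>] 0) (𝓝 L)

/-- `v` is a `β`-homogeneous solution of `div (t^{1-2s} ∇ v) = 0` in the half-plane with boundary
values `(x_+)^β`, attained continuously away from the origin. -/
structure IsHomogExtension (s β : ℝ) (v : ℝ × ℝ → ℝ) : Prop where
  homogeneous : ∀ x t r : ℝ, 0 ≤ t → 0 < r → v (r * x, r * t) = r ^ β * v (x, t)
  equation : IsDegHarmonic s v
  continuousOn : ContinuousOn v (closedHalfPlane \ {(0, 0)})
  trace : ∀ x : ℝ, v (x, 0) = posPow β x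

/-- `v` solves the extended form of the regional problem on the half-line. -/
structure SolvesExtendedRegional (s : ℝ) (v : ℝ × ℝ → ℝ) : Prop where
  equation : IsDegHarmonic s v
  continuousOn : ContinuousOn v (closedHalfPlane \ {(0, 0)})
  conormal : ∀ x : ℝ, 0 < x →
    HasConormal s v x (extConst s * (killConst s / x ^ (2 * s)) * v (x, 0))
  trace : ∀ x : ℝ, x ≤ 0 → v (x, 0) = 0

/-! ### The fractional Laplacian on the line, and its generalized sense -/

/-- `(-Δ)^s u (x) = L`, pointwise, as a principal value. -/
def HasFracLaplacian (s : ℝ) (u : ℝ → ℝ) (x L : ℝ) : Prop :=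
  (∀ ε > 0, IntegrableOn (fun y => (u x - u y) / |x - y| ^ (1 + 2 * s)) {y | ε < |x - y|}) ∧
  Tendsto (fun ε : ℝ => fracConst s *
      ∫ y in {y | ε < |x - y|}, (u x - u y) / |x - y| ^ (1 + 2 * s)) (𝓝[>] 0) (𝓝 L)

/-- A family of smooth cut-offs `χ_R`, `R > 0`, with values in `[0, 1]`, compactly supported in
`(-2R, 2R)` and equal to `1` on `(-R, R)`. -/
def IsCutoffFamily (χ : ℝ → ℝ → ℝ) : Prop :=
  ∀ R > 0, ContDiff ℝ ∞ (χ R) ∧ HasCompactSupport (χ R) ∧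
    tsupport (χ R) ⊆ Metric.ball 0 (2 * R) ∧
    (∀ x ∈ Metric.ball (0 : ℝ) R, χ R x = 1) ∧ ∀ x, 0 ≤ χ R x ∧ χ R x ≤ 1

/-- `(-Δ)^s u = f` in `Ω` up to polynomials of degree at most `k - 1`. The convergence `f_R → f` is
uniform on the bounded parts of `Ω`, which for bounded `Ω` is uniform convergence in `Ω`. -/
def HasFracLaplacianMod (χ : ℝ → ℝ → ℝ) (s : ℝ) (k : ℕ) (u f : ℝ → ℝ) (Ω : Set ℝ) : Prop :=
  Integrable (fun x => |u x| / (1 + |x| ^ (1 + 2 * s + k))) ∧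
  ∃ (p : ℝ → Polynomial ℝ) (F : ℝ → ℝ → ℝ),
    (∀ R > 0, (p R).degree < k) ∧
    (∀ R > 0, ∀ x ∈ Ω ∩ Metric.ball 0 (R / 2),
      HasFracLaplacian s (fun y => u y * χ R y) x (F R x + (p R).eval x)) ∧
    ∀ M > 0, TendstoUniformlyOn F f atTop (Ω ∩ Metric.ball 0 M)

/-! ### The angular eigenvalue problem -/

/-- `lam` is an eigenvalue of the angular problem obtained by inserting `r^β ψ(θ)` in the extended
problem, with eigenfunction `ψ` in `H¹((0,π); sin(θ)^{1-2s} dθ)`. -/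
def IsAngularEigenvalue (s lam : ℝ) : Prop :=
  ∃ ψ : ℝ → ℝ,
    (∃ θ ∈ Ioo 0 π, ψ θ ≠ 0) ∧
    ContDiffOn ℝ 2 ψ (Ioo 0 π) ∧
    ContinuousOn ψ (Icc 0 π) ∧
    IntegrableOn (fun θ => sin θ ^ (1 - 2 * s) * (ψ θ ^ 2 + deriv ψ θ ^ 2)) (Ioo 0 π) ∧
    (∀ θ ∈ Ioo 0 π, -deriv (fun φ => sin φ ^ (1 - 2 * s) * deriv ψ φ) θ =
      lam * sin θ ^ (1 - 2 * s) * ψ θ) ∧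
    Tendsto (fun θ => -(sin θ ^ (1 - 2 * s) * deriv ψ θ)) (𝓝[>] 0)
      (𝓝 (extConst s * killConst s * ψ 0)) ∧
    ψ π = 0

/-- `β` is one of the exponents `β_k = (2s-1)/2 + √(λ_k + ((2s-1)/2)²)`. -/
def IsRegionalExponent (s β : ℝ) : Prop :=
  ∃ lam : ℝ, IsAngularEigenvalue s lam ∧
    β = (2 * s - 1) / 2 + √(lam + ((2 * s - 1) / 2) ^ 2)

end

/-! Angular part. For v = r^β ψ(θ) the equation becomes -(sin^{1-2s} ψ')' = λ sin^{1-2s} ψ with λ =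
β(β+1-2s). In the variable z = (1 + cos θ)/2 this is a first-order linear system for ψ and its flux.
One solution, P = `angP` with flux Q = `angQ`, vanishes at z = 0, the side of the negative
half-line. The exchange (s, β) ↦ (1-s, β+1-2s) keeps λ and swaps function and flux, so it yields a
second solution `angX`, equal to 1 at z = 0. The Wronskian of the two is -1, hence they span all
solutions (`exists_angular_combination`).

The boundary values (x_+)^β rule out `angX` and divide P by P(1); this gives existence and
uniqueness of v, with conormal derivative s 2^{1-2s} (Q(1)/P(1)) x^{β-2s}. Gauss's summation theorem
(`hyp_one`) and the reflection formula turn the constant into κ_s C_s(β) (`conormal_const_eq`). So v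
solves the regional problem iff C_s(β) = a_s. Multiplying this by sin(π(β-2s)) gives (E), at the
price of the spurious root β = 2s-2 (`exponentEq_iff`).

For an eigenfunction, ψ(π) = 0 again leaves only multiples of P, and the condition at θ = 0 is the
same relation between P(1) and Q(1). To identify β with the larger root of β(β+1-2s) = λ above
max(2s-1, 0) one needs λ ≥ 0. This comes from a Wronskian comparison with the positive eigenfunction
at β = 0 (`nonneg_of_isAngularEigenvalue`).

The fractional Laplacian is computed directly, without the extension. Scaling x to 1 and folding (1,
∞) onto (0, 1) by σ = 1/y gives, for -1 < β < 2s, a convergent integral that reduces to Beta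
functions (`fracConst_mul_pvConst`). For larger β the divergent terms at σ = 0 are removed as a
Hadamard finite part; finite part and C_s(β) obey the same recurrence β → β+1
(`fracConst_mul_regConst`). For the cut-off power the removed terms scale to x^j with j < k, which
is the discarded polynomial (`rpow_mul_cutoffCoeff`), and the remaining error is O(R^{-(2s-β+k)}),
locally uniformly in x. -/

noncomputable section

/-! ### The Gauss hypergeometric series with real parameters -/

/-- The coefficients `(a)ₙ (b)ₙ / ((c)ₙ n!)` of the Gauss hypergeometric series. -/
def hypCoeff (a b c : ℝ) : ℕ → ℝ
  | 0 => 1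
  | n + 1 => hypCoeff a b c n * ((a + n) * (b + n) / ((c + n) * (1 + n)))

/-- The Gauss hypergeometric function `F(a, b; c; z)` for real parameters. -/
def hyp (a b c z : ℝ) : ℝ := ∑' n, hypCoeff a b c n * z ^ n

lemma hypCoeff_succ (a b c : ℝ) (n : ℕ) :
    hypCoeff a b c (n + 1) = hypCoeff a b c n * ((a + n) * (b + n) / ((c + n) * (1 + n))) := rfl

lemma hypCoeff_zero (a b c : ℝ) : hypCoeff a b c 0 = 1 := rfl

lemma tendsto_hypCoeff_ratio (a b c : ℝ) :
    Tendsto (fun n : ℕ => (a + n) * (b + n) / ((c + n) * (1 + n))) atTop (𝓝 1) := by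
  have h : ∀ x y : ℝ, Tendsto (fun n : ℕ => (x + n) / (y + n)) atTop (𝓝 1) := fun x y => by
    simpa using tendsto_add_mul_div_add_mul_atTop_nhds x y 1 (one_ne_zero (α := ℝ))
  simpa [mul_div_mul_comm] using (h a c).mul (h b 1)

lemma summable_hypCoeff_mul_pow (a b c : ℝ) {z : ℝ} (hz : |z| < 1) :
    Summable (fun n => hypCoeff a b c n * z ^ n) := by
  obtain ⟨r, hr1, hr2⟩ := exists_between hz
  refine summable_of_ratio_norm_eventually_le (r := r) hr2 ?_
  have ht : Tendsto (fun n : ℕ => |(a + n) * (b + n) / ((c + n) * (1 + n))| * |z|) atTop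
      (𝓝 (|1| * |z|)) := (tendsto_hypCoeff_ratio a b c).abs.mul_const _
  rw [abs_one, one_mul] at ht
  filter_upwards [ht.eventually_lt_const hr1] with n hn
  rw [hypCoeff_succ, pow_succ, Real.norm_eq_abs, Real.norm_eq_abs]
  have : |hypCoeff a b c n * ((a + n) * (b + n) / ((c + n) * (1 + n))) * (z ^ n * z)| =
      |(a + n) * (b + n) / ((c + n) * (1 + n))| * |z| * |hypCoeff a b c n * z ^ n| := by
    simp only [abs_mul]; ring
  rw [this]
  gcongr

lemma succ_mul_hypCoeff_succ (a b : ℝ) {c : ℝ} (hc : 0 < c) (n : ℕ) :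
    (n + 1) * hypCoeff a b c (n + 1) = a * b / c * hypCoeff (a + 1) (b + 1) (c + 1) n := by
  induction n with
  | zero => simp [hypCoeff]
  | succ n ih =>
    rw [hypCoeff_succ a b c (n + 1), hypCoeff_succ (a + 1) (b + 1) (c + 1) n, ← mul_assoc,
      ← mul_assoc, ← ih]
    push_cast
    have h1 : c + 1 + n ≠ 0 := by positivity
    have h2 : c + (n + 1) ≠ 0 := by positivity
    field_simp
    ring

lemma hasDerivAt_hyp (a b : ℝ) {c z : ℝ} (hc : 0 < c) (hz : |z| < 1) :
    HasDerivAt (hyp a b c) (a * b / c * hyp (a + 1) (b + 1) (c + 1) z) z := by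
  obtain ⟨r, hr1, hr2⟩ := exists_between hz
  have hr0 : 0 < r := (abs_nonneg z).trans_lt hr1
  have hs : Summable (fun n => |a * b / c * (hypCoeff (a + 1) (b + 1) (c + 1) n * r ^ n)|) :=
    ((summable_hypCoeff_mul_pow (a + 1) (b + 1) (c + 1)
      (by rwa [abs_of_pos hr0])).mul_left _).abs
  have hs' : Summable (fun n : ℕ => |hypCoeff a b c n * (n * r ^ (n - 1))|) := by
    rw [← summable_nat_add_iff 1]
    refine hs.congr fun n => ?_
    rw [← mul_assoc (a * b / c), ← succ_mul_hypCoeff_succ a b hc]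
    push_cast
    congr 1; ring
  have key := hasDerivAt_tsum_of_isPreconnected (t := Metric.ball (0 : ℝ) r) hs'
    (g := fun n z => hypCoeff a b c n * z ^ n)
    (g' := fun n z => hypCoeff a b c n * (n * z ^ (n - 1))) Metric.isOpen_ball
    (convex_ball (0 : ℝ) r).isPreconnected (fun n y _ => (hasDerivAt_pow n y).const_mul _)
    (fun n y hy => by
      rw [Real.norm_eq_abs, abs_mul, abs_mul (hypCoeff a b c n), abs_mul, abs_mul (n : ℝ),
        abs_pow, abs_pow]
      have : |y| ≤ |r| := by
        rw [abs_of_pos hr0]; exact (by simpa using hy : |y| < r).le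
      gcongr)
    (Metric.mem_ball_self hr0) (summable_hypCoeff_mul_pow a b c (by simp))
    (by simpa using hr1 : z ∈ Metric.ball (0 : ℝ) r)
  refine key.congr_deriv ?_
  have hsz : Summable (fun n : ℕ => hypCoeff a b c n * (n * z ^ (n - 1))) := by
    rw [← summable_nat_add_iff 1]
    refine ((summable_hypCoeff_mul_pow (a + 1) (b + 1) (c + 1) hz).mul_left
      (a * b / c)).congr fun n => ?_
    rw [← mul_assoc (a * b / c), ← succ_mul_hypCoeff_succ a b hc]
    push_cast
    ring
  rw [hsz.tsum_eq_zero_add, hyp, ← tsum_mul_left]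
  simp only [CharP.cast_eq_zero, zero_mul, mul_zero, zero_add]
  refine tsum_congr fun n => ?_
  rw [← mul_assoc (a * b / c), ← succ_mul_hypCoeff_succ a b hc]
  push_cast
  ring

lemma hyp_zero (a b c : ℝ) : hyp a b c 0 = 1 := by
  rw [hyp, tsum_eq_single 0 (fun n hn => by simp [hn])]
  simp [hypCoeff_zero]

lemma HasSum.of_eq {f g : ℕ → ℝ} {x : ℝ} (h : HasSum f x) (e : ∀ n, g n = f n) : HasSum g x :=
  (funext e : g = f) ▸ h

/-- The hypergeometric equation z(1-z)F'' + (c-(a+b+1)z)F' - abF = 0 divided by ab/c, a form that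
keeps its content when ab = 0. -/
lemma hyp_contiguous (a b : ℝ) {c z : ℝ} (hc : 0 < c) (hz : |z| < 1) :
    z * (1 - z) * ((a + 1) * (b + 1) / (c + 1) * hyp (a + 2) (b + 2) (c + 2) z) +
      (c - (a + b + 1) * z) * hyp (a + 1) (b + 1) (c + 1) z - c * hyp a b c z = 0 := by
  set A := hypCoeff a b c
  set B := hypCoeff (a + 1) (b + 1) (c + 1)
  have e0 := (summable_hypCoeff_mul_pow a b c hz).hasSum
  have e1 := (summable_hypCoeff_mul_pow (a + 1) (b + 1) (c + 1) hz).hasSum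
  have e2 := (summable_hypCoeff_mul_pow (a + 2) (b + 2) (c + 2) hz).hasSum
  have hk (n : ℕ) : (n + 1) * B (n + 1) =
      (a + 1) * (b + 1) / (c + 1) * hypCoeff (a + 2) (b + 2) (c + 2) n := by
    rw [succ_mul_hypCoeff_succ _ _ (by linarith)]
    norm_num [add_assoc]
  set F := hyp a b c z with hF
  set F1 := hyp (a + 1) (b + 1) (c + 1) z with hF1
  set F2 := (a + 1) * (b + 1) / (c + 1) * hyp (a + 2) (b + 2) (c + 2) z with hF2
  have t2 : HasSum (fun n : ℕ => (n + 1) * B (n + 1) * z ^ (n + 1)) (z * F2) := by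
    have := (e2.mul_left ((a + 1) * (b + 1) / (c + 1))).mul_left z
    refine this.of_eq fun n => ?_
    rw [← mul_assoc (_ / _), ← hk]; ring
  have t2' : HasSum (fun n : ℕ => n * B n * z ^ n) (z * F2) := by
    rw [← hasSum_nat_add_iff' 1]
    simpa using t2
  have t1 : HasSum (fun n : ℕ => B (n + 1) * z ^ (n + 1)) (F1 - 1) := by
    have := (hasSum_nat_add_iff' 1).2 e1
    simpa [B, hypCoeff_zero, F1, hyp] using this
  have t0 : HasSum (fun n : ℕ => A (n + 1) * z ^ (n + 1)) (F - 1) := by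
    have := (hasSum_nat_add_iff' 1).2 e0
    simpa [A, hypCoeff_zero, F, hyp] using this
  have tot := (((t2.add (t1.mul_left c)).sub (t0.mul_left c)).sub
    ((t2'.add (e1.mul_left (a + b + 1))).mul_left z))
  have hz0 : HasSum (fun _ : ℕ => (0 : ℝ)) 0 := hasSum_zero
  suffices hzero : ∀ n : ℕ, (n + 1) * B (n + 1) * z ^ (n + 1) + c * (B (n + 1) * z ^ (n + 1)) -
      c * (A (n + 1) * z ^ (n + 1)) - z * (n * B n * z ^ n + (a + b + 1) * (B n * z ^ n)) = 0 by
    have := tot.unique (hz0.of_eq fun n => hzero n)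
    rw [show (∑' n, hypCoeff (a + 1) (b + 1) (c + 1) n * z ^ n) = F1 from rfl] at this
    linear_combination this
  intro n
  have h1 := succ_mul_hypCoeff_succ a b hc n
  have hb : B (n + 1) * ((c + n + 1) * (n + 1)) = B n * ((a + n + 1) * (b + n + 1)) := by
    simp only [B, hypCoeff_succ]
    have h1 : c + 1 + n ≠ 0 := by positivity
    have h2 : c + n + 1 ≠ 0 := by positivity
    field_simp
    ring
  change (n + 1) * A (n + 1) = a * b / c * B n at h1
  have h1' : c * (n + 1) * A (n + 1) = a * b * B n := by
    rw [mul_assoc, h1]; field_simp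
  have hn : (n : ℝ) + 1 ≠ 0 := by positivity
  apply mul_left_cancel₀ hn
  rw [pow_succ]
  linear_combination z ^ n * z * hb - z ^ n * z * h1'

/-! ### Decay of the coefficients and the value at z = 1. -/

lemma exists_hypCoeff_le (a b : ℝ) {c : ℝ} (hc : 0 < c) (h : 0 < c - a - b) :
    ∃ K e : ℝ, 1 < e ∧ ∀ n : ℕ, |hypCoeff a b c n| ≤ K * ((n : ℝ) + 1) ^ (-e) := by
  -- Raabe's test: the coefficient ratio is 1 - (1+c-a-b)/n + O(n⁻²), so any e strictly between 1
  -- and 1+c-a-b serves.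
  set e : ℝ := 1 + (c - a - b) / 2 with he
  have he1 : 1 < e := by linarith
  have key : ∀ᶠ n : ℕ in atTop, |(a + n) * (b + n) / ((c + n) * (1 + n))| ≤ 1 - e / (n + 2) := by
    have l1 : Tendsto (fun n : ℕ => (2 + 1 * (n : ℝ)) / (1 + 1 * n) *
        ((c - a * b + (1 + c - a - b) * n) / (c + 1 * n))) atTop (𝓝 (1 + c - a - b)) := by
      simpa using (tendsto_add_mul_div_add_mul_atTop_nhds (2 : ℝ) 1 1 one_ne_zero).mul
        (tendsto_add_mul_div_add_mul_atTop_nhds (c - a * b) c (1 + c - a - b)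
          (one_ne_zero (α := ℝ)))
    filter_upwards [l1.eventually_const_lt (show e < 1 + c - a - b by linarith),
      (tendsto_hypCoeff_ratio a b c).eventually_const_lt zero_lt_one] with n hn hpos
    rw [abs_of_pos hpos]
    have h1 : (1 : ℝ) + n ≠ 0 := by positivity
    have h2 : c + n ≠ 0 := by positivity
    have h3 : (n : ℝ) + 2 > 0 := by positivity
    have : (2 + 1 * (n : ℝ)) / (1 + 1 * n) * ((c - a * b + (1 + c - a - b) * n) / (c + 1 * n)) =
        (n + 2) * (1 - (a + n) * (b + n) / ((c + n) * (1 + n))) := by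
      field_simp; ring
    rw [this, mul_comm, ← div_lt_iff₀ h3] at hn
    linarith
  have mono : ∀ᶠ n : ℕ in atTop, |hypCoeff a b c (n + 1)| * ((n : ℝ) + 1 + 1) ^ e ≤
      |hypCoeff a b c n| * ((n : ℝ) + 1) ^ e := by
    filter_upwards [key] with n hn
    -- Bernoulli's inequality compares the coefficient ratio with that of (n+1)^{-e}, so
    -- |coefficient| (n+1)^e is eventually nonincreasing.
    have hb : 1 - e / (n + 2) ≤ (((n : ℝ) + 1) / (n + 2)) ^ e := by
      have := one_add_mul_self_le_rpow_one_add (s := -1 / ((n : ℝ) + 2)) (p := e)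
        (by rw [le_div_iff₀ (by positivity)]; linarith [(Nat.cast_nonneg n : (0 : ℝ) ≤ n)]) he1.le
      convert this using 1
      · ring
      · congr 1; field_simp; ring
    rw [hypCoeff_succ, abs_mul, mul_assoc]
    refine mul_le_mul_of_nonneg_left ?_ (abs_nonneg _)
    calc _ ≤ (((n : ℝ) + 1) / (n + 2)) ^ e * ((n : ℝ) + 1 + 1) ^ e := by
          gcongr; exact hn.trans hb
      _ = _ := by
          rw [← mul_rpow (by positivity) (by positivity)]
          congr 1; field_simp; ring
  obtain ⟨N, hN⟩ := eventually_atTop.1 mono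
  set u : ℕ → ℝ := fun n => |hypCoeff a b c n| * ((n : ℝ) + 1) ^ e with hu
  have hu0 : ∀ n, 0 ≤ u n := fun n => by positivity
  have hbd : ∀ n, u n ≤ ∑ i ∈ Finset.range (N + 1), u i := by
    intro n
    rcases le_total n N with hn | hn
    · exact Finset.single_le_sum (f := u) (fun i _ => hu0 i) (Finset.mem_range.2 (by omega))
    · induction n, hn using Nat.le_induction with
      | base => exact Finset.single_le_sum (f := u) (fun i _ => hu0 i) (by simp)
      | succ m hm ih =>
        refine le_trans ?_ ih
        simpa [hu] using hN m hm
  refine ⟨∑ i ∈ Finset.range (N + 1), u i, e, he1, fun n => ?_⟩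
  have := hbd n
  have hp : 0 < ((n : ℝ) + 1) ^ e := by positivity
  rw [rpow_neg (by positivity), ← div_eq_mul_inv, le_div_iff₀ hp]
  exact this

lemma summable_succ_rpow_neg {e : ℝ} (he : 1 < e) :
    Summable (fun n : ℕ => ((n : ℝ) + 1) ^ (-e)) := by
  have := (summable_nat_add_iff 1).2 (Real.summable_nat_rpow.2 (by linarith : -e < -1))
  simpa using this

lemma summable_abs_hypCoeff (a b : ℝ) {c : ℝ} (hc : 0 < c) (h : 0 < c - a - b) :
    Summable (fun n => |hypCoeff a b c n|) := by
  obtain ⟨K, e, he, hK⟩ := exists_hypCoeff_le a b hc h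
  exact Summable.of_nonneg_of_le (fun n => abs_nonneg _) hK ((summable_succ_rpow_neg he).mul_left K)

lemma continuousOn_hyp (a b : ℝ) {c : ℝ} (hc : 0 < c) (h : 0 < c - a - b) :
    ContinuousOn (hyp a b c) (Icc 0 1) := by
  refine continuousOn_tsum (fun n => by fun_prop) (summable_abs_hypCoeff a b hc h) fun n z hz => ?_
  rw [Real.norm_eq_abs, abs_mul, abs_pow, abs_of_nonneg hz.1]
  exact mul_le_of_le_one_right (abs_nonneg _) (pow_le_one₀ hz.1 hz.2)

lemma hypCoeff_add_one (a b : ℝ) {c : ℝ} (hc : 0 < c) (n : ℕ) :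
    (c + n) * hypCoeff a b (c + 1) n = c * hypCoeff a b c n := by
  induction n with
  | zero => simp [hypCoeff_zero]
  | succ n ih =>
    have h1 : c + n ≠ 0 := by positivity
    have h2 : c + 1 + n ≠ 0 := by positivity
    have h3 : (1 : ℝ) + n ≠ 0 := by positivity
    rw [hypCoeff_succ, hypCoeff_succ, ← mul_assoc c, ← ih]
    push_cast
    field_simp
    ring

/-- With A_n the coefficients for c, the difference of the n-th terms of the two sides is c(n A_n -
(n+1) A_{n+1}). The sum telescopes, and n A_n → 0 by the decay of the coefficients. -/
lemma hyp_one_step (a b : ℝ) {c : ℝ} (hc : 0 < c) (h : 0 < c - a - b) :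
    c * (c - a - b) * hyp a b c 1 = (c - a) * (c - b) * hyp a b (c + 1) 1 := by
  obtain ⟨K, e, he, hK⟩ := exists_hypCoeff_le a b hc h
  have s0 := (summable_abs_hypCoeff a b hc h).of_abs
  have s1 := (summable_abs_hypCoeff a b (c := c + 1) (by linarith) (by linarith)).of_abs
  have hid (n : ℕ) : c * (c - a - b) * hypCoeff a b c n - (c - a) * (c - b) * hypCoeff a b (c + 1) n
      = c * (n * hypCoeff a b c n) - c * ((n + 1 : ℕ) * hypCoeff a b c (n + 1)) := by
    have h1 : c + n ≠ 0 := by positivity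
    have h3 : (1 : ℝ) + n ≠ 0 := by positivity
    have h4 := hypCoeff_add_one a b hc n
    have h5 : (c + n) * ((n + 1) * hypCoeff a b c (n + 1)) =
        hypCoeff a b c n * ((a + n) * (b + n)) := by
      rw [hypCoeff_succ]; field_simp; ring
    apply mul_left_cancel₀ h1
    push_cast
    linear_combination (-(c - a) * (c - b)) * h4 + c * h5
  have hlim : Tendsto (fun n : ℕ => (n : ℝ) * hypCoeff a b c n) atTop (𝓝 0) := by
    have hl : Tendsto (fun n : ℕ => K * ((n : ℝ) + 1) ^ (-(e - 1))) atTop (𝓝 0) := by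
      have h1 := (tendsto_rpow_neg_atTop (show 0 < e - 1 by linarith)).comp
        (tendsto_natCast_atTop_atTop (R := ℝ).atTop_add (tendsto_const_nhds (x := (1 : ℝ))))
      simpa using h1.const_mul K
    refine squeeze_zero_norm (fun n => ?_) hl
    rw [Real.norm_eq_abs, abs_mul, Nat.abs_cast]
    have hp : (0 : ℝ) < n + 1 := by positivity
    calc (n : ℝ) * |hypCoeff a b c n| ≤ (n + 1) * (K * ((n : ℝ) + 1) ^ (-e)) := by
          have := hK n
          gcongr
          linarith
      _ = K * (((n : ℝ) + 1) ^ (1 : ℝ) * ((n : ℝ) + 1) ^ (-e)) := by rw [rpow_one]; ring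
      _ = _ := by rw [← rpow_add hp]; ring_nf
  have hs := (s0.mul_left (c * (c - a - b))).sub (s1.mul_left ((c - a) * (c - b)))
  have h2 := hs.hasSum.tendsto_sum_nat
  simp only [hid] at h2
  simp_rw [Finset.sum_range_sub'] at h2
  have h3 := tendsto_nhds_unique h2 ((tendsto_const_nhds
    (x := c * ((0 : ℕ) * hypCoeff a b c 0))).sub (hlim.const_mul c))
  simp only [← hid] at h3
  rw [(s0.mul_left _).tsum_sub (s1.mul_left _), tsum_mul_left, tsum_mul_left] at h3
  simp only [hyp, one_pow, mul_one]
  simp at h3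
  linarith

lemma abs_hypCoeff_anti (a b : ℝ) {c c' : ℝ} (hc : 0 < c) (h : c ≤ c') (n : ℕ) :
    |hypCoeff a b c' n| ≤ |hypCoeff a b c n| := by
  induction n with
  | zero => simp [hypCoeff_zero]
  | succ n ih =>
    have h2 : 0 ≤ |(a + n) * (b + n)| / ((c' + n) * (1 + n)) := by
      have : 0 < c' + n := by linarith [(Nat.cast_nonneg n : (0 : ℝ) ≤ n)]
      positivity
    rw [hypCoeff_succ, hypCoeff_succ, abs_mul, abs_mul, abs_div, abs_div, abs_mul (c' + n),
      abs_mul (c + n), abs_of_pos (show 0 < c + n by positivity),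
      abs_of_pos (show 0 < c' + n by linarith [(Nat.cast_nonneg n : (0 : ℝ) ≤ n)]),
      abs_of_pos (show (0 : ℝ) < 1 + n by positivity)]
    gcongr

/-- Every coefficient with n ≥ 1 tends to 0 as the third parameter grows. The coefficients decrease
in absolute value in that parameter, so those for c dominate. -/
lemma tendsto_hyp_one_add_nat (a b : ℝ) {c : ℝ} (hc : 0 < c) (h : 0 < c - a - b) :
    Tendsto (fun m : ℕ => hyp a b (c + m) 1) atTop (𝓝 1) := by
  have hto (n : ℕ) : Tendsto (fun m : ℕ => hypCoeff a b (c + m) n * 1 ^ n) atTop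
      (𝓝 (if n = 0 then 1 else 0)) := by
    cases n with
    | zero => simp [hypCoeff_zero]
    | succ n =>
      have hc' : Tendsto (fun m : ℕ => c + (m : ℝ) + n) atTop atTop :=
        tendsto_atTop_add_const_right _ _
          (tendsto_atTop_add_const_left _ _ tendsto_natCast_atTop_atTop)
      have h1 : Tendsto (fun m : ℕ => |hypCoeff a b c n| *
          |(a + n) * (b + n) / (1 + n)| * (c + (m : ℝ) + n)⁻¹) atTop (𝓝 0) := by
        simpa using hc'.inv_tendsto_atTop.const_mul (|hypCoeff a b c n| *
          |(a + n) * (b + n) / (1 + n)|)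
      simp only [one_pow, mul_one, Nat.add_eq_zero_iff, one_ne_zero, and_false, if_false]
      refine squeeze_zero_norm (fun m => ?_) h1
      rw [hypCoeff_succ, Real.norm_eq_abs, mul_comm (c + _ + _), ← div_div,
        div_eq_mul_inv _ (c + _ + _), abs_mul, abs_mul (_ / _), ← mul_assoc,
        abs_of_pos (show 0 < (c + (m : ℝ) + n)⁻¹ by positivity)]
      gcongr ?_ * _ * _
      exact abs_hypCoeff_anti a b hc (le_add_of_nonneg_right m.cast_nonneg) n
  have := tendsto_tsum_of_dominated_convergence (summable_abs_hypCoeff a b hc h) hto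
    (Eventually.of_forall fun m n => by
      simpa using abs_hypCoeff_anti a b hc (le_add_of_nonneg_right m.cast_nonneg : c ≤ c + m) n)
  simpa [hyp] using this

lemma hyp_one_eq_prod (a b : ℝ) {c : ℝ} (hc : 0 < c) (h : 0 < c - a - b) (m : ℕ) :
    hyp a b c 1 = (∏ j ∈ Finset.range m, ((c - a + j) * (c - b + j) / ((c + j) * (c - a - b + j)))) *
      hyp a b (c + m) 1 := by
  induction m with
  | zero => simp
  | succ m ih =>
    have h1 : 0 < c + m := by positivity
    have h2 : 0 < c - a - b + m := by positivity
    have := hyp_one_step a b h1 (by linarith)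
    rw [ih, Finset.prod_range_succ, mul_assoc]
    congr 1
    push_cast
    rw [← add_assoc, div_mul_eq_mul_div, eq_div_iff (by positivity)]
    linear_combination this

/-- Stated for reciprocals because c-a and c-b may be poles of Γ. At x = -m the product under
`GammaSeq` is 0 for n ≥ m, so the inverse is 0, in accordance with 1/Γ = 0. -/
lemma tendsto_inv_GammaSeq (x : ℝ) :
    Tendsto (fun n => (GammaSeq x n)⁻¹) atTop (𝓝 (Gamma x)⁻¹) := by
  by_cases hx : Gamma x = 0
  · obtain ⟨m, hm⟩ := (Gamma_eq_zero_iff x).1 hx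
    rw [hx, inv_zero]
    refine tendsto_const_nhds.congr' ?_
    filter_upwards [eventually_ge_atTop m] with n hn
    have : ∏ j ∈ Finset.range (n + 1), (x + j) = 0 :=
      Finset.prod_eq_zero (Finset.mem_range.2 (by omega : m < n + 1)) (by rw [hm]; simp)
    rw [GammaSeq, this]; simp
  · exact (GammaSeq_tendsto_Gamma x).inv₀ hx

/-- Gauss's summation theorem. -/
theorem hyp_one (a b : ℝ) {c : ℝ} (hc : 0 < c) (h : 0 < c - a - b) :
    hyp a b c 1 = Gamma c * Gamma (c - a - b) / (Gamma (c - a) * Gamma (c - b)) := by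
  have l1 := ((GammaSeq_tendsto_Gamma c).mul (GammaSeq_tendsto_Gamma (c - a - b))).mul
    ((tendsto_inv_GammaSeq (c - a)).mul (tendsto_inv_GammaSeq (c - b)))
  have l2 := l1.mul ((tendsto_add_atTop_iff_nat 1).2 (tendsto_hyp_one_add_nat a b hc h))
  rw [mul_one, ← mul_inv, ← div_eq_mul_inv] at l2
  refine tendsto_nhds_unique (tendsto_const_nhds.congr' ?_) l2
  filter_upwards [eventually_gt_atTop 0] with n hn
  -- The finite product is exactly a quotient of Euler's products for Γ: the powers of n cancel
  -- because c + (c-a-b) = (c-a) + (c-b).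
  rw [hyp_one_eq_prod a b hc h (n + 1)]
  congr 1
  have hn' : (0 : ℝ) < n := by exact_mod_cast hn
  simp only [GammaSeq, Finset.prod_div_distrib, Finset.prod_mul_distrib, inv_div]
  have h1 : ∏ j ∈ Finset.range (n + 1), (c + j) ≠ 0 :=
    Finset.prod_ne_zero_iff.2 fun j _ => by positivity
  have h2 : ∏ j ∈ Finset.range (n + 1), (c - a - b + j) ≠ 0 :=
    Finset.prod_ne_zero_iff.2 fun j _ => by positivity
  have h3 : ((n.factorial : ℕ) : ℝ) ≠ 0 := by positivity
  have h4 : (n : ℝ) ^ c * (n : ℝ) ^ (c - a - b) = (n : ℝ) ^ (c - a) * (n : ℝ) ^ (c - b) := by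
    rw [← rpow_add hn', ← rpow_add hn']; ring_nf
  have h5 : (n : ℝ) ^ (c - a) ≠ 0 := by positivity
  have h6 : (n : ℝ) ^ (c - b) ≠ 0 := by positivity
  field_simp
  linear_combination (-(∏ j ∈ Finset.range (n + 1), (c - a + j)) *
    (∏ j ∈ Finset.range (n + 1), (c - b + j))) * h4

/-! ### The angular solutions -/

lemma eq_left_of_hasDerivAt_zero {f : ℝ → ℝ} {a b z : ℝ} (hf : ContinuousOn f (Ico a b))
    (hd : ∀ x ∈ Ioo a b, HasDerivAt f 0 x) (hz : z ∈ Ioo a b) : f z = f a := by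
  obtain ⟨c, hc, h⟩ := exists_hasDerivAt_eq_slope f (fun _ => 0) hz.1
    (hf.mono fun x hx => ⟨hx.1, hx.2.trans_lt hz.2⟩) fun x hx => hd x ⟨hx.1, hx.2.trans hz.2⟩
  have : z - a ≠ 0 := sub_ne_zero.2 hz.1.ne'
  field_simp at h
  linarith

/-- The Wronskian of two solutions of the system `f' = A g`, `g' = B f` has zero derivative. -/
lemma hasDerivAt_wronskian {f₁ g₁ f₂ g₂ : ℝ → ℝ} {A B z : ℝ}
    (hf₁ : HasDerivAt f₁ (A * g₁ z) z) (hg₁ : HasDerivAt g₁ (B * f₁ z) z)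
    (hf₂ : HasDerivAt f₂ (A * g₂ z) z) (hg₂ : HasDerivAt g₂ (B * f₂ z) z) :
    HasDerivAt (fun z => f₁ z * g₂ z - g₁ z * f₂ z) 0 z :=
  ((hf₁.mul hg₂).sub (hg₁.mul hf₂)).congr_deriv (by ring)

/-- The solution `z^s F(s-β, β+1-s; 1+s; z)` of the angular equation, `z = (1 + cos θ) / 2`; it
vanishes at `z = 0`. -/
def angP (s β z : ℝ) : ℝ := z ^ s * hyp (s - β) (β + 1 - s) (1 + s) z

/-- The normalised flux `F(2s-1-β, β; s; z)` of `angP`. -/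
def angQ (s β z : ℝ) : ℝ := hyp (2 * s - 1 - β) β s z

/-- The flux of `angP` in terms of the derivative of the hypergeometric function. -/
def angFlux (s β z : ℝ) : ℝ :=
  (1 - z) ^ (1 - s) * (hyp (s - β) (β + 1 - s) (1 + s) z + z * ((s - β) * (β + 1 - s) / (1 + s) *
    hyp (s - β + 1) (β + 1 - s + 1) (1 + s + 1) z) / s)

lemma abs_lt_one_of_mem {z : ℝ} (hz : z ∈ Ico (0 : ℝ) 1) : |z| < 1 := by
  rw [abs_of_nonneg hz.1]; exact hz.2

lemma continuousOn_hyp_Ico (a b : ℝ) {c : ℝ} (hc : 0 < c) : ContinuousOn (hyp a b c) (Ico 0 1) :=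
  fun _ hz => (hasDerivAt_hyp a b hc (abs_lt_one_of_mem hz)).continuousAt.continuousWithinAt

lemma continuousOn_angFlux {s : ℝ} (hs0 : 0 < s) (hs1 : s < 1) (β : ℝ) :
    ContinuousOn (angFlux s β) (Ico 0 1) := by
  refine ContinuousOn.mul (ContinuousOn.rpow_const (by fun_prop) fun z hz => ?_) ?_
  · right; linarith
  · exact (continuousOn_hyp_Ico _ _ (by linarith)).add ((continuousOn_id.mul
      ((continuousOn_hyp_Ico _ _ (by linarith)).const_mul _)).div_const _)

lemma angFlux_zero (s β : ℝ) : angFlux s β 0 = 1 := by simp [angFlux, hyp_zero]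

lemma angP_zero {s : ℝ} (hs : s ≠ 0) (β : ℝ) : angP s β 0 = 0 := by simp [angP, zero_rpow hs]

lemma continuousOn_angP {s : ℝ} (hs : 0 < s) (β : ℝ) : ContinuousOn (angP s β) (Icc 0 1) :=
  (continuousOn_id.rpow_const fun _ _ => Or.inr hs.le).mul
    (continuousOn_hyp _ _ (by linarith) (by linarith))

lemma continuousOn_angQ {s : ℝ} (hs0 : 0 < s) (hs1 : s < 1) (β : ℝ) :
    ContinuousOn (angQ s β) (Icc 0 1) :=
  continuousOn_hyp _ _ hs0 (by linarith)

lemma angQ_zero (s β : ℝ) : angQ s β 0 = 1 := hyp_zero _ _ _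

lemma hasDerivAt_angP_flux {s : ℝ} (hs0 : 0 < s) (β : ℝ) {z : ℝ} (hz : z ∈ Ioo (0 : ℝ) 1) :
    HasDerivAt (angP s β) (s * (z * (1 - z)) ^ (s - 1) * angFlux s β z) z := by
  have h1 : 0 < 1 - z := by linarith [hz.2]
  have hy := hasDerivAt_hyp (s - β) (β + 1 - s) (show 0 < 1 + s by linarith)
    (abs_lt_one_of_mem ⟨hz.1.le, hz.2⟩)
  refine ((Real.hasDerivAt_rpow_const (p := s) (Or.inl hz.1.ne')).mul hy).congr_deriv ?_
  rw [angFlux, mul_rpow hz.1.le h1.le]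
  have e1 : (1 - z) ^ (s - 1) * (1 - z) ^ (1 - s) = 1 := by
    rw [← rpow_add h1]; simp
  have e2 : z ^ s = z ^ (s - 1) * z := by
    rw [← rpow_add_one hz.1.ne']; ring_nf
  rw [e2]
  field_simp
  linear_combination (-z ^ (s - 1) * (s * hyp (s - β) (β + 1 - s) (1 + s) z * (1 + s) +
    z * (s - β) * (β + 1 - s) * hyp (s - β + 1) (β + 1 - s + 1) (1 + s + 1) z)) * e1

lemma hasDerivAt_angFlux {s : ℝ} (hs0 : 0 < s) (β : ℝ) {z : ℝ} (hz : z ∈ Ioo (0 : ℝ) 1) :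
    HasDerivAt (angFlux s β)
      (-(β * (β + 1 - 2 * s) / s) * (z * (1 - z)) ^ (-s) * angP s β z) z := by
  have h1 : 0 < 1 - z := by linarith [hz.2]
  have hz' := abs_lt_one_of_mem ⟨hz.1.le, hz.2⟩
  have hy := hasDerivAt_hyp (s - β) (β + 1 - s) (show 0 < 1 + s by linarith) hz'
  have hy' := hasDerivAt_hyp (s - β + 1) (β + 1 - s + 1) (show 0 < 1 + s + 1 by linarith) hz'
  have hode := hyp_contiguous (s - β) (β + 1 - s) (show 0 < 1 + s by linarith) hz'
  have hr : HasDerivAt (fun z : ℝ => (1 - z) ^ (1 - s)) (-1 * (1 - s) * (1 - z) ^ (1 - s - 1)) z :=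
    ((hasDerivAt_id z).const_sub 1).rpow_const (Or.inl h1.ne')
  refine (hr.mul (hy.add (((hasDerivAt_id z).mul (hy'.const_mul _)).div_const s))).congr_deriv ?_
  rw [angP, mul_rpow hz.1.le h1.le]
  have e1 : z ^ (-s) * z ^ s = 1 := by rw [← rpow_add hz.1]; simp
  have e2 : (1 - z) ^ (1 - s) = (1 - z) ^ (-s) * (1 - z) := by
    rw [← rpow_add_one h1.ne']; ring_nf
  have e3 : 1 - s - 1 = -s := by ring
  rw [e2, e3]
  simp only [id, Pi.mul_apply, Pi.add_apply]
  rw [show s - β + 2 = s - β + 1 + 1 by ring, show β + 1 - s + 2 = β + 1 - s + 1 + 1 by ring,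
    show 1 + s + 2 = 1 + s + 1 + 1 by ring] at hode
  set F := hyp (s - β) (β + 1 - s) (1 + s) z
  set F1 := hyp (s - β + 1) (β + 1 - s + 1) (1 + s + 1) z
  set F2 := hyp (s - β + 1 + 1) (β + 1 - s + 1 + 1) (1 + s + 1 + 1) z
  have h2 : 1 + s ≠ 0 := by linarith
  have hode2 : z * (1 - z) * ((s - β + 1) * (β + 1 - s + 1) / (1 + s + 1) * F2) * (1 + s)⁻¹ +
      (1 + s - (s - β + (β + 1 - s) + 1) * z) * F1 * (1 + s)⁻¹ - F = 0 := by
    have h3 : (1 + s) * (1 + s)⁻¹ = 1 := mul_inv_cancel₀ h2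
    linear_combination (1 + s)⁻¹ * hode + F * h3
  have hs : s * s⁻¹ = 1 := mul_inv_cancel₀ hs0.ne'
  rw [div_eq_mul_inv _ (1 + s), div_eq_mul_inv _ s, div_eq_mul_inv _ s, div_eq_mul_inv _ s]
  linear_combination (1 - z) ^ (-s) * (s - β) * (β + 1 - s) * s⁻¹ * hode2 -
    (1 - z) ^ (-s) * (1 - z) * (s - β) * (β + 1 - s) * (1 + s)⁻¹ * F1 * hs +
    (1 - s) * (1 - z) ^ (-s) * F * hs +
    β * (β + 1 - 2 * s) * s⁻¹ * (1 - z) ^ (-s) * F * e1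

/-- The substitution (s, β) ↦ (1-s, β+1-2s) leaves β(β+1-2s) unchanged and interchanges the weights
(z(1-z))^{s-1} and (z(1-z))^{-s}. -/
lemma hasDerivAt_angFlux_dual {s : ℝ} (hs1 : s < 1) (β : ℝ) {z : ℝ}
    (hz : z ∈ Ioo (0 : ℝ) 1) :
    HasDerivAt (angFlux (1 - s) (β + 1 - 2 * s)) (-(β * (β + 1 - 2 * s) / (1 - s)) *
      (z * (1 - z)) ^ (s - 1) * angP (1 - s) (β + 1 - 2 * s) z) z := by
  refine (hasDerivAt_angFlux (show 0 < 1 - s by linarith) (β + 1 - 2 * s) hz).congr_deriv ?_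
  rw [show -(1 - s) = s - 1 by ring]; ring

lemma hasDerivAt_angP_dual_flux {s : ℝ} (hs1 : s < 1) (β : ℝ) {z : ℝ}
    (hz : z ∈ Ioo (0 : ℝ) 1) :
    HasDerivAt (angP (1 - s) (β + 1 - 2 * s)) ((1 - s) * (z * (1 - z)) ^ (-s) *
      angFlux (1 - s) (β + 1 - 2 * s) z) z := by
  refine (hasDerivAt_angP_flux (show 0 < 1 - s by linarith) (β + 1 - 2 * s) hz).congr_deriv ?_
  rw [show 1 - s - 1 = -s by ring]

/-- A Legendre-type relation: the expression is a Wronskian of the solution and its dual, so it is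
constant, and at z = 0 both fluxes are 1 while both functions vanish. -/
lemma angFlux_mul_angFlux {s : ℝ} (hs0 : 0 < s) (hs1 : s < 1) (β : ℝ) {z : ℝ}
    (hz : z ∈ Ioo (0 : ℝ) 1) :
    angFlux s β z * angFlux (1 - s) (β + 1 - 2 * s) z + β * (β + 1 - 2 * s) / (s * (1 - s)) *
      (angP s β z * angP (1 - s) (β + 1 - 2 * s) z) = 1 := by
  have hs1' : 0 < 1 - s := by linarith
  have key := eq_left_of_hasDerivAt_zero (a := 0) (b := 1)
    (f := fun z => angFlux s β z * angFlux (1 - s) (β + 1 - 2 * s) z +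
      β * (β + 1 - 2 * s) / (s * (1 - s)) * (angP s β z * angP (1 - s) (β + 1 - 2 * s) z))
    (((continuousOn_angFlux hs0 hs1 β).mul
      (continuousOn_angFlux hs1' (by linarith) (β + 1 - 2 * s))).add
      (continuousOn_const.mul (((continuousOn_angP hs0 β).mul
        (continuousOn_angP hs1' _)).mono Ico_subset_Icc_self)))
    (fun x hx => (((hasDerivAt_angFlux hs0 β hx).mul (hasDerivAt_angFlux_dual hs1 β hx)).add
      (((hasDerivAt_angP_flux hs0 β hx).mul
        (hasDerivAt_angP_dual_flux hs1 β hx)).const_mul _)).congr_deriv (by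
          field_simp; ring)) hz
  simpa [angFlux_zero, angP_zero hs0.ne'] using key

/-- In `angFlux` a factor (1-z)^{1-s} multiplies a series whose parameters have c-a-b = s-1 < 0, so
its value at z = 1 is hidden. For `angQ`, c-a-b = 1-s > 0 and Gauss's sum applies. The two agree
because (`angQ`, g) and (`angFlux`, a multiple of `angP`) solve the dual system with the same data
at z = 0. -/
lemma angQ_eq_angFlux {s : ℝ} (hs0 : 0 < s) (hs1 : s < 1) (β : ℝ) {z : ℝ}
    (hz : z ∈ Ioo (0 : ℝ) 1) : angQ s β z = angFlux s β z := by
  have hs1' : 0 < 1 - s := by linarith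
  set μ := β * (β + 1 - 2 * s) / (s * (1 - s)) with hμ
  set F1 : ℝ → ℝ := hyp (2 * s - 1 - β + 1) (β + 1) (s + 1)
  set K := (2 * s - 1 - β) * β / s with hK
  set g : ℝ → ℝ := fun z => (z * (1 - z)) ^ s * (K * F1 z) / (1 - s) with hg
  have hQ : ∀ x ∈ Ico (0 : ℝ) 1, HasDerivAt (angQ s β) (K * F1 x) x := fun x hx =>
    hasDerivAt_hyp _ _ hs0 (abs_lt_one_of_mem hx)
  have hgc : ContinuousOn g (Ico 0 1) :=
    ((ContinuousOn.rpow_const (by fun_prop) fun x _ => Or.inr hs0.le).mul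
      ((continuousOn_hyp_Ico _ _ (by linarith)).const_mul _)).div_const _
  have hgd : ∀ x ∈ Ioo (0 : ℝ) 1, HasDerivAt g
      (-(β * (β + 1 - 2 * s) / (1 - s)) * (x * (1 - x)) ^ (s - 1) * angQ s β x) x := by
    intro x hx
    have hx' : |x| < 1 := abs_lt_one_of_mem ⟨hx.1.le, hx.2⟩
    have hxx : 0 < x * (1 - x) := mul_pos hx.1 (by linarith [hx.2])
    have hp : HasDerivAt (fun x : ℝ => (x * (1 - x)) ^ s)
        ((1 * (1 - x) + x * -1) * s * (x * (1 - x)) ^ (s - 1)) x :=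
      ((hasDerivAt_id x).mul ((hasDerivAt_id x).const_sub 1)).rpow_const (Or.inl hxx.ne')
    have hode := hyp_contiguous (2 * s - 1 - β) β hs0 hx'
    refine ((hp.mul ((hasDerivAt_hyp (2 * s - 1 - β + 1) (β + 1) (show 0 < s + 1 by linarith)
      hx').const_mul K)).div_const (1 - s)).congr_deriv ?_
    have e : (x * (1 - x)) ^ s = (x * (1 - x)) ^ (s - 1) * (x * (1 - x)) := by
      rw [← rpow_add_one hxx.ne']; ring_nf
    rw [e, angQ]
    rw [show 2 * s - 1 - β + 2 = 2 * s - 1 - β + 1 + 1 by ring,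
      show β + 2 = β + 1 + 1 by ring, show s + 2 = s + 1 + 1 by ring] at hode
    change _ + _ * F1 x - _ = 0 at hode
    change (_ * (K * F1 x) + _) / _ = _
    set F2 := hyp (2 * s - 1 - β + 1 + 1) (β + 1 + 1) (s + 1 + 1) x
    have h2 : 1 - s ≠ 0 := hs1'.ne'
    have hKs : K * s = (2 * s - 1 - β) * β := by rw [hK]; field_simp
    rw [div_eq_iff h2]
    have : -(β * (β + 1 - 2 * s) / (1 - s)) * (x * (1 - x)) ^ (s - 1) *
        hyp (2 * s - 1 - β) β s x * (1 - s) = K * s * ((x * (1 - x)) ^ (s - 1) *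
        hyp (2 * s - 1 - β) β s x) := by rw [hKs]; field_simp; ring
    rw [this]
    linear_combination (x * (1 - x)) ^ (s - 1) * K * hode
  -- The Wronskian of those two pairs is constant and vanishes at z = 0. The next one, with the dual
  -- solution, equals 1; with `angFlux_mul_angFlux` the two determine `angQ` by linear algebra.
  have c1 : g z * angFlux s β z + μ * (angQ s β z * angP s β z) = 0 := by
    have := eq_left_of_hasDerivAt_zero (a := 0) (b := 1)
      (f := fun z => g z * angFlux s β z + μ * (angQ s β z * angP s β z))
      ((hgc.mul (continuousOn_angFlux hs0 hs1 β)).add (continuousOn_const.mul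
        (((continuousOn_angQ hs0 hs1 β).mul (continuousOn_angP hs0 β)).mono Ico_subset_Icc_self)))
      (fun x hx => (((hgd x hx).mul (hasDerivAt_angFlux hs0 β hx)).add
        (((hQ x ⟨hx.1.le, hx.2⟩).mul (hasDerivAt_angP_flux hs0 β hx)).const_mul μ)).congr_deriv (by
          have hxx : 0 < x * (1 - x) := mul_pos hx.1 (by linarith [hx.2])
          have e : (x * (1 - x)) ^ s * (x * (1 - x)) ^ (-s) = 1 := by
            rw [← rpow_add hxx]; simp
          simp only [hg, hμ]
          field_simp
          linear_combination (-K * F1 x * β * (β + 1 - 2 * s) * angP s β x) * e)) hz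
    simpa [angFlux_zero, angP_zero hs0.ne', hg, zero_rpow hs0.ne'] using this
  have c2 : angFlux (1 - s) (β + 1 - 2 * s) z * angQ s β z -
      angP (1 - s) (β + 1 - 2 * s) z * g z = 1 := by
    have := eq_left_of_hasDerivAt_zero (a := 0) (b := 1)
      (f := fun z => angFlux (1 - s) (β + 1 - 2 * s) z * angQ s β z -
        angP (1 - s) (β + 1 - 2 * s) z * g z)
      (((continuousOn_angFlux hs1' (by linarith) (β + 1 - 2 * s)).mul
        ((continuousOn_angQ hs0 hs1 β).mono Ico_subset_Icc_self)).sub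
        (((continuousOn_angP hs1' _).mono Ico_subset_Icc_self).mul hgc))
      (fun x hx => (((hasDerivAt_angFlux_dual hs1 β hx).mul (hQ x ⟨hx.1.le, hx.2⟩)).sub
        ((hasDerivAt_angP_dual_flux hs1 β hx).mul (hgd x hx))).congr_deriv (by
          have hxx : 0 < x * (1 - x) := mul_pos hx.1 (by linarith [hx.2])
          have e : (x * (1 - x)) ^ s * (x * (1 - x)) ^ (-s) = 1 := by
            rw [← rpow_add hxx]; simp
          simp only [hg]
          field_simp
          linear_combination
            (-K * F1 x * (1 - s) * angFlux (1 - s) (β + 1 - 2 * s) x) * e)) hz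
    simpa [angFlux_zero, angP_zero hs1'.ne', hg, angQ_zero] using this
  have hL := angFlux_mul_angFlux hs0 hs1 β hz
  rw [← hμ] at hL
  linear_combination (-angQ s β z) * hL + angP (1 - s) (β + 1 - 2 * s) z * c1 + angFlux s β z * c2

lemma hasDerivAt_angP {s : ℝ} (hs0 : 0 < s) (hs1 : s < 1) (β : ℝ) {z : ℝ}
    (hz : z ∈ Ioo (0 : ℝ) 1) :
    HasDerivAt (angP s β) (s * (z * (1 - z)) ^ (s - 1) * angQ s β z) z := by
  rw [angQ_eq_angFlux hs0 hs1 β hz]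
  exact hasDerivAt_angP_flux hs0 β hz

lemma hasDerivAt_angQ {s : ℝ} (hs0 : 0 < s) (hs1 : s < 1) (β : ℝ) {z : ℝ}
    (hz : z ∈ Ioo (0 : ℝ) 1) :
    HasDerivAt (angQ s β) (-(β * (β + 1 - 2 * s) / s) * (z * (1 - z)) ^ (-s) * angP s β z) z :=
  (hasDerivAt_angFlux hs0 β hz).congr_of_eventuallyEq (by
    filter_upwards [Ioo_mem_nhds hz.1 hz.2] with x hx using angQ_eq_angFlux hs0 hs1 β hx)

/-- The solution of the angular equation that is regular and equal to `1` at `z = 0`. -/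
def angX (s β z : ℝ) : ℝ := angQ (1 - s) (β + 1 - 2 * s) z

/-- The normalised flux of `angX`. -/
def angY (s β z : ℝ) : ℝ :=
  -(β * (β + 1 - 2 * s) / (s * (1 - s))) * angP (1 - s) (β + 1 - 2 * s) z

lemma hasDerivAt_angX {s : ℝ} (hs0 : 0 < s) (hs1 : s < 1) (β : ℝ) {z : ℝ}
    (hz : z ∈ Ioo (0 : ℝ) 1) :
    HasDerivAt (angX s β) (s * (z * (1 - z)) ^ (s - 1) * angY s β z) z := by
  have := hasDerivAt_angQ (s := 1 - s) (by linarith) (by linarith) (β + 1 - 2 * s) hz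
  refine this.congr_deriv ?_
  have h1 : 1 - s ≠ 0 := by linarith
  rw [angY, show -(1 - s) = s - 1 by ring]
  field_simp
  ring

lemma hasDerivAt_angY {s : ℝ} (hs0 : 0 < s) (hs1 : s < 1) (β : ℝ) {z : ℝ}
    (hz : z ∈ Ioo (0 : ℝ) 1) :
    HasDerivAt (angY s β) (-(β * (β + 1 - 2 * s) / s) * (z * (1 - z)) ^ (-s) * angX s β z) z := by
  have := (hasDerivAt_angP (s := 1 - s) (by linarith) (by linarith) (β + 1 - 2 * s) hz).const_mul
    (-(β * (β + 1 - 2 * s) / (s * (1 - s))))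
  refine this.congr_deriv ?_
  have h1 : 1 - s ≠ 0 := by linarith
  rw [angX, show 1 - s - 1 = -s by ring]
  field_simp

/-- The normalised Wronskian: the two solutions are independent, and `angP`, `angQ` never vanish
together in (0, 1). -/
lemma angP_mul_angY_sub {s : ℝ} (hs0 : 0 < s) (hs1 : s < 1) (β : ℝ) {z : ℝ}
    (hz : z ∈ Ioo (0 : ℝ) 1) : angP s β z * angY s β z - angQ s β z * angX s β z = -1 := by
  have h := angFlux_mul_angFlux hs0 hs1 β hz
  rw [← angQ_eq_angFlux hs0 hs1 β hz,
    ← angQ_eq_angFlux (by linarith : 0 < 1 - s) (by linarith) (β + 1 - 2 * s) hz] at h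
  rw [angY, angX]
  linear_combination -h

lemma continuousOn_angX {s : ℝ} (hs0 : 0 < s) (hs1 : s < 1) (β : ℝ) :
    ContinuousOn (angX s β) (Icc 0 1) := continuousOn_angQ (by linarith) (by linarith) _

lemma angX_zero (s β : ℝ) : angX s β 0 = 1 := angQ_zero _ _

/-- For β > -1 this vanishes exactly at the poles of Γ(2s-β), that is β-2s ∈ ℕ. There the solution
cannot be normalised to 1 on the positive half-line, whence the excluded exponents. -/
lemma angP_one {s : ℝ} (hs0 : 0 < s) (β : ℝ) :
    angP s β 1 = Gamma (1 + s) * Gamma s / (Gamma (1 + β) * Gamma (2 * s - β)) := by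
  rw [angP, one_rpow, one_mul, hyp_one _ _ (by linarith) (by linarith)]
  ring_nf

lemma angQ_one {s : ℝ} (hs0 : 0 < s) (hs1 : s < 1) (β : ℝ) :
    angQ s β 1 = sin (π * (s - β)) / sin (π * s) := by
  have h1 := Gamma_mul_Gamma_one_sub s
  have h2 := Gamma_mul_Gamma_one_sub (s - β)
  rw [angQ, hyp_one _ _ hs0 (by linarith), show s - (2 * s - 1 - β) - β = 1 - s by ring, h1,
    show s - (2 * s - 1 - β) = 1 - (s - β) by ring, mul_comm (Gamma (1 - (s - β))), h2]
  have := pi_ne_zero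
  by_cases h : sin (π * (s - β)) = 0
  -- Here s-β is an integer and Γ(s-β)Γ(1-s+β) is read as 0, so both sides are 0.
  · simp [h]
  · field_simp

/-- Every solution of the angular system, in an arbitrary parametrisation `z` of `(0, 1)`, is a
combination of the two explicit ones. -/
lemma exists_angular_combination {s : ℝ} (hs0 : 0 < s) (hs1 : s < 1) (β : ℝ) {I : Set ℝ}
    (hI : IsOpen I) (hI' : IsPreconnected I) {z z' f g : ℝ → ℝ}
    (hz : ∀ t ∈ I, z t ∈ Ioo (0 : ℝ) 1) (hzd : ∀ t ∈ I, HasDerivAt z (z' t) t)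
    (hf : ∀ t ∈ I, HasDerivAt f (s * (z t * (1 - z t)) ^ (s - 1) * z' t * g t) t)
    (hg : ∀ t ∈ I, HasDerivAt g
      (-(β * (β + 1 - 2 * s) / s) * (z t * (1 - z t)) ^ (-s) * z' t * f t) t) :
    ∃ c₁ c₂ : ℝ, ∀ t ∈ I, f t = c₁ * angP s β (z t) + c₂ * angX s β (z t) ∧
      g t = c₁ * angQ s β (z t) + c₂ * angY s β (z t) := by
  have hP : ∀ t ∈ I, HasDerivAt (fun t => angP s β (z t))
      (s * (z t * (1 - z t)) ^ (s - 1) * z' t * angQ s β (z t)) t := fun t ht =>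
    ((hasDerivAt_angP hs0 hs1 β (hz t ht)).comp t (hzd t ht)).congr_deriv (by ring)
  have hQ : ∀ t ∈ I, HasDerivAt (fun t => angQ s β (z t))
      (-(β * (β + 1 - 2 * s) / s) * (z t * (1 - z t)) ^ (-s) * z' t * angP s β (z t)) t :=
    fun t ht => ((hasDerivAt_angQ hs0 hs1 β (hz t ht)).comp t (hzd t ht)).congr_deriv (by ring)
  have hX : ∀ t ∈ I, HasDerivAt (fun t => angX s β (z t))
      (s * (z t * (1 - z t)) ^ (s - 1) * z' t * angY s β (z t)) t := fun t ht =>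
    ((hasDerivAt_angX hs0 hs1 β (hz t ht)).comp t (hzd t ht)).congr_deriv (by ring)
  have hY : ∀ t ∈ I, HasDerivAt (fun t => angY s β (z t))
      (-(β * (β + 1 - 2 * s) / s) * (z t * (1 - z t)) ^ (-s) * z' t * angX s β (z t)) t :=
    fun t ht => ((hasDerivAt_angY hs0 hs1 β (hz t ht)).comp t (hzd t ht)).congr_deriv (by ring)
  obtain rfl | ⟨t₀, ht₀⟩ := I.eq_empty_or_nonempty
  · exact ⟨0, 0, fun t ht => ht.elim⟩
  have hconst : ∀ F : ℝ → ℝ, (∀ t ∈ I, HasDerivAt F 0 t) → ∀ t ∈ I, F t = F t₀ :=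
    fun F hF t ht => hI.is_const_of_deriv_eq_zero hI'
      (fun x hx => (hF x hx).differentiableAt.differentiableWithinAt)
      (fun x hx => (hF x hx).deriv) ht ht₀
  -- The Wronskians of (f, g) with each basis solution are constant on I. Cramer's rule then gives
  -- the coefficients; the minus signs come from the basis Wronskian being -1.
  have h1 := hconst _ fun t ht => hasDerivAt_wronskian (hf t ht) (hg t ht) (hX t ht) (hY t ht)
  have h2 := hconst _ fun t ht => hasDerivAt_wronskian (hP t ht) (hQ t ht) (hf t ht) (hg t ht)
  refine ⟨-(f t₀ * angY s β (z t₀) - g t₀ * angX s β (z t₀)),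
    -(angP s β (z t₀) * g t₀ - angQ s β (z t₀) * f t₀), fun t ht => ?_⟩
  rw [← h1 t ht, ← h2 t ht]
  have hL := angP_mul_angY_sub hs0 hs1 β (hz t ht)
  exact ⟨by linear_combination f t * hL, by linear_combination g t * hL⟩

/-! ### Homogeneous functions in the half-plane -/

/-- The degenerate Laplacian of the `β`-homogeneous function `t ^ β h (x / t)`. -/
lemma deg_laplacian_homogeneous (s β : ℝ) {w : ℝ × ℝ → ℝ} {h h₁ h₂ : ℝ → ℝ}
    (hw : ∀ x t : ℝ, 0 < t → w (x, t) = t ^ β * h (x / t))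
    (h1 : ∀ y, HasDerivAt h (h₁ y) y) (h2 : ∀ y, HasDerivAt h₁ (h₂ y) y) (x : ℝ) {t : ℝ}
    (ht : 0 < t) :
    deriv (fun ξ => t ^ (1 - 2 * s) * deriv (fun η => w (η, t)) ξ) x +
      deriv (fun τ => τ ^ (1 - 2 * s) * deriv (fun σ => w (x, σ)) τ) t =
    t ^ (β - 1 - 2 * s) * ((1 + (x / t) ^ 2) * h₂ (x / t) -
      (2 * β - 1 - 2 * s) * (x / t) * h₁ (x / t) + β * (β - 2 * s) * h (x / t)) := by
  have hx1 : ∀ ξ, deriv (fun η => w (η, t)) ξ = t ^ β * (h₁ (ξ / t) * (1 / t)) := fun ξ => by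
    have : (fun η => w (η, t)) = fun η => t ^ β * h (η / t) := funext fun η => hw η t ht
    rw [this]
    exact (((h1 (ξ / t)).comp ξ ((hasDerivAt_id ξ).div_const t)).const_mul _).deriv
  have hquot : ∀ τ : ℝ, 0 < τ → HasDerivAt (fun τ => x / τ) (-x / τ ^ 2) τ := fun τ hτ =>
    ((hasDerivAt_const τ x).div (hasDerivAt_id τ) hτ.ne').congr_deriv (by simp)
  have ht1 : ∀ τ : ℝ, 0 < τ → deriv (fun σ => w (x, σ)) τ =
      β * τ ^ (β - 1) * h (x / τ) + τ ^ β * (h₁ (x / τ) * (-x / τ ^ 2)) := fun τ hτ => by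
    have : (fun σ => w (x, σ)) =ᶠ[𝓝 τ] fun σ => σ ^ β * h (x / σ) := by
      filter_upwards [lt_mem_nhds hτ] with σ hσ using hw x σ hσ
    rw [this.deriv_eq]
    exact ((Real.hasDerivAt_rpow_const (Or.inl hτ.ne')).mul
      ((h1 (x / τ)).comp τ (hquot τ hτ))).deriv
  have ht2 : (fun τ => τ ^ (1 - 2 * s) * deriv (fun σ => w (x, σ)) τ) =ᶠ[𝓝 t]
      fun τ => β * τ ^ (β - 2 * s) * h (x / τ) - x * τ ^ (β - 1 - 2 * s) * h₁ (x / τ) := by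
    filter_upwards [lt_mem_nhds ht] with τ hτ
    rw [ht1 τ hτ]
    have e1 : τ ^ (β - 2 * s) = τ ^ (1 - 2 * s) * τ ^ (β - 1) := by
      rw [← rpow_add hτ]; ring_nf
    have e2 : τ ^ (β - 1 - 2 * s) * τ ^ (2 : ℝ) = τ ^ (1 - 2 * s) * τ ^ β := by
      rw [← rpow_add hτ, ← rpow_add hτ]; ring_nf
    rw [rpow_two] at e2
    rw [e1]
    field_simp
    linear_combination x * h₁ (x / τ) * e2
  have hx2 : HasDerivAt (fun ξ => t ^ (1 - 2 * s) * (t ^ β * (h₁ (ξ / t) * (1 / t))))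
      (t ^ (1 - 2 * s) * (t ^ β * (h₂ (x / t) * (1 / t) * (1 / t)))) x :=
    ((((h2 (x / t)).comp x ((hasDerivAt_id x).div_const t)).mul_const _).const_mul _).const_mul _
  have ht3 := (((Real.hasDerivAt_rpow_const (p := β - 2 * s) (Or.inl ht.ne')).const_mul β).mul
    ((h1 (x / t)).comp t (hquot t ht))).sub
    (((Real.hasDerivAt_rpow_const (p := β - 1 - 2 * s) (Or.inl ht.ne')).const_mul x).mul
    ((h2 (x / t)).comp t (hquot t ht)))
  simp only [hx1]
  rw [hx2.deriv, ht2.deriv_eq]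
  refine (congrArg₂ _ rfl ht3.deriv).trans ?_
  have e1 : t ^ (1 - 2 * s) * t ^ β = t ^ (β - 1 - 2 * s) * t ^ 2 := by
    rw [← rpow_two, ← rpow_add ht, ← rpow_add ht]; ring_nf
  have e2 : t ^ (β - 2 * s - 1) = t ^ (β - 1 - 2 * s) := by ring_nf
  have e3 : t ^ (β - 2 * s) = t ^ (β - 1 - 2 * s) * t := by
    rw [← rpow_add_one ht.ne']; ring_nf
  have e4 : t ^ (β - 1 - 2 * s - 1) = t ^ (β - 1 - 2 * s) / t := by
    rw [rpow_sub_one ht.ne']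
  simp only [Function.comp_apply]
  rw [e2, e3, e4, ← mul_assoc, e1]
  field_simp
  ring

/-- Reduction of the slice equation to the angular system. -/
lemma hasDerivAt_slice_flux (s β : ℝ) {h h₁ h₂ : ℝ → ℝ}
    (h1 : ∀ y, HasDerivAt h (h₁ y) y) (h2 : ∀ y, HasDerivAt h₁ (h₂ y) y) (y : ℝ) :
    HasDerivAt (fun y => (1 + y ^ 2) ^ (-β / 2) * h y)
      ((1 + y ^ 2) ^ (-β / 2) * (h₁ y - β * y * h y / (1 + y ^ 2))) y ∧
    HasDerivAt (fun y => (1 + y ^ 2) ^ (1 / 2 + s - β / 2) * (h₁ y - β * y * h y / (1 + y ^ 2)))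
      ((1 + y ^ 2) ^ (s - β / 2 - 1 / 2) * ((1 + y ^ 2) * h₂ y - (2 * β - 1 - 2 * s) * y * h₁ y +
        β * (β - 2 * s) * h y) - β * (β + 1 - 2 * s) * (1 + y ^ 2) ^ (s - β / 2 - 3 / 2) * h y) y := by
  have hm : 0 < 1 + y ^ 2 := by positivity
  have hmd : HasDerivAt (fun y : ℝ => 1 + y ^ 2) (2 * y) y :=
    ((hasDerivAt_pow 2 y).const_add 1).congr_deriv (by simp)
  constructor
  · refine ((hmd.rpow_const (p := -β / 2) (Or.inl hm.ne')).mul (h1 y)).congr_deriv ?_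
    rw [rpow_sub_one hm.ne']
    field_simp
    ring
  · refine ((hmd.rpow_const (p := 1 / 2 + s - β / 2) (Or.inl hm.ne')).mul ((h2 y).sub
      ((((hasDerivAt_id y).const_mul β).mul (h1 y)).div hmd hm.ne'))).congr_deriv ?_
    have e0 : (1 + y ^ 2) ^ (1 / 2 + s - β / 2 - 1) =
        (1 + y ^ 2) ^ (s - β / 2 - 3 / 2) * (1 + y ^ 2) := by
      rw [← rpow_add_one hm.ne']; ring_nf
    have e1 : (1 + y ^ 2) ^ (s - β / 2 - 1 / 2) =
        (1 + y ^ 2) ^ (s - β / 2 - 3 / 2) * (1 + y ^ 2) := by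
      rw [← rpow_add_one hm.ne']; ring_nf
    have e2 : (1 + y ^ 2) ^ (1 / 2 + s - β / 2) =
        (1 + y ^ 2) ^ (s - β / 2 - 3 / 2) * (1 + y ^ 2) ^ 2 := by
      rw [← rpow_natCast (1 + y ^ 2) 2, ← rpow_add hm]; push_cast; ring_nf
    rw [e0, e1, e2]
    simp only [id, Pi.sub_apply, Pi.div_apply, Pi.mul_apply]
    field_simp
    ring

/-- The parametrisation of `(0, 1)` by the slope `y = x / t`. -/
def slopeParam (y : ℝ) : ℝ := (1 + y * (1 + y ^ 2) ^ (-(1 / 2) : ℝ)) / 2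

/-- With y = cot θ one has `slopeParam y` = (1 + cos θ)/2, and the product is sin²θ/4. -/
lemma slopeParam_mul (y : ℝ) : slopeParam y * (1 - slopeParam y) = (4 * (1 + y ^ 2))⁻¹ := by
  have hm : 0 < 1 + y ^ 2 := by positivity
  have : ((1 + y ^ 2) ^ (-(1 / 2) : ℝ)) ^ 2 = (1 + y ^ 2)⁻¹ := by
    rw [← rpow_natCast, ← rpow_mul hm.le, ← rpow_neg_one]; norm_num
  rw [slopeParam]
  have e : (1 + y ^ 2) * (1 + y ^ 2)⁻¹ = 1 := mul_inv_cancel₀ hm.ne'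
  rw [mul_inv]
  linear_combination (-y ^ 2 / 4) * this - (1 / 4) * e

lemma slopeParam_mem (y : ℝ) : slopeParam y ∈ Ioo (0 : ℝ) 1 := by
  have h : 0 < slopeParam y * (1 - slopeParam y) := by rw [slopeParam_mul]; positivity
  constructor <;> nlinarith

lemma hasDerivAt_slopeParam (y : ℝ) :
    HasDerivAt slopeParam ((1 + y ^ 2) ^ (-(3 / 2) : ℝ) / 2) y := by
  have hm : 0 < 1 + y ^ 2 := by positivity
  have hmd : HasDerivAt (fun y : ℝ => 1 + y ^ 2) (2 * y) y :=
    ((hasDerivAt_pow 2 y).const_add 1).congr_deriv (by simp)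
  refine ((((hasDerivAt_id y).mul (hmd.rpow_const (p := -(1 / 2)) (Or.inl hm.ne'))).const_add
    1).div_const 2).congr_deriv ?_
  have e1 : (1 + y ^ 2) ^ (-(1 / 2) : ℝ) = (1 + y ^ 2) ^ (-(3 / 2) : ℝ) * (1 + y ^ 2) := by
    rw [← rpow_add_one hm.ne']; norm_num
  have e2 : (-(1 / 2) - 1 : ℝ) = -(3 / 2) := by norm_num
  rw [e2, e1]
  simp only [id]
  ring

lemma slope_weight_left (s y : ℝ) :
    s * (slopeParam y * (1 - slopeParam y)) ^ (s - 1) * ((1 + y ^ 2) ^ (-(3 / 2) : ℝ) / 2) =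
      s * 2 ^ (1 - 2 * s) * (1 + y ^ 2) ^ (-(1 / 2) - s) := by
  have hm : 0 < 1 + y ^ 2 := by positivity
  rw [slopeParam_mul, inv_rpow (by positivity), ← rpow_neg (by positivity),
    mul_rpow (by norm_num) hm.le, show (4 : ℝ) = 2 ^ (2 : ℝ) by norm_num, ← rpow_mul (by norm_num),
    show (2 : ℝ) * -(s - 1) = (1 - 2 * s) + 1 by ring, rpow_add_one (by norm_num),
    show (-(1 / 2) - s : ℝ) = -(s - 1) + -(3 / 2) by ring, rpow_add hm]
  ring

lemma slope_weight_right (s c y : ℝ) :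
    -(c / s) * (slopeParam y * (1 - slopeParam y)) ^ (-s) * ((1 + y ^ 2) ^ (-(3 / 2) : ℝ) / 2) =
      -(c / s) * 2 ^ (2 * s - 1) * (1 + y ^ 2) ^ (s - 3 / 2) := by
  have hm : 0 < 1 + y ^ 2 := by positivity
  rw [slopeParam_mul, inv_rpow (by positivity), ← rpow_neg (by positivity), neg_neg,
    mul_rpow (by norm_num) hm.le, show (4 : ℝ) = 2 ^ (2 : ℝ) by norm_num, ← rpow_mul (by norm_num),
    rpow_sub_one (by norm_num), show (s - 3 / 2 : ℝ) = s + -(3 / 2) by ring, rpow_add hm]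
  ring

/-- Bootstrapping: each derivative is a smooth multiple of the other function. It gives the
regularity of the profiles without differentiating the series again. -/
lemma contDiff_of_linear_system {a b f g : ℝ → ℝ} (ha : ∀ n : ℕ, ContDiff ℝ n a)
    (hb : ∀ n : ℕ, ContDiff ℝ n b) (hf : ∀ y, HasDerivAt f (a y * g y) y)
    (hg : ∀ y, HasDerivAt g (b y * f y) y) (n : ℕ) : ContDiff ℝ n f ∧ ContDiff ℝ n g := by
  have df : deriv f = fun y => a y * g y := funext fun y => (hf y).deriv
  have dg : deriv g = fun y => b y * f y := funext fun y => (hg y).deriv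
  have f0 : Differentiable ℝ f := fun y => (hf y).differentiableAt
  have g0 : Differentiable ℝ g := fun y => (hg y).differentiableAt
  induction n with
  | zero => exact ⟨contDiff_zero.2 f0.continuous, contDiff_zero.2 g0.continuous⟩
  | succ n ih =>
    push_cast
    rw [contDiff_succ_iff_deriv, contDiff_succ_iff_deriv, df, dg]
    exact ⟨⟨f0, by simp, (ha n).mul ih.2⟩, ⟨g0, by simp, (hb n).mul ih.1⟩⟩


/-! ### The explicit homogeneous solution. -/

/-- The angular profile `A⁻¹ P` as a function of the slope `y = x / t`, times `(1 + y²)^{β/2}`. -/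
def sliceProfile (s β y : ℝ) : ℝ :=
  (1 + y ^ 2) ^ (β / 2) * (angP s β (slopeParam y) / angP s β 1)

/-- The `β`-homogeneous solution with boundary values `(x_+)^β`. -/
def homogSol (s β : ℝ) (p : ℝ × ℝ) : ℝ :=
  -- The separate value at the origin matters for β = 0, where 0 ^ 0 = 1 would contradict the trace
  -- (x_+)^0 = 0 at x = 0.
  if p = (0, 0) then 0 else
    √(p.1 ^ 2 + p.2 ^ 2) ^ β * (angP s β ((1 + p.1 / √(p.1 ^ 2 + p.2 ^ 2)) / 2) / angP s β 1)

lemma sqrt_sq_add_sq {x t : ℝ} (ht : 0 < t) :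
    √(x ^ 2 + t ^ 2) = t * (1 + (x / t) ^ 2) ^ (1 / 2 : ℝ) := by
  rw [← sqrt_eq_rpow, ← sqrt_sq ht.le, ← sqrt_mul (by positivity), sqrt_sq ht.le]
  congr 1
  field_simp
  ring

lemma homogSol_eq_slice (s β x : ℝ) {t : ℝ} (ht : 0 < t) :
    homogSol s β (x, t) = t ^ β * sliceProfile s β (x / t) := by
  have hm : 0 < 1 + (x / t) ^ 2 := by positivity
  have hne : ((x, t) : ℝ × ℝ) ≠ (0, 0) := fun h => ht.ne' (congrArg Prod.snd h)
  rw [homogSol, if_neg hne]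
  simp only
  rw [sqrt_sq_add_sq ht, mul_rpow ht.le (by positivity), ← rpow_mul hm.le,
    show x / (t * (1 + (x / t) ^ 2) ^ (1 / 2 : ℝ)) =
      x / t * (1 + (x / t) ^ 2) ^ (-(1 / 2) : ℝ) by rw [rpow_neg hm.le]; field_simp,
    ← slopeParam, sliceProfile]
  ring_nf

lemma slice_system {s : ℝ} (hs0 : 0 < s) (hs1 : s < 1) (β y : ℝ) :
    HasDerivAt (fun y => angP s β (slopeParam y))
      (s * 2 ^ (1 - 2 * s) * (1 + y ^ 2) ^ (-(1 / 2) - s) * angQ s β (slopeParam y)) y ∧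
    HasDerivAt (fun y => angQ s β (slopeParam y))
      (-(β * (β + 1 - 2 * s) / s) * 2 ^ (2 * s - 1) * (1 + y ^ 2) ^ (s - 3 / 2) *
        angP s β (slopeParam y)) y := by
  rw [← slope_weight_left, ← slope_weight_right]
  exact ⟨((hasDerivAt_angP hs0 hs1 β (slopeParam_mem y)).comp y
    (hasDerivAt_slopeParam y)).congr_deriv (by ring),
    ((hasDerivAt_angQ hs0 hs1 β (slopeParam_mem y)).comp y
    (hasDerivAt_slopeParam y)).congr_deriv (by ring)⟩

lemma contDiff_one_add_sq_rpow (e : ℝ) (n : ℕ) : ContDiff ℝ n (fun y : ℝ => (1 + y ^ 2) ^ e) :=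
  ContDiff.rpow_const_of_ne (by fun_prop) fun y => by positivity

lemma contDiff_sliceProfile {s : ℝ} (hs0 : 0 < s) (hs1 : s < 1) (β : ℝ) :
    ContDiff ℝ 2 (sliceProfile s β) := by
  have h := (contDiff_of_linear_system
    (fun n => contDiff_const.mul (contDiff_one_add_sq_rpow (-(1 / 2) - s) n))
    (fun n => contDiff_const.mul (contDiff_one_add_sq_rpow (s - 3 / 2) n))
    (fun y => (slice_system hs0 hs1 β y).1) (fun y => (slice_system hs0 hs1 β y).2) 2).1
  exact (contDiff_one_add_sq_rpow (β / 2) 2).mul (h.div_const _)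

lemma two_step_derivatives {h : ℝ → ℝ} (hh : ContDiff ℝ 2 h) :
    (∀ y, HasDerivAt h (deriv h y) y) ∧ ∀ y, HasDerivAt (deriv h) (deriv (deriv h) y) y := by
  have h2 : ContDiff ℝ (1 + 1) h := by simpa [one_add_one_eq_two] using hh
  rw [contDiff_succ_iff_deriv] at h2
  exact ⟨fun y => (h2.1 y).hasDerivAt,
    fun y => ((h2.2.2.differentiable one_ne_zero) y).hasDerivAt⟩

lemma sliceProfile_deriv {s : ℝ} (hs0 : 0 < s) (hs1 : s < 1) (β y : ℝ) :
    (1 + y ^ 2) ^ (-β / 2) * (deriv (sliceProfile s β) y -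
      β * y * sliceProfile s β y / (1 + y ^ 2)) =
    s * 2 ^ (1 - 2 * s) * (1 + y ^ 2) ^ (-(1 / 2) - s) * angQ s β (slopeParam y) / angP s β 1 := by
  obtain ⟨h1, h2⟩ := two_step_derivatives (contDiff_sliceProfile hs0 hs1 β)
  refine (hasDerivAt_slice_flux s β h1 h2 y).1.unique ?_
  refine ((slice_system hs0 hs1 β y).1.div_const (angP s β 1)).congr_of_eventuallyEq
    (Eventually.of_forall fun y => ?_)
  have hm : 0 < 1 + y ^ 2 := by positivity
  change (1 + y ^ 2) ^ (-β / 2) * sliceProfile s β y = _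
  rw [sliceProfile, ← mul_assoc, ← rpow_add hm]
  simp [neg_div]

/-- The flux is differentiated in two ways: `hasDerivAt_slice_flux` gives the operator minus a
multiple of the profile, and `slice_system` gives that same multiple alone. -/
lemma sliceProfile_ode {s : ℝ} (hs0 : 0 < s) (hs1 : s < 1) (β y : ℝ) :
    (1 + y ^ 2) * deriv (deriv (sliceProfile s β)) y -
      (2 * β - 1 - 2 * s) * y * deriv (sliceProfile s β) y +
      β * (β - 2 * s) * sliceProfile s β y = 0 := by
  obtain ⟨h1, h2⟩ := two_step_derivatives (contDiff_sliceProfile hs0 hs1 β)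
  have hm : 0 < 1 + y ^ 2 := by positivity
  have e1 := (hasDerivAt_slice_flux s β h1 h2 y).2
  have e2 := ((slice_system hs0 hs1 β y).2.const_mul (s * 2 ^ (1 - 2 * s))).div_const (angP s β 1)
  have e3 := e1.unique (e2.congr_of_eventuallyEq (Eventually.of_forall fun y => ?_))
  · have e4 : (1 + y ^ 2) ^ (s - β / 2 - 3 / 2) * sliceProfile s β y =
        (1 + y ^ 2) ^ (s - 3 / 2) * angP s β (slopeParam y) / angP s β 1 := by
      rw [sliceProfile, ← mul_assoc, ← rpow_add hm, mul_div_assoc]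
      ring_nf
    have e5 : (2 : ℝ) ^ (1 - 2 * s) * 2 ^ (2 * s - 1) = 1 := by
      rw [← rpow_add (by norm_num)]; simp
    have e6 : s * 2 ^ (1 - 2 * s) * (-(β * (β + 1 - 2 * s) / s) * 2 ^ (2 * s - 1) *
        (1 + y ^ 2) ^ (s - 3 / 2) * angP s β (slopeParam y)) / angP s β 1 =
        -(β * (β + 1 - 2 * s)) * ((1 + y ^ 2) ^ (s - β / 2 - 3 / 2) * sliceProfile s β y) := by
      rw [e4]
      have e7 : s * (β * (β + 1 - 2 * s) / s) = β * (β + 1 - 2 * s) := by field_simp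
      linear_combination (-(β * (β + 1 - 2 * s)) * ((1 + y ^ 2) ^ (s - 3 / 2) *
        angP s β (slopeParam y) / angP s β 1)) * e5 - 2 ^ (1 - 2 * s) * 2 ^ (2 * s - 1) *
        ((1 + y ^ 2) ^ (s - 3 / 2) * angP s β (slopeParam y) / angP s β 1) * e7
    rw [e6] at e3
    have e7 : (1 + y ^ 2) ^ (s - β / 2 - 1 / 2) ≠ 0 := by positivity
    apply (mul_right_inj' e7).1
    linear_combination e3
  · have hm : 0 < 1 + y ^ 2 := by positivity
    have := sliceProfile_deriv hs0 hs1 β y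
    have e7 : (1 + y ^ 2) ^ (1 / 2 + s - β / 2) =
        (1 + y ^ 2) ^ (1 / 2 + s) * (1 + y ^ 2) ^ (-β / 2) := by
      rw [← rpow_add hm]; ring_nf
    have e8 : (1 + y ^ 2) ^ (1 / 2 + s) * (1 + y ^ 2) ^ (-(1 / 2) - s) = 1 := by
      rw [← rpow_add hm]; simp
    simp only
    rw [e7, mul_assoc, this]
    linear_combination (s * 2 ^ (1 - 2 * s) * angQ s β (slopeParam y) / angP s β 1) * e8

lemma homogSol_isDegHarmonic {s : ℝ} (hs0 : 0 < s) (hs1 : s < 1) (β : ℝ) :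
    IsDegHarmonic s (homogSol s β) := by
  have hc := contDiff_sliceProfile hs0 hs1 β
  refine ⟨?_, fun x t ht => ?_⟩
  · have : ContDiffOn ℝ 2 (fun p : ℝ × ℝ => p.2 ^ β * sliceProfile s β (p.1 / p.2))
        openHalfPlane := by
      refine ContDiffOn.mul (contDiffOn_snd.rpow_const_of_ne fun p hp => ne_of_gt hp) ?_
      exact hc.comp_contDiffOn (contDiffOn_fst.div contDiffOn_snd fun p hp => ne_of_gt hp)
    exact this.congr fun p hp => homogSol_eq_slice s β p.1 hp
  · obtain ⟨h1, h2⟩ := two_step_derivatives hc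
    rw [deg_laplacian_homogeneous s β (fun x t ht => homogSol_eq_slice s β x ht) h1 h2 x ht,
      sliceProfile_ode hs0 hs1, mul_zero]

lemma half_one_add_div_mem (x t : ℝ) : (1 + x / √(x ^ 2 + t ^ 2)) / 2 ∈ Icc (0 : ℝ) 1 := by
  have h : |x / √(x ^ 2 + t ^ 2)| ≤ 1 := by
    rw [abs_div, abs_of_nonneg (sqrt_nonneg _)]
    refine div_le_one_of_le₀ (abs_le_sqrt (by nlinarith [sq_nonneg t])) (sqrt_nonneg _)
  rw [abs_le] at h
  constructor <;> linarith [h.1, h.2]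

lemma sqrt_pos_of_ne {p : ℝ × ℝ} (hp : p ≠ (0, 0)) : 0 < √(p.1 ^ 2 + p.2 ^ 2) := by
  apply sqrt_pos.2
  by_contra h
  exact hp (Prod.ext (by nlinarith [sq_nonneg p.1, sq_nonneg p.2])
    (by nlinarith [sq_nonneg p.1, sq_nonneg p.2]))

lemma continuousOn_homogSol {s : ℝ} (hs0 : 0 < s) (β : ℝ) :
    ContinuousOn (homogSol s β) {(0, 0)}ᶜ := by
  have h0 : ContinuousOn (fun p : ℝ × ℝ => √(p.1 ^ 2 + p.2 ^ 2)) {(0, 0)}ᶜ := by fun_prop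
  have h1 : ContinuousOn (fun p : ℝ × ℝ => √(p.1 ^ 2 + p.2 ^ 2) ^ β *
      (angP s β ((1 + p.1 / √(p.1 ^ 2 + p.2 ^ 2)) / 2) / angP s β 1)) {(0, 0)}ᶜ := by
    refine (h0.rpow_const fun p hp => Or.inl (sqrt_pos_of_ne hp).ne').mul
      (ContinuousOn.div_const ?_ _)
    refine (continuousOn_angP hs0 β).comp ?_ fun p _ => half_one_add_div_mem p.1 p.2
    exact (continuousOn_const.add (continuousOn_fst.div h0
      fun p hp => (sqrt_pos_of_ne hp).ne')).div_const _
  exact h1.congr fun p hp => if_neg hp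

lemma homogSol_trace {s β : ℝ} (hs0 : 0 < s) (hA : angP s β 1 ≠ 0) (x : ℝ) :
    homogSol s β (x, 0) = posPow β x := by
  rcases lt_trichotomy x 0 with hx | hx | hx
  · rw [homogSol, if_neg (by simp [hx.ne]), posPow, if_neg hx.le.not_gt]
    simp only [ne_eq, OfNat.ofNat_ne_zero, not_false_eq_true, zero_pow, add_zero]
    rw [sqrt_sq_eq_abs, abs_of_neg hx, div_neg, div_self hx.ne]
    simp [angP_zero hs0.ne']
  · simp [homogSol, posPow, hx]
  · rw [homogSol, if_neg (by simp [hx.ne']), posPow, if_pos hx]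
    simp only [ne_eq, OfNat.ofNat_ne_zero, not_false_eq_true, zero_pow, add_zero]
    rw [sqrt_sq hx.le, div_self hx.ne']
    norm_num [div_self hA]

lemma homogSol_homogeneous (s β x t : ℝ) {r : ℝ} (hr : 0 < r) :
    homogSol s β (r * x, r * t) = r ^ β * homogSol s β (x, t) := by
  by_cases h : ((x, t) : ℝ × ℝ) = (0, 0)
  · obtain ⟨rfl, rfl⟩ := Prod.mk.inj h
    simp [homogSol]
  · have h' : ((r * x, r * t) : ℝ × ℝ) ≠ (0, 0) := fun h2 => h (by
      obtain ⟨h3, h4⟩ := Prod.mk.inj h2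
      rw [(mul_eq_zero.1 h3).resolve_left hr.ne', (mul_eq_zero.1 h4).resolve_left hr.ne'])
    rw [homogSol, homogSol, if_neg h, if_neg h']
    simp only
    have e : √((r * x) ^ 2 + (r * t) ^ 2) = r * √(x ^ 2 + t ^ 2) := by
      rw [mul_pow, mul_pow, ← mul_add, sqrt_mul (by positivity), sqrt_sq hr.le]
    rw [e, mul_rpow hr.le (sqrt_nonneg _), mul_div_mul_left _ _ hr.ne']
    ring

theorem isHomogExtension_homogSol {s β : ℝ} (hs0 : 0 < s) (hs1 : s < 1) (hA : angP s β 1 ≠ 0) :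
    IsHomogExtension s β (homogSol s β) where
  homogeneous x t _ _ hr := homogSol_homogeneous s β x t hr
  equation := homogSol_isDegHarmonic hs0 hs1 β
  continuousOn := (continuousOn_homogSol hs0 β).mono fun _ hp => hp.2
  trace := homogSol_trace hs0 hA

/-- Splits the weighted derivative into a radial part, which carries t^{2-2s} and disappears as t →
0, and an angular part in which the weight has been absorbed into the flux `angQ`, continuous up to
z = 1. -/
lemma homogSol_weighted_deriv {s : ℝ} (hs0 : 0 < s) (hs1 : s < 1) (β x : ℝ) {t : ℝ} (ht : 0 < t) :
    t ^ (1 - 2 * s) * deriv (fun τ => homogSol s β (x, τ)) t =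
      β * t ^ (2 - 2 * s) * √(x ^ 2 + t ^ 2) ^ (β - 2) *
        (angP s β ((1 + x / √(x ^ 2 + t ^ 2)) / 2) / angP s β 1) -
      s * 2 ^ (1 - 2 * s) * x * √(x ^ 2 + t ^ 2) ^ (β - 1 - 2 * s) *
        (angQ s β ((1 + x / √(x ^ 2 + t ^ 2)) / 2) / angP s β 1) := by
  obtain ⟨h1, h2⟩ := two_step_derivatives (contDiff_sliceProfile hs0 hs1 β)
  have hquot : HasDerivAt (fun τ => x / τ) (-x / t ^ 2) t :=
    ((hasDerivAt_const t x).div (hasDerivAt_id t) ht.ne').congr_deriv (by simp)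
  have hd : HasDerivAt (fun τ => homogSol s β (x, τ)) (β * t ^ (β - 1) * sliceProfile s β (x / t) +
      t ^ β * (deriv (sliceProfile s β) (x / t) * (-x / t ^ 2))) t := by
    refine ((Real.hasDerivAt_rpow_const (p := β) (Or.inl ht.ne')).mul
      ((h1 (x / t)).comp t hquot)).congr_of_eventuallyEq ?_
    filter_upwards [lt_mem_nhds ht] with τ hτ using homogSol_eq_slice s β x hτ
  have hm : 0 < 1 + (x / t) ^ 2 := by positivity
  have hρ : 0 < √(x ^ 2 + t ^ 2) := sqrt_pos.2 (by positivity)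
  have hz : (1 + x / √(x ^ 2 + t ^ 2)) / 2 = slopeParam (x / t) := by
    rw [sqrt_sq_add_sq ht, slopeParam, rpow_neg hm.le]
    field_simp
  have hsd := sliceProfile_deriv hs0 hs1 β (x / t)
  have hmρ : ∀ e : ℝ, (1 + (x / t) ^ 2) ^ e = √(x ^ 2 + t ^ 2) ^ (2 * e) * t ^ (-(2 * e)) := by
    intro e
    have : 1 + (x / t) ^ 2 = (√(x ^ 2 + t ^ 2) / t) ^ (2 : ℝ) := by
      rw [rpow_two, div_pow, div_pow, sq_sqrt (by positivity)]; field_simp; ring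
    rw [this, ← rpow_mul (by positivity), div_rpow hρ.le ht.le, rpow_neg ht.le, div_eq_mul_inv]
  rw [hd.deriv, hz]
  have hv : sliceProfile s β (x / t) = √(x ^ 2 + t ^ 2) ^ β * t ^ (-β) *
      (angP s β (slopeParam (x / t)) / angP s β 1) := by
    rw [sliceProfile, hmρ]; ring_nf
  have hh1 : deriv (sliceProfile s β) (x / t) = √(x ^ 2 + t ^ 2) ^ β * t ^ (-β) *
      (s * 2 ^ (1 - 2 * s) * (√(x ^ 2 + t ^ 2) ^ (-1 - 2 * s) * t ^ (1 + 2 * s)) *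
        angQ s β (slopeParam (x / t)) / angP s β 1) +
      β * (x / t) * sliceProfile s β (x / t) / (1 + (x / t) ^ 2) := by
    have e : (1 + (x / t) ^ 2) ^ (β / 2) * (1 + (x / t) ^ 2) ^ (-β / 2) = 1 := by
      rw [← rpow_add hm]; simp [neg_div]
    have e1 := hmρ (-(1 / 2) - s)
    have e2 := hmρ (β / 2)
    rw [show 2 * (-(1 / 2) - s) = -1 - 2 * s by ring, show -(-1 - 2 * s) = 1 + 2 * s by ring] at e1
    rw [show 2 * (β / 2) = β by ring] at e2
    rw [← e1, ← e2, ← hsd]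
    linear_combination (-(deriv (sliceProfile s β) (x / t) -
      β * (x / t) * sliceProfile s β (x / t) / (1 + (x / t) ^ 2))) * e
  rw [hh1, hv]
  set ρ := √(x ^ 2 + t ^ 2)
  set p := angP s β (slopeParam (x / t)) / angP s β 1
  have hρ2 : ρ ^ 2 = x ^ 2 + t ^ 2 := sq_sqrt (by positivity)
  have a1 : t ^ (1 - 2 * s) * t ^ (β - 1) * t ^ (-β) * t ^ 2 = t ^ (2 - 2 * s) := by
    rw [← rpow_add ht, ← rpow_add ht, ← rpow_two, ← rpow_add ht]; ring_nf
  have a2 : t ^ (1 - 2 * s) * t ^ β * t ^ (-β) = t ^ (2 - 2 * s) / t := by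
    rw [← rpow_add ht, ← rpow_add ht, ← rpow_sub_one ht.ne']; ring_nf
  have a3 : t ^ (1 - 2 * s) * t ^ β * t ^ (-β) * t ^ (1 + 2 * s) = t ^ 2 := by
    rw [← rpow_add ht, ← rpow_add ht, ← rpow_add ht, ← rpow_two]; ring_nf
  have a4 : ρ ^ (β - 2) * ρ ^ 2 = ρ ^ β := by
    rw [← rpow_two, ← rpow_add hρ]; ring_nf
  have a5 : ρ ^ (β - 1 - 2 * s) = ρ ^ β * ρ ^ (-1 - 2 * s) := by
    rw [← rpow_add hρ]; ring_nf
  have a6 : 1 + (x / t) ^ 2 = ρ ^ 2 / t ^ 2 := by rw [hρ2]; field_simp; ring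
  rw [a6, a5, ← a4]
  have a1' : t ^ (1 - 2 * s) * t ^ (β - 1) * t ^ (-β) = t ^ (2 - 2 * s) / t ^ 2 := by
    rw [← a1]; field_simp
  have t1 : t ^ (1 - 2 * s) * (β * t ^ (β - 1) * (ρ ^ (β - 2) * ρ ^ 2 * t ^ (-β) * p)) =
      β * (t ^ (2 - 2 * s) / t ^ 2) * (ρ ^ (β - 2) * ρ ^ 2) * p := by rw [← a1']; ring
  have t2 : t ^ (1 - 2 * s) * (t ^ β * (β * (x / t) * (ρ ^ (β - 2) * ρ ^ 2 * t ^ (-β) * p) /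
      (ρ ^ 2 / t ^ 2) * (-x / t ^ 2))) =
      - (β * x ^ 2 * (t ^ (2 - 2 * s) / t ^ 2) * ρ ^ (β - 2) * p) := by
    have : t ^ (2 - 2 * s) / t ^ 2 = t ^ (1 - 2 * s) * t ^ β * t ^ (-β) / t := by
      rw [a2]; field_simp
    rw [this]; field_simp
  have t3 : t ^ (1 - 2 * s) * (t ^ β * (ρ ^ (β - 2) * ρ ^ 2 * t ^ (-β) *
      (s * 2 ^ (1 - 2 * s) * (ρ ^ (-1 - 2 * s) * t ^ (1 + 2 * s)) *
        angQ s β (slopeParam (x / t)) / angP s β 1) * (-x / t ^ 2))) =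
      -(s * 2 ^ (1 - 2 * s) * x * (ρ ^ (β - 2) * ρ ^ 2 * ρ ^ (-1 - 2 * s)) *
        (angQ s β (slopeParam (x / t)) / angP s β 1)) := by
    have : t ^ (1 - 2 * s) * t ^ β * t ^ (-β) * t ^ (1 + 2 * s) / t ^ 2 = 1 := by
      rw [a3]; field_simp
    linear_combination (-(s * 2 ^ (1 - 2 * s) * x * (ρ ^ (β - 2) * ρ ^ 2 * ρ ^ (-1 - 2 * s)) *
        (angQ s β (slopeParam (x / t)) / angP s β 1))) * this
  have t4 : (t ^ (2 - 2 * s) / t ^ 2) * t ^ 2 = t ^ (2 - 2 * s) := by field_simp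
  linear_combination t1 + t2 + t3 + β * (t ^ (2 - 2 * s) / t ^ 2) * ρ ^ (β - 2) * p * hρ2 +
    β * ρ ^ (β - 2) * p * t4

theorem hasConormal_homogSol {s : ℝ} (hs0 : 0 < s) (hs1 : s < 1) (β : ℝ) {x : ℝ} (hx : 0 < x)
    : HasConormal s (homogSol s β) x
      (s * 2 ^ (1 - 2 * s) * (angQ s β 1 / angP s β 1) * x ^ (β - 2 * s)) := by
  have hρ : Tendsto (fun t : ℝ => √(x ^ 2 + t ^ 2)) (𝓝[>] 0) (𝓝 x) := by
    have : Continuous fun t : ℝ => √(x ^ 2 + t ^ 2) := by fun_prop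
    have h := this.tendsto 0
    simp only [ne_eq, OfNat.ofNat_ne_zero, not_false_eq_true, zero_pow, add_zero,
      sqrt_sq hx.le] at h
    exact h.mono_left nhdsWithin_le_nhds
  have hz : Tendsto (fun t : ℝ => (1 + x / √(x ^ 2 + t ^ 2)) / 2) (𝓝[>] 0) (𝓝[Icc 0 1] 1) := by
    refine tendsto_nhdsWithin_iff.2 ⟨?_, Eventually.of_forall fun t => half_one_add_div_mem x t⟩
    have := (((tendsto_const_nhds (x := x)).div hρ hx.ne').const_add 1).div_const 2
    rwa [div_self hx.ne', one_add_one_eq_two, div_self two_ne_zero] at this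
  have h1 : (1 : ℝ) ∈ Icc (0 : ℝ) 1 := by simp
  have hP := ((continuousOn_angP hs0 β 1 h1).tendsto.comp hz).div_const (angP s β 1)
  have hQ := ((continuousOn_angQ hs0 hs1 β 1 h1).tendsto.comp hz).div_const (angP s β 1)
  have ht : Tendsto (fun t : ℝ => t ^ (2 - 2 * s)) (𝓝[>] 0) (𝓝 0) := by
    have := (continuousAt_rpow_const 0 (2 - 2 * s) (Or.inr (by linarith))).tendsto
    rw [zero_rpow (by linarith)] at this
    exact this.mono_left nhdsWithin_le_nhds
  have key := ((((ht.const_mul β).mul (hρ.rpow_const (p := β - 2) (Or.inl hx.ne'))).mul hP).sub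
    (((hρ.rpow_const (p := β - 1 - 2 * s) (Or.inl hx.ne')).const_mul
      (s * 2 ^ (1 - 2 * s) * x)).mul hQ)).neg
  rw [HasConormal]
  have e : x ^ (β - 2 * s) = x * x ^ (β - 1 - 2 * s) := by
    rw [show β - 2 * s = 1 + (β - 1 - 2 * s) by ring, rpow_add hx, rpow_one]
  rw [e]
  refine (key.congr' ?_).trans_eq ?_
  · filter_upwards [self_mem_nhdsWithin] with t ht
    rw [homogSol_weighted_deriv hs0 hs1 β x ht]
    rfl
  · congr 1; ring

/-! ### Uniqueness of the homogeneous extension. -/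

lemma tendsto_slope_atTop :
    Tendsto (fun y : ℝ => y * (1 + y ^ 2) ^ (-(1 / 2) : ℝ)) atTop (𝓝 1) ∧
    Tendsto (fun y : ℝ => (1 + y ^ 2) ^ (-(1 / 2) : ℝ)) atTop (𝓝 0) := by
  have hm : Tendsto (fun y : ℝ => 1 + y ^ 2) atTop atTop :=
    tendsto_atTop_add_const_left _ _ (tendsto_pow_atTop two_ne_zero)
  have h0 : Tendsto (fun y : ℝ => (1 + y ^ 2) ^ (-(1 / 2) : ℝ)) atTop (𝓝 0) :=
    (tendsto_rpow_neg_atTop (show (0 : ℝ) < 1 / 2 by norm_num)).comp hm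
  refine ⟨?_, h0⟩
  have h1 : Tendsto (fun y : ℝ => √(1 - (1 + y ^ 2)⁻¹)) atTop (𝓝 (√(1 - 0))) :=
    (hm.inv_tendsto_atTop.const_sub 1).sqrt
  rw [sub_zero, sqrt_one] at h1
  refine h1.congr' ?_
  filter_upwards [eventually_gt_atTop 0] with y hy
  have hm : 0 < 1 + y ^ 2 := by positivity
  have : ((1 + y ^ 2) ^ (-(1 / 2) : ℝ)) ^ 2 = (1 + y ^ 2)⁻¹ := by
    rw [← rpow_natCast, ← rpow_mul hm.le, ← rpow_neg_one]; norm_num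
  rw [sqrt_eq_iff_mul_self_eq_of_pos (by positivity)]
  have e : (1 + y ^ 2) * (1 + y ^ 2)⁻¹ = 1 := mul_inv_cancel₀ hm.ne'
  linear_combination y ^ 2 * this + e

lemma tendsto_slope_atBot :
    Tendsto (fun y : ℝ => y * (1 + y ^ 2) ^ (-(1 / 2) : ℝ)) atBot (𝓝 (-1)) ∧
    Tendsto (fun y : ℝ => (1 + y ^ 2) ^ (-(1 / 2) : ℝ)) atBot (𝓝 0) := by
  refine ⟨?_, ?_⟩
  · have := (tendsto_slope_atTop.1.comp tendsto_neg_atBot_atTop).neg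
    refine this.congr fun y => ?_
    simp
  · have := tendsto_slope_atTop.2.comp tendsto_neg_atBot_atTop
    refine this.congr fun y => ?_
    simp

/-- Homogeneity reduces the equation to the angular system, so w on the unit circle is c₁ `angP` +
c₂ `angX`. The zero boundary value at slope -∞ kills c₂ because `angX` is 1 there; the value 1 at
slope +∞ fixes c₁. -/
theorem IsHomogExtension.eq_homogSol {s β : ℝ} (hs0 : 0 < s) (hs1 : s < 1) {w : ℝ × ℝ → ℝ}
    (hA : angP s β 1 ≠ 0) (hw : IsHomogExtension s β w) :
    EqOn w (homogSol s β) closedHalfPlane := by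
  have hsl : ∀ x t : ℝ, 0 < t → w (x, t) = t ^ β * w (x / t, 1) := fun x t ht => by
    rw [← hw.homogeneous _ _ t zero_le_one ht, mul_div_cancel₀ _ ht.ne', mul_one]
  have hc : ContDiff ℝ 2 (fun y => w (y, 1)) := by
    rw [← contDiffOn_univ]
    exact hw.equation.1.comp (by fun_prop) fun y _ => (zero_lt_one : (0 : ℝ) < 1)
  obtain ⟨h1, h2⟩ := two_step_derivatives hc
  set h := fun y => w (y, 1) with hh
  have hode : ∀ y, (1 + y ^ 2) * deriv (deriv h) y - (2 * β - 1 - 2 * s) * y * deriv h y +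
      β * (β - 2 * s) * h y = 0 := fun y => by
    have := hw.equation.2 y 1 one_pos
    rw [deg_laplacian_homogeneous s β hsl h1 h2 y one_pos] at this
    simpa using this
  have hK : s * 2 ^ (1 - 2 * s) ≠ 0 := by positivity
  -- By homogeneity H is w at the point of the unit circle with slope y = x/t, and G is its
  -- normalised flux.
  set H : ℝ → ℝ := fun y => (1 + y ^ 2) ^ (-β / 2) * h y with hH
  set G : ℝ → ℝ := fun y => (1 + y ^ 2) ^ (1 / 2 + s - β / 2) *
    (deriv h y - β * y * h y / (1 + y ^ 2)) / (s * 2 ^ (1 - 2 * s)) with hG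
  obtain ⟨c₁, c₂, hcomb⟩ := exists_angular_combination hs0 hs1 β isOpen_univ isPreconnected_univ
    (z := slopeParam) (z' := fun y => (1 + y ^ 2) ^ (-(3 / 2) : ℝ) / 2) (f := H) (g := G)
    (fun y _ => slopeParam_mem y) (fun y _ => hasDerivAt_slopeParam y)
    (fun y _ => by
      refine (hasDerivAt_slice_flux s β h1 h2 y).1.congr_deriv ?_
      have hm : 0 < 1 + y ^ 2 := by positivity
      rw [slope_weight_left, hG]
      have e : (1 + y ^ 2) ^ (-(1 / 2) - s) * (1 + y ^ 2) ^ (1 / 2 + s - β / 2) =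
          (1 + y ^ 2) ^ (-β / 2) := by rw [← rpow_add hm]; ring_nf
      rw [← e]
      field_simp)
    (fun y _ => by
      refine ((hasDerivAt_slice_flux s β h1 h2 y).2.div_const _).congr_deriv ?_
      have hm : 0 < 1 + y ^ 2 := by positivity
      rw [slope_weight_right, hode, hH]
      have e : (1 + y ^ 2) ^ (s - 3 / 2) * (1 + y ^ 2) ^ (-β / 2) =
          (1 + y ^ 2) ^ (s - β / 2 - 3 / 2) := by rw [← rpow_add hm]; ring_nf
      have e5 : (2 : ℝ) ^ (1 - 2 * s) * 2 ^ (2 * s - 1) = 1 := by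
        rw [← rpow_add (by norm_num)]; simp
      rw [← e, div_eq_iff hK]
      have e7 : β * (β + 1 - 2 * s) / s * s = β * (β + 1 - 2 * s) := by field_simp
      linear_combination (β * (β + 1 - 2 * s) / s * s * ((1 + y ^ 2) ^ (s - 3 / 2) *
        (1 + y ^ 2) ^ (-β / 2)) * h y) * e5 + ((1 + y ^ 2) ^ (s - 3 / 2) *
        (1 + y ^ 2) ^ (-β / 2)) * h y * e7)
  have hHw : ∀ y, H y = w (y * (1 + y ^ 2) ^ (-(1 / 2) : ℝ), (1 + y ^ 2) ^ (-(1 / 2) : ℝ)) := by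
    intro y
    have hm : 0 < 1 + y ^ 2 := by positivity
    have := hw.homogeneous y 1 ((1 + y ^ 2) ^ (-(1 / 2) : ℝ)) zero_le_one (by positivity)
    rw [mul_one, mul_comm _ y, ← rpow_mul hm.le] at this
    rw [this]
    change (1 + y ^ 2) ^ (-β / 2) * w (y, 1) = _
    ring_nf
  have hlim : ∀ (l : Filter ℝ) (a : ℝ), a ≠ 0 →
      Tendsto (fun y : ℝ => y * (1 + y ^ 2) ^ (-(1 / 2) : ℝ)) l (𝓝 a) →
      Tendsto (fun y : ℝ => (1 + y ^ 2) ^ (-(1 / 2) : ℝ)) l (𝓝 0) →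
      Tendsto H l (𝓝 (posPow β a)) := by
    intro l a ha h1 h2
    have hcw := hw.continuousOn (a, 0) ⟨le_refl (0 : ℝ), by simp [ha]⟩
    rw [← hw.trace a]
    have : Tendsto (fun y : ℝ => (y * (1 + y ^ 2) ^ (-(1 / 2) : ℝ), (1 + y ^ 2) ^ (-(1 / 2) : ℝ))) l
        (𝓝[closedHalfPlane \ {(0, 0)}] (a, 0)) := by
      refine tendsto_nhdsWithin_iff.2 ⟨h1.prodMk_nhds h2, Eventually.of_forall fun y => ?_⟩
      have : 0 < (1 + y ^ 2) ^ (-(1 / 2) : ℝ) := by positivity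
      exact ⟨this.le, fun h => this.ne' (congrArg Prod.snd h)⟩
    exact (hcw.tendsto.comp this).congr fun y => (hHw y).symm
  have hzlim : ∀ (l : Filter ℝ) (a : ℝ),
      Tendsto (fun y : ℝ => y * (1 + y ^ 2) ^ (-(1 / 2) : ℝ)) l (𝓝 a) →
      Tendsto slopeParam l (𝓝[Icc 0 1] ((1 + a) / 2)) := fun l a h1 =>
    tendsto_nhdsWithin_iff.2 ⟨(h1.const_add 1).div_const 2,
      Eventually.of_forall fun y => Ioo_subset_Icc_self (slopeParam_mem y)⟩
  have hPX : ∀ (l : Filter ℝ) (a : ℝ), (1 + a) / 2 ∈ Icc (0 : ℝ) 1 →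
      Tendsto (fun y : ℝ => y * (1 + y ^ 2) ^ (-(1 / 2) : ℝ)) l (𝓝 a) →
      Tendsto H l (𝓝 (c₁ * angP s β ((1 + a) / 2) + c₂ * angX s β ((1 + a) / 2))) := by
    intro l a ha h1
    have := (((continuousOn_angP hs0 β _ ha).tendsto.comp (hzlim l a h1)).const_mul c₁).add
      (((continuousOn_angX hs0 hs1 β _ ha).tendsto.comp (hzlim l a h1)).const_mul c₂)
    exact this.congr fun y => (hcomb y (mem_univ y)).1.symm
  have hc2 : c₂ = 0 := by
    have := tendsto_nhds_unique (hlim atBot (-1) (by norm_num) tendsto_slope_atBot.1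
      tendsto_slope_atBot.2) (hPX atBot (-1) (by norm_num) tendsto_slope_atBot.1)
    norm_num [posPow, angP_zero hs0.ne', angX_zero] at this
    exact this.symm
  have hc1 : c₁ = 1 / angP s β 1 := by
    have := tendsto_nhds_unique (hlim atTop 1 (by norm_num) tendsto_slope_atTop.1
      tendsto_slope_atTop.2) (hPX atTop 1 (by norm_num) tendsto_slope_atTop.1)
    norm_num [posPow, hc2] at this
    rw [eq_div_iff hA, ← this]
  intro p hp
  obtain ⟨x, t⟩ := p
  rcases (show 0 ≤ t from hp).eq_or_lt with rfl | ht
  · rw [hw.trace, homogSol_trace hs0 hA]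
  · rw [hsl x t ht, homogSol_eq_slice s β x ht]
    congr 1
    have hm : 0 < 1 + (x / t) ^ 2 := by positivity
    have := (hcomb (x / t) (mem_univ _)).1
    rw [hc2, hc1, zero_mul, add_zero] at this
    rw [sliceProfile, show angP s β (slopeParam (x / t)) / angP s β 1 =
      1 / angP s β 1 * angP s β (slopeParam (x / t)) by ring, ← this, hH, ← mul_assoc,
      ← rpow_add hm]
    simp [neg_div, hh]

/-! ### Gamma function identities -/

/-- `C_s(β)` in a form that is regular for all `β > -1` with `β - 2s ∉ ℕ`. -/
def powConst (s β : ℝ) : ℝ := -(Gamma (β + 1) * Gamma (2 * s - β) * sin (π * (β - s)) / π)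

/-- Legendre's duplication formula and Euler's reflection formula bring a_s to the shape of
`powConst`. -/
lemma killConst_eq {s : ℝ} (hs0 : 0 < s) (hs1 : s < 1) :
    killConst s = Gamma (2 * s) * sin (π * s) / π := by
  have h1 := Gamma_mul_Gamma_add_half s
  have h2 := Gamma_mul_Gamma_one_sub s
  have g1 : Gamma s ≠ 0 := (Gamma_pos_of_pos hs0).ne'
  have g2 : Gamma (1 - s) ≠ 0 := (Gamma_pos_of_pos (by linarith)).ne'
  have hpi := pi_ne_zero
  have hsin : sin (π * s) ≠ 0 := fun h => by rw [h, div_zero] at h2; exact mul_ne_zero g1 g2 h2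
  have hsq : √π ≠ 0 := sqrt_ne_zero'.2 pi_pos
  have h4 : (4 : ℝ) ^ s * 2 ^ (1 - 2 * s) = 2 := by
    rw [show (4 : ℝ) = 2 ^ (2 : ℝ) by norm_num, ← rpow_mul (by norm_num),
      ← rpow_add (by norm_num)]; norm_num
  rw [killConst, fracConst, ← sqrt_eq_rpow, add_comm (1 / 2) s]
  have h3 : Gamma (s + 1 / 2) = Gamma (2 * s) * 2 ^ (1 - 2 * s) * √π / Gamma s := by
    rw [eq_div_iff g1, mul_comm, h1]
  have h5 : Gamma (1 - s) = π / sin (π * s) / Gamma s := by rw [eq_div_iff g1, mul_comm, h2]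
  rw [h3, h5]
  generalize sin (π * s) = σ at *
  generalize (2 : ℝ) ^ (1 - 2 * s) = r at *
  field_simp
  linear_combination h4

lemma sin_pi_mul_pos {s : ℝ} (hs0 : 0 < s) (hs1 : s < 1) : 0 < sin (π * s) :=
  sin_pos_of_pos_of_lt_pi (by positivity) (by nlinarith [pi_pos])

lemma extConst_pos {s : ℝ} (hs0 : 0 < s) (hs1 : s < 1) : 0 < extConst s :=
  div_pos (Gamma_pos_of_pos (by linarith)) (mul_pos (by positivity) (Gamma_pos_of_pos hs0))

lemma Gamma_two_mul_sub_ne_zero {s β : ℝ} (h : ∀ n : ℕ, β ≠ 2 * s + n) : Gamma (2 * s - β) ≠ 0 :=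
  Gamma_ne_zero fun m hm => h m (by linarith)

lemma angP_one_ne_zero {s β : ℝ} (hs0 : 0 < s) (hβ : -1 < β) (h : ∀ n : ℕ, β ≠ 2 * s + n) :
    angP s β 1 ≠ 0 := by
  rw [angP_one hs0]
  exact div_ne_zero (mul_ne_zero (Gamma_pos_of_pos (by linarith)).ne' (Gamma_pos_of_pos hs0).ne')
    (mul_ne_zero (Gamma_pos_of_pos (by linarith)).ne' (Gamma_two_mul_sub_ne_zero h))

lemma conormal_const_eq {s β : ℝ} (hs0 : 0 < s) (hs1 : s < 1) (hβ : -1 < β)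
    (h : ∀ n : ℕ, β ≠ 2 * s + n) :
    s * 2 ^ (1 - 2 * s) * (angQ s β 1 / angP s β 1) = extConst s * powConst s β := by
  have g0 : Gamma s ≠ 0 := (Gamma_pos_of_pos hs0).ne'
  have g1 : Gamma (1 + s) = s * Gamma s := by rw [add_comm, Gamma_add_one hs0.ne']
  have g2 : Gamma (1 + β) ≠ 0 := (Gamma_pos_of_pos (by linarith)).ne'
  have g3 := Gamma_two_mul_sub_ne_zero h
  have g4 := Gamma_mul_Gamma_one_sub s
  have hsin := (sin_pi_mul_pos hs0 hs1).ne'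
  have hpi := pi_ne_zero
  have g5 : Gamma (1 - s) = π / sin (π * s) / Gamma s := by rw [eq_div_iff g0, mul_comm, g4]
  have e1 : (2 : ℝ) ^ (2 * s - 1) = (2 ^ (1 - 2 * s))⁻¹ := by
    rw [← rpow_neg (by norm_num)]; ring_nf
  have e2 : sin (π * (s - β)) = -sin (π * (β - s)) := by
    rw [← sin_neg]; ring_nf
  have e3 : (2 : ℝ) ^ (1 - 2 * s) ≠ 0 := by positivity
  rw [angP_one hs0, angQ_one hs0 hs1, extConst, powConst, g1, g5, e1, e2, add_comm β 1]
  field_simp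

lemma sin_pi_mul_ne_zero_of_ne_int {x : ℝ} (hx : ∀ n : ℤ, x ≠ n) : sin (π * x) ≠ 0 := by
  intro h
  obtain ⟨n, hn⟩ := sin_eq_zero_iff.1 h
  exact hx n (mul_left_cancel₀ pi_ne_zero (by rw [← hn]; ring))

/-- Reflection at 2s-β. The reciprocal form also covers negative integers β-2s, where `Gamma` is 0
at its pole and both sides vanish. -/
lemma one_div_Gamma_reflection {s β : ℝ} (h : ∀ n : ℕ, β ≠ 2 * s + n) :
    1 / Gamma (β - 2 * s + 1) = -(Gamma (2 * s - β) * sin (π * (β - 2 * s)) / π) := by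
  have h2 := Gamma_mul_Gamma_one_sub (2 * s - β)
  have g3 := Gamma_two_mul_sub_ne_zero h
  have hpi := pi_ne_zero
  have e2 : sin (π * (2 * s - β)) = -sin (π * (β - 2 * s)) := by
    rw [← sin_neg]; ring_nf
  rw [show 1 - (2 * s - β) = β - 2 * s + 1 by ring, e2] at h2
  by_cases hs : sin (π * (β - 2 * s)) = 0
  · rw [hs, neg_zero, div_zero] at h2
    rw [(mul_eq_zero.1 h2).resolve_left g3, hs]; simp
  · have g4 : Gamma (β - 2 * s + 1) = π / -sin (π * (β - 2 * s)) / Gamma (2 * s - β) := by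
      rw [eq_div_iff g3, mul_comm, h2]
    rw [g4]
    field_simp

lemma powQuot_eq_powConst {s β : ℝ} (h : ∀ n : ℤ, β - 2 * s ≠ n) :
    powQuot s β = powConst s β := by
  have h' : ∀ n : ℕ, β ≠ 2 * s + n := fun n hn => h n (by rw [hn]; push_cast; ring)
  have hs := sin_pi_mul_ne_zero_of_ne_int h
  have hpi := pi_ne_zero
  rw [powQuot, powConst, div_eq_mul_one_div, one_div_Gamma_reflection h']
  field_simp

/-- `powConst` is continuous at β and equals the quotient wherever β-2s is not an integer; near β
the only possible exception is β itself. -/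
lemma tendsto_powQuot {s β : ℝ} (hβ : -1 < β) (h : ∀ n : ℕ, β ≠ 2 * s + n) :
    Tendsto (powQuot s) (𝓝[≠] β) (𝓝 (powConst s β)) := by
  have hcont : ContinuousAt (powConst s) β := by
    have c1 : ContinuousAt (fun β : ℝ => Gamma (β + 1)) β :=
      ContinuousAt.comp (g := Gamma) (differentiableAt_Gamma fun m hm => by
        have : (0 : ℝ) ≤ m := m.cast_nonneg
        linarith).continuousAt (by fun_prop)
    have c2 : ContinuousAt (fun β : ℝ => Gamma (2 * s - β)) β :=
      ContinuousAt.comp (g := Gamma) (differentiableAt_Gamma fun m hm =>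
        h m (by linarith)).continuousAt (by fun_prop)
    have c3 : ContinuousAt (fun β : ℝ => sin (π * (β - s))) β := by fun_prop
    exact (((c1.mul c2).mul c3).div_const π).neg
  refine (hcont.tendsto.mono_left nhdsWithin_le_nhds).congr' ?_
  have hev : ∀ᶠ b in 𝓝[≠] β, ∀ n : ℤ, b - 2 * s ≠ n := by
    have hfl : ∀ᶠ b : ℝ in 𝓝[≠] (β - 2 * s), ∀ n : ℤ, b ≠ (n : ℝ) := by
      have hlt : ∀ᶠ b in 𝓝 (β - 2 * s), b < (⌊β - 2 * s⌋ : ℝ) + 1 :=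
        gt_mem_nhds (Int.lt_floor_add_one _)
      have hgt : ∀ᶠ b in 𝓝 (β - 2 * s), (⌈β - 2 * s⌉ : ℝ) - 1 < b :=
        lt_mem_nhds (by linarith [Int.ceil_lt_add_one (β - 2 * s)])
      filter_upwards [self_mem_nhdsWithin, hlt.filter_mono nhdsWithin_le_nhds,
        hgt.filter_mono nhdsWithin_le_nhds] with b hb h1 h2 n hn
      rw [hn] at h1 h2
      have h3 : n < ⌊β - 2 * s⌋ + 1 := by exact_mod_cast h1
      have h4 : ⌈β - 2 * s⌉ - 1 < n := by exact_mod_cast h2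
      have h5 : (n : ℝ) ≤ β - 2 * s := Int.le_floor.1 (by omega)
      have h6 : β - 2 * s ≤ n := Int.ceil_le.1 (by omega)
      exact hb (by rw [hn]; exact le_antisymm h5 h6)
    have ht : Tendsto (fun b : ℝ => b - 2 * s) (𝓝[≠] β) (𝓝[≠] (β - 2 * s)) :=
      tendsto_nhdsWithin_iff.2 ⟨((continuous_sub_right (2 * s)).tendsto β).mono_left
        nhdsWithin_le_nhds, by
          filter_upwards [self_mem_nhdsWithin] with b hb hb'
          exact hb (by simpa using hb')⟩
    exact ht.eventually hfl
  filter_upwards [hev] with b hb using (powQuot_eq_powConst hb).symm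

/-- (E) is C_s(β) = a_s multiplied by sin(π(β-2s)). The two can differ only where this factor
vanishes, which under β > -1 and β-2s ∉ ℕ leaves β = 2s-1 and β = 2s-2. At 2s-1 both hold. At 2s-2
(E) reads 0 = 0, while C_s(β) < 0 < a_s. -/
lemma exponentEq_iff {s β : ℝ} (hs0 : 0 < s) (hs1 : s < 1) (hβ : -1 < β)
    (h : ∀ n : ℕ, β ≠ 2 * s + n) :
    powConst s β = killConst s ↔ ExponentEq s β ∧ β ≠ 2 * s - 2 := by
  have g1 : 0 < Gamma (β + 1) := Gamma_pos_of_pos (by linarith)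
  have g2 : 0 < Gamma (2 * s) := Gamma_pos_of_pos (by linarith)
  have hsin := sin_pi_mul_pos hs0 hs1
  have hpi := pi_pos
  -- The second conjunct accounts for division by zero: where sin(π(β-s)) = 0 the right side of (E)
  -- is read as 0, and equality then forces sin(π(β-2s)) = 0.
  have hE : ExponentEq s β ↔ -(Gamma (β + 1) * Gamma (2 * s - β) * sin (π * (β - 2 * s))) *
      sin (π * (β - s)) = Gamma (2 * s) * sin (π * (β - 2 * s)) * sin (π * s) ∧
      (sin (π * (β - s)) = 0 → sin (π * (β - 2 * s)) = 0) := by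
    rw [ExponentEq, show Gamma (β + 1) / (Gamma (β - 2 * s + 1) * Gamma (2 * s)) =
      Gamma (β + 1) * (1 / Gamma (β - 2 * s + 1)) / Gamma (2 * s) by field_simp,
      one_div_Gamma_reflection h]
    have g3 := Gamma_two_mul_sub_ne_zero h
    by_cases h0 : sin (π * (β - s)) = 0
    · simp only [h0, div_zero, mul_zero]
      constructor
      · intro h1
        have : sin (π * (β - 2 * s)) = 0 := by
          have h2 : Gamma (β + 1) * -(Gamma (2 * s - β) * sin (π * (β - 2 * s)) / π) = 0 :=
            (div_eq_zero_iff.1 h1).resolve_right g2.ne'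
          have h3 := neg_eq_zero.1 ((mul_eq_zero.1 h2).resolve_left g1.ne')
          exact (mul_eq_zero.1 ((div_eq_zero_iff.1 h3).resolve_right hpi.ne')).resolve_left g3
        simp [this]
      · rintro ⟨-, h1⟩
        simp [h1 trivial]
    · simp only [h0, false_imp_iff, and_true]
      have := g2.ne'
      have := hpi.ne'
      field_simp
  rw [hE, killConst_eq hs0 hs1, powConst, ← neg_div, div_left_inj' hpi.ne']
  by_cases hz : sin (π * (β - 2 * s)) = 0
  · obtain ⟨n, hn⟩ := sin_eq_zero_iff.1 hz
    have hn' : β = 2 * s + n := by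
      have := mul_left_cancel₀ hpi.ne' (show π * n = π * (β - 2 * s) by rw [← hn]; ring)
      linarith
    have hneg : n < 0 := by
      by_contra hn0
      obtain ⟨m, hm⟩ := Int.eq_ofNat_of_zero_le (not_lt.1 hn0)
      exact h m (by rw [hn', hm]; simp)
    -- n = β-2s with β > -1 and s < 1.
    have hgt : -3 < n := by
      have : (-3 : ℝ) < n := by linarith
      exact_mod_cast this
    have hcases : n = -1 ∨ n = -2 := by omega
    simp only [hz, mul_zero, zero_mul, neg_zero, implies_true, and_self, true_and]
    rcases hcases with rfl | rfl
    · push_cast at hn'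
      have e1 : sin (π * (β - s)) = -sin (π * s) := by
        rw [hn', show π * (2 * s + -1 - s) = π * s - π by ring, sin_sub_pi]
      have e2 : 2 * s - β = 1 := by rw [hn']; ring
      have e3 : β + 1 = 2 * s := by rw [hn']; ring
      rw [e1, e2, e3, Gamma_one]
      refine iff_of_true (by ring) (by linarith)
    · push_cast at hn'
      have e1 : sin (π * (β - s)) = sin (π * s) := by
        rw [hn', show π * (2 * s + -2 - s) = π * s - 2 * π by ring, sin_sub_two_pi]
      have e2 : 2 * s - β = 2 := by rw [hn']; ring
      refine iff_of_false ?_ (by simp [hn', sub_eq_add_neg])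
      rw [e1, e2, Gamma_two]
      have := mul_pos g1 hsin
      have := mul_pos g2 hsin
      linarith
  · have h2 : β ≠ 2 * s - 2 := fun h2 => hz (by
      rw [h2, show π * (2 * s - 2 - 2 * s) = -(2 * π) by ring, sin_neg, sin_two_pi, neg_zero])
    simp only [h2, ne_eq, not_false_eq_true, and_true]
    constructor
    · intro h3
      refine ⟨by linear_combination sin (π * (β - 2 * s)) * h3, fun h4 => ?_⟩
      rw [h4] at h3
      have := mul_pos g2 hsin
      linarith
    · rintro ⟨h3, -⟩
      exact mul_left_cancel₀ hz (by linear_combination h3)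

/-- When P(1) ≠ 0 this is C_s(β) = a_s; the range of β excludes 2s-2. When β-2s ∈ ℕ both sides fail:
P(1) = 0 ≠ Q(1), and in (E) the left side is positive while the right side is 0. -/
lemma angular_condition_iff {s β : ℝ} (hs0 : 0 < s) (hs1 : s < 1) (hβ : max (2 * s - 1) 0 ≤ β) :
    s * 2 ^ (1 - 2 * s) * angQ s β 1 = extConst s * killConst s * angP s β 1 ↔
      ExponentEq s β := by
  have hβ1 : -1 < β := by linarith [(le_max_right (2 * s - 1) 0).trans hβ]
  have hβ2 : β ≠ 2 * s - 2 := by linarith [(le_max_left (2 * s - 1) 0).trans hβ]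
  by_cases h : ∀ n : ℕ, β ≠ 2 * s + n
  · have hA := angP_one_ne_zero hs0 hβ1 h
    have e := conormal_const_eq hs0 hs1 hβ1 h
    rw [← mul_div_assoc, div_eq_iff hA] at e
    rw [← and_iff_left (a := ExponentEq s β) hβ2, ← exponentEq_iff hs0 hs1 hβ1 h, e,
      mul_left_inj' hA, mul_right_inj' (extConst_pos hs0 hs1).ne']
  · push Not at h
    obtain ⟨n, hn⟩ := h
    have hs : sin (π * (β - s)) ≠ 0 := by
      refine sin_pi_mul_ne_zero_of_ne_int fun m hm => ?_
      have : s = ((m - n : ℤ) : ℝ) := by push_cast; linarith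
      have h1 : (0 : ℤ) < m - n := by rw [this] at hs0; exact_mod_cast hs0
      have h2 : m - n < (1 : ℤ) := by rw [this] at hs1; exact_mod_cast hs1
      omega
    refine iff_of_false ?_ ?_
    · have hA : angP s β 1 = 0 := by
        rw [angP_one hs0, show 2 * s - β = -(n : ℝ) by rw [hn]; ring,
          (Gamma_eq_zero_iff _).2 ⟨n, rfl⟩]
        simp
      rw [hA, mul_zero, angQ_one hs0 hs1]
      have h3 : sin (π * (s - β)) ≠ 0 := by
        rw [show π * (s - β) = -(π * (β - s)) by ring, sin_neg]
        exact neg_ne_zero.2 hs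
      have := (sin_pi_mul_pos hs0 hs1).ne'
      positivity
    · have h3 : sin (π * (β - 2 * s)) = 0 := by
        rw [hn, show π * (2 * s + n - 2 * s) = n * π by ring, sin_nat_mul_pi]
      rw [ExponentEq, h3]
      have h4 : 0 < Gamma (β + 1) := Gamma_pos_of_pos (by linarith)
      have h5 : 0 < Gamma (β - 2 * s + 1) := Gamma_pos_of_pos (by
        rw [hn]; linarith [(Nat.cast_nonneg n : (0 : ℝ) ≤ n)])
      have h6 : 0 < Gamma (2 * s) := Gamma_pos_of_pos (by linarith)
      have : 0 < Gamma (β + 1) / (Gamma (β - 2 * s + 1) * Gamma (2 * s)) := by positivity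
      simpa using this.ne'

/-! ### The angular eigenvalue problem -/

/-- The parametrisation of `(0, 1)` by the polar angle. -/
def angleParam (θ : ℝ) : ℝ := (1 + cos θ) / 2

lemma hasDerivAt_angleParam (θ : ℝ) : HasDerivAt angleParam (-(sin θ / 2)) θ :=
  (((hasDerivAt_cos θ).const_add 1).div_const 2).congr_deriv (by ring)

lemma angleParam_mul (θ : ℝ) : angleParam θ * (1 - angleParam θ) = (sin θ / 2) ^ (2 : ℝ) := by
  rw [angleParam, rpow_two]
  linear_combination (-1 / 4) * sin_sq_add_cos_sq θ

lemma angleParam_mem {θ : ℝ} (hθ : θ ∈ Ioo 0 π) : angleParam θ ∈ Ioo (0 : ℝ) 1 := by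
  have h := sin_pos_of_mem_Ioo hθ
  have h1 : 0 < angleParam θ * (1 - angleParam θ) := by rw [angleParam_mul]; positivity
  constructor <;> nlinarith

lemma angleParam_mem_Icc (θ : ℝ) : angleParam θ ∈ Icc (0 : ℝ) 1 := by
  constructor <;> rw [angleParam] <;> linarith [neg_one_le_cos θ, cos_le_one θ]

lemma continuous_angleParam : Continuous angleParam := by unfold angleParam; fun_prop

lemma angleParam_zero : angleParam 0 = 1 := by norm_num [angleParam]

lemma angleParam_pi : angleParam π = 0 := by norm_num [angleParam]

lemma angle_weight_left (s : ℝ) {θ : ℝ} (hθ : θ ∈ Ioo 0 π) :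
    s * (angleParam θ * (1 - angleParam θ)) ^ (s - 1) * (-(sin θ / 2)) =
      -(s * 2 ^ (1 - 2 * s) * sin θ ^ (2 * s - 1)) := by
  have h := sin_pos_of_mem_Ioo hθ
  have e : (sin θ / 2) ^ (2 * (s - 1)) * (sin θ / 2) = sin θ ^ (2 * s - 1) * 2 ^ (1 - 2 * s) := by
    rw [← rpow_add_one (by positivity), show 2 * (s - 1) + 1 = 2 * s - 1 by ring,
      div_rpow h.le (by norm_num), show 1 - 2 * s = -(2 * s - 1) by ring, rpow_neg (by norm_num)]
    rfl
  rw [angleParam_mul, ← rpow_mul (by positivity)]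
  linear_combination (-s) * e

lemma angle_weight_right (s c : ℝ) {θ : ℝ} (hθ : θ ∈ Ioo 0 π) :
    -(c / s) * (angleParam θ * (1 - angleParam θ)) ^ (-s) * (-(sin θ / 2)) =
      c / s * 2 ^ (2 * s - 1) * sin θ ^ (1 - 2 * s) := by
  have h := sin_pos_of_mem_Ioo hθ
  have e : (sin θ / 2) ^ (2 * -s) * (sin θ / 2) = sin θ ^ (1 - 2 * s) * 2 ^ (2 * s - 1) := by
    rw [← rpow_add_one (by positivity), show 2 * -s + 1 = 1 - 2 * s by ring,
      div_rpow h.le (by norm_num), show 2 * s - 1 = -(1 - 2 * s) by ring, rpow_neg (by norm_num)]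
    rfl
  rw [angleParam_mul, ← rpow_mul (by positivity)]
  linear_combination c / s * e

lemma sin_rpow_mul_sin_rpow (s : ℝ) {θ : ℝ} (hθ : θ ∈ Ioo 0 π) :
    sin θ ^ (1 - 2 * s) * sin θ ^ (2 * s - 1) = 1 := by
  rw [← rpow_add (sin_pos_of_mem_Ioo hθ)]; simp

lemma hasDerivAt_angP_angle {s : ℝ} (hs0 : 0 < s) (hs1 : s < 1) (β : ℝ) {θ : ℝ}
    (hθ : θ ∈ Ioo 0 π) : HasDerivAt (fun θ => angP s β (angleParam θ))
      (-(s * 2 ^ (1 - 2 * s) * sin θ ^ (2 * s - 1)) * angQ s β (angleParam θ)) θ := by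
  rw [← angle_weight_left s hθ]
  exact ((hasDerivAt_angP hs0 hs1 β (angleParam_mem hθ)).comp θ
    (hasDerivAt_angleParam θ)).congr_deriv (by ring)

lemma hasDerivAt_angQ_angle {s : ℝ} (hs0 : 0 < s) (hs1 : s < 1) (β : ℝ) {θ : ℝ}
    (hθ : θ ∈ Ioo 0 π) : HasDerivAt (fun θ => angQ s β (angleParam θ))
      (β * (β + 1 - 2 * s) / s * 2 ^ (2 * s - 1) * sin θ ^ (1 - 2 * s) *
        angP s β (angleParam θ)) θ := by
  rw [← angle_weight_right s _ hθ]
  exact ((hasDerivAt_angQ hs0 hs1 β (angleParam_mem hθ)).comp θ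
    (hasDerivAt_angleParam θ)).congr_deriv (by ring)

/-- At β = 0 the second parameter is 0 and the series stops after its first term. Thus `angP s 0`
has constant flux: it is the solution for λ = 0. -/
lemma angQ_base (s z : ℝ) : angQ s 0 z = 1 := by
  have : ∀ n : ℕ, n ≠ 0 → hypCoeff (2 * s - 1 - 0) 0 s n = 0 := by
    intro n hn
    induction n with
    | zero => exact absurd rfl hn
    | succ n ih =>
      rw [hypCoeff_succ]
      rcases eq_or_ne n 0 with rfl | hn'
      · simp
      · rw [ih hn', zero_mul]
  rw [angQ, hyp, tsum_eq_single 0 fun n hn => by rw [this n hn, zero_mul]]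
  simp [hypCoeff_zero]

/-- The solution for β = 0, up to a constant factor, is a continuous primitive of this nonnegative
weight. -/
lemma integrableOn_sin_rpow {s : ℝ} (hs0 : 0 < s) (hs1 : s < 1) :
    IntegrableOn (fun θ => sin θ ^ (2 * s - 1)) (Ioo 0 π) := by
  have hK : s * 2 ^ (1 - 2 * s) ≠ 0 := by positivity
  have := intervalIntegral.integrableOn_deriv_of_nonneg (a := 0) (b := π)
    (g := fun θ => -(angP s 0 (angleParam θ) / (s * 2 ^ (1 - 2 * s))))
    (g' := fun θ => sin θ ^ (2 * s - 1))
    (((continuousOn_angP hs0 0).comp continuous_angleParam.continuousOn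
      fun θ _ => angleParam_mem_Icc θ).div_const _).neg
    (fun θ hθ => ((hasDerivAt_angP_angle hs0 hs1 0 hθ).div_const _).neg.congr_deriv (by
      rw [angQ_base]; field_simp))
    (fun θ hθ => rpow_nonneg (sin_pos_of_mem_Ioo hθ).le _)
  exact this.mono_set Ioo_subset_Ioc_self

/-- The first-order system satisfied by an angular eigenfunction and its flux. -/
lemma angular_system {s lam : ℝ} {ψ : ℝ → ℝ} (hψ : ContDiffOn ℝ 2 ψ (Ioo 0 π))
    (hode : ∀ θ ∈ Ioo 0 π, -deriv (fun φ => sin φ ^ (1 - 2 * s) * deriv ψ φ) θ =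
      lam * sin θ ^ (1 - 2 * s) * ψ θ) {θ : ℝ} (hθ : θ ∈ Ioo 0 π) :
    HasDerivAt ψ (deriv ψ θ) θ ∧ HasDerivAt (fun φ => -(sin φ ^ (1 - 2 * s) * deriv ψ φ))
      (lam * sin θ ^ (1 - 2 * s) * ψ θ) θ := by
  have h1 : ContDiffOn ℝ (1 + 1) ψ (Ioo 0 π) := by simpa [one_add_one_eq_two] using hψ
  rw [contDiffOn_succ_iff_deriv_of_isOpen isOpen_Ioo] at h1
  have hn : Ioo 0 π ∈ 𝓝 θ := isOpen_Ioo.mem_nhds hθ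
  refine ⟨((h1.1 θ hθ).differentiableAt hn).hasDerivAt, ?_⟩
  have h2 : DifferentiableAt ℝ (deriv ψ) θ :=
    ((h1.2.2.differentiableOn one_ne_zero) θ hθ).differentiableAt hn
  have h3 : DifferentiableAt ℝ (fun φ => sin φ ^ (1 - 2 * s)) θ :=
    ((hasDerivAt_sin θ).rpow_const (Or.inl (sin_pos_of_mem_Ioo hθ).ne')).differentiableAt
  rw [← hode θ hθ]
  exact (h3.mul h2).hasDerivAt.neg

lemma tendsto_angle_comp {f : ℝ → ℝ} (hf : ContinuousOn f (Icc 0 1)) (θ₀ : ℝ) (l : Set ℝ) :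
    Tendsto (fun θ => f (angleParam θ)) (𝓝[l] θ₀) (𝓝 (f (angleParam θ₀))) :=
  (hf _ (angleParam_mem_Icc θ₀)).tendsto.comp (tendsto_nhdsWithin_iff.2
    ⟨(continuous_angleParam.tendsto θ₀).mono_left nhdsWithin_le_nhds,
      Eventually.of_forall angleParam_mem_Icc⟩)

lemma tendsto_left_of_continuousOn {ψ : ℝ → ℝ} {a b : ℝ} (hab : a < b)
    (h : ContinuousOn ψ (Icc a b)) : Tendsto ψ (𝓝[>] a) (𝓝 (ψ a)) := by
  have := (h a (left_mem_Icc.2 hab.le)).tendsto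
  rw [← nhdsWithin_Ioo_eq_nhdsGT hab]
  exact this.mono_left (nhdsWithin_mono _ Ioo_subset_Icc_self)

lemma tendsto_right_of_continuousOn {ψ : ℝ → ℝ} {a b : ℝ} (hab : a < b)
    (h : ContinuousOn ψ (Icc a b)) : Tendsto ψ (𝓝[<] b) (𝓝 (ψ b)) := by
  have := (h b (right_mem_Icc.2 hab.le)).tendsto
  rw [← nhdsWithin_Ioo_eq_nhdsLT hab]
  exact this.mono_left (nhdsWithin_mono _ Ioo_subset_Icc_self)

/-! ### Eigenvalues and the relation between P(1) and Q(1). -/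

lemma condition_of_isAngularEigenvalue {s : ℝ} (hs0 : 0 < s) (hs1 : s < 1) {β : ℝ}
    (h : IsAngularEigenvalue s (β * (β + 1 - 2 * s))) :
    s * 2 ^ (1 - 2 * s) * angQ s β 1 = extConst s * killConst s * angP s β 1 := by
  obtain ⟨ψ, ⟨θ₀, hθ₀, hne⟩, hsm, hcont, -, hode, hcon, hpi⟩ := h
  have hK : s * 2 ^ (1 - 2 * s) ≠ 0 := by positivity
  have hsys := fun θ hθ => angular_system hsm hode (θ := θ) hθ
  obtain ⟨c₁, c₂, hc⟩ := exists_angular_combination hs0 hs1 β isOpen_Ioo isPreconnected_Ioo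
    (z := angleParam) (z' := fun θ => -(sin θ / 2)) (f := ψ)
    (g := fun θ => -(sin θ ^ (1 - 2 * s) * deriv ψ θ) / (s * 2 ^ (1 - 2 * s)))
    (fun θ hθ => angleParam_mem hθ) (fun θ _ => hasDerivAt_angleParam θ)
    (fun θ hθ => (hsys θ hθ).1.congr_deriv (by
      rw [angle_weight_left s hθ]
      have := sin_rpow_mul_sin_rpow s hθ
      clear * - this hK
      generalize s * 2 ^ (1 - 2 * s) = K at *
      generalize sin θ ^ (1 - 2 * s) = a at *
      generalize sin θ ^ (2 * s - 1) = b at *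
      field_simp
      linear_combination (-deriv ψ θ) * this))
    (fun θ hθ => ((hsys θ hθ).2.div_const _).congr_deriv (by
      have e5 : (2 : ℝ) ^ (1 - 2 * s) * 2 ^ (2 * s - 1) = 1 := by
        rw [← rpow_add (by norm_num)]; simp
      have e7 : β * (β + 1 - 2 * s) / s * s = β * (β + 1 - 2 * s) := by field_simp
      rw [angle_weight_right s _ hθ, div_eq_iff hK]
      linear_combination (-(β * (β + 1 - 2 * s) / s * s * sin θ ^ (1 - 2 * s) * ψ θ)) * e5 -
        sin θ ^ (1 - 2 * s) * ψ θ * e7))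
  have hIr : ∀ᶠ θ in 𝓝[<] π, θ ∈ Ioo 0 π := by
    rw [← nhdsWithin_Ioo_eq_nhdsLT pi_pos]; exact self_mem_nhdsWithin
  have hIl : ∀ᶠ θ in 𝓝[>] 0, θ ∈ Ioo 0 π := by
    rw [← nhdsWithin_Ioo_eq_nhdsGT pi_pos]; exact self_mem_nhdsWithin
  have hcP := continuousOn_angP hs0 β
  have hcQ := continuousOn_angQ hs0 hs1 β
  have hcX := continuousOn_angX hs0 hs1 β
  -- At θ = π, that is z = 0, `angP` vanishes and `angX` is 1, so ψ(π) = 0 leaves only the multiple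
  -- of `angP`.
  have hc2 : c₂ = 0 := by
    have h1 := tendsto_right_of_continuousOn pi_pos hcont
    have h2 := ((tendsto_angle_comp hcP π (Iio π)).const_mul c₁).add
      ((tendsto_angle_comp hcX π (Iio π)).const_mul c₂)
    have h3 := tendsto_nhds_unique (h1.congr' (by
      filter_upwards [hIr] with θ hθ using (hc θ hθ).1)) h2
    rw [hpi, angleParam_pi, angP_zero hs0.ne', angX_zero] at h3
    linarith
  subst hc2
  simp only [zero_mul, add_zero] at hc
  have hc1 : c₁ ≠ 0 := by
    rintro rfl
    exact hne (by simpa using (hc θ₀ hθ₀).1)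
  have hA : ψ 0 = c₁ * angP s β 1 := by
    have h1 := tendsto_left_of_continuousOn pi_pos hcont
    have h2 := (tendsto_angle_comp hcP 0 (Ioi 0)).const_mul c₁
    have h3 := tendsto_nhds_unique (h1.congr' (by
      filter_upwards [hIl] with θ hθ using (hc θ hθ).1)) h2
    rwa [angleParam_zero] at h3
  have hB : extConst s * killConst s * ψ 0 / (s * 2 ^ (1 - 2 * s)) = c₁ * angQ s β 1 := by
    have h2 := (tendsto_angle_comp hcQ 0 (Ioi 0)).const_mul c₁
    have h3 := tendsto_nhds_unique ((hcon.div_const (s * 2 ^ (1 - 2 * s))).congr' (by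
      filter_upwards [hIl] with θ hθ using (hc θ hθ).2)) h2
    rwa [angleParam_zero] at h3
  rw [hA, div_eq_iff hK] at hB
  exact mul_left_cancel₀ hc1 (by linear_combination -hB)

lemma isAngularEigenvalue_of_condition {s : ℝ} (hs0 : 0 < s) (hs1 : s < 1) {β : ℝ}
    (h : s * 2 ^ (1 - 2 * s) * angQ s β 1 = extConst s * killConst s * angP s β 1) :
    IsAngularEigenvalue s (β * (β + 1 - 2 * s)) := by
  set ψ : ℝ → ℝ := fun θ => angP s β (angleParam θ) with hψ
  have hd : ∀ θ ∈ Ioo 0 π, HasDerivAt ψ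
      (-(s * 2 ^ (1 - 2 * s) * sin θ ^ (2 * s - 1)) * angQ s β (angleParam θ)) θ :=
    fun θ hθ => hasDerivAt_angP_angle hs0 hs1 β hθ
  have hflux : ∀ θ ∈ Ioo 0 π, sin θ ^ (1 - 2 * s) * deriv ψ θ =
      -(s * 2 ^ (1 - 2 * s)) * angQ s β (angleParam θ) := fun θ hθ => by
    rw [(hd θ hθ).deriv]
    linear_combination (-(s * 2 ^ (1 - 2 * s)) * angQ s β (angleParam θ)) *
      sin_rpow_mul_sin_rpow s hθ
  have hcz : ∀ {f : ℝ → ℝ}, ContinuousOn f (Icc 0 1) → Continuous fun θ => f (angleParam θ) :=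
    fun hf => hf.comp_continuous continuous_angleParam angleParam_mem_Icc
  have hIl : ∀ᶠ θ in 𝓝[>] 0, θ ∈ Ioo 0 π := by
    rw [← nhdsWithin_Ioo_eq_nhdsGT pi_pos]; exact self_mem_nhdsWithin
  have hcP := hcz (continuousOn_angP hs0 β)
  have hcQ := hcz (continuousOn_angQ hs0 hs1 β)
  refine ⟨ψ, ?_, ?_, hcP.continuousOn, ?_, ?_, ?_, ?_⟩
  -- If ψ vanished on (0, π), its flux would vanish too, against the Wronskian -1.
  · by_contra! h0
    have h2 : π / 2 ∈ Ioo 0 π := ⟨by positivity, by linarith [pi_pos]⟩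
    have hz : angP s β (angleParam (π / 2)) = 0 := h0 _ h2
    have hdz : HasDerivAt ψ 0 (π / 2) := by
      refine (hasDerivAt_const (π / 2) (0 : ℝ)).congr_of_eventuallyEq ?_
      filter_upwards [isOpen_Ioo.mem_nhds h2] with θ hθ using h0 θ hθ
    have hq : angQ s β (angleParam (π / 2)) = 0 := by
      have := (hd _ h2).unique hdz
      rw [sin_pi_div_two, one_rpow, mul_one] at this
      have hK : -(s * 2 ^ (1 - 2 * s)) ≠ 0 := by
        have : 0 < s * 2 ^ (1 - 2 * s) := by positivity
        linarith
      exact (mul_eq_zero.1 this).resolve_left hK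
    have := angP_mul_angY_sub hs0 hs1 β (angleParam_mem h2)
    rw [hz, hq] at this
    norm_num at this
  -- Regularity is transported from the slope variable through y = cot θ.
  · have h1 := (contDiff_of_linear_system
      (fun n => contDiff_const.mul (contDiff_one_add_sq_rpow (-(1 / 2) - s) n))
      (fun n => contDiff_const.mul (contDiff_one_add_sq_rpow (s - 3 / 2) n))
      (fun y => (slice_system hs0 hs1 β y).1) (fun y => (slice_system hs0 hs1 β y).2) 2).1
    have h2 : ContDiffOn ℝ 2 (fun θ => cos θ / sin θ) (Ioo 0 π) :=
      contDiff_cos.contDiffOn.div contDiff_sin.contDiffOn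
        fun θ hθ => (sin_pos_of_mem_Ioo hθ).ne'
    refine (h1.comp_contDiffOn h2).congr fun θ hθ => ?_
    have hsin := sin_pos_of_mem_Ioo hθ
    have e : 1 + (cos θ / sin θ) ^ 2 = (sin θ ^ (2 : ℝ))⁻¹ := by
      rw [rpow_two]; field_simp; exact sin_sq_add_cos_sq θ
    simp only [hψ, Function.comp_apply]
    congr 1
    rw [angleParam, slopeParam, e, inv_rpow (by positivity), ← rpow_neg (by positivity),
      ← rpow_mul hsin.le]
    norm_num
    field_simp
  -- Since ψ' is sin^{2s-1} times a continuous function, the energy density is a sum of the weights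
  -- sin^{1-2s} and sin^{2s-1}, each times a continuous function.
  · have h1 : IntegrableOn (fun θ => sin θ ^ (1 - 2 * s)) (Ioo 0 π) := by
      have := integrableOn_sin_rpow (s := 1 - s) (by linarith) (by linarith)
      rwa [show 2 * (1 - s) - 1 = 1 - 2 * s by ring] at this
    have h2 := integrableOn_sin_rpow hs0 hs1
    have bd : ∀ {w F : ℝ → ℝ}, IntegrableOn w (Ioo 0 π) → Continuous F →
        IntegrableOn (fun θ => w θ * F θ) (Ioo 0 π) := fun {w F} hw hF => by
      obtain ⟨M, hM⟩ := isCompact_Icc.exists_bound_of_continuousOn (hF.continuousOn (s := Icc 0 π))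
      refine Integrable.mul_bdd (c := M) hw hF.aestronglyMeasurable ?_
      filter_upwards [ae_restrict_mem measurableSet_Ioo] with θ hθ
        using hM θ (Ioo_subset_Icc_self hθ)
    refine ((bd h1 (hcP.pow 2)).add (bd h2 ((continuous_const.mul hcQ).pow 2) :
      IntegrableOn (fun θ => sin θ ^ (2 * s - 1) * (s * 2 ^ (1 - 2 * s) *
        angQ s β (angleParam θ)) ^ 2) _)).congr_fun (fun θ hθ => ?_) measurableSet_Ioo
    simp only [Pi.add_apply, Pi.pow_apply, hψ]
    rw [← hψ, (hd θ hθ).deriv]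
    linear_combination (-(sin θ ^ (2 * s - 1) * (s * 2 ^ (1 - 2 * s) *
        angQ s β (angleParam θ)) ^ 2)) * sin_rpow_mul_sin_rpow s hθ
  · intro θ hθ
    have hev : (fun φ => sin φ ^ (1 - 2 * s) * deriv ψ φ) =ᶠ[𝓝 θ]
        fun φ => -(s * 2 ^ (1 - 2 * s)) * angQ s β (angleParam φ) := by
      filter_upwards [isOpen_Ioo.mem_nhds hθ] with φ hφ using hflux φ hφ
    rw [hev.deriv_eq, ((hasDerivAt_angQ_angle hs0 hs1 β hθ).const_mul _).deriv]
    have e5 : (2 : ℝ) ^ (1 - 2 * s) * 2 ^ (2 * s - 1) = 1 := by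
      rw [← rpow_add (by norm_num)]; simp
    have e7 : β * (β + 1 - 2 * s) / s * s = β * (β + 1 - 2 * s) := by field_simp
    linear_combination (β * (β + 1 - 2 * s) / s * s * sin θ ^ (1 - 2 * s) * ψ θ) * e5 +
        sin θ ^ (1 - 2 * s) * ψ θ * e7
  · have h1 := (tendsto_angle_comp (continuousOn_angQ hs0 hs1 β) 0 (Ioi 0)).const_mul
      (s * 2 ^ (1 - 2 * s))
    rw [angleParam_zero, h] at h1
    have h0 : ψ 0 = angP s β 1 := by rw [hψ]; simp only [angleParam_zero]
    rw [h0]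
    refine h1.congr' ?_
    filter_upwards [hIl] with θ hθ
    rw [hflux θ hθ]; ring
  · rw [hψ]; simp only [angleParam_pi]; exact angP_zero hs0.ne' β

/-! ### Nonnegativity of the eigenvalues. -/

/-- An eigenfunction with a negative eigenvalue that is positive somewhere is nonnegative, and so
is its flux. -/
lemma angular_nonneg {s lam : ℝ} {ψ : ℝ → ℝ} (hlam : lam < 0) (hsm : ContDiffOn ℝ 2 ψ (Ioo 0 π))
    (hcont : ContinuousOn ψ (Icc 0 π))
    (hode : ∀ θ ∈ Ioo 0 π, -deriv (fun φ => sin φ ^ (1 - 2 * s) * deriv ψ φ) θ =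
      lam * sin θ ^ (1 - 2 * s) * ψ θ) (hpi : ψ π = 0) {θ₀ : ℝ} (hθ₀ : θ₀ ∈ Ioo 0 π)
    (hpos : 0 < ψ θ₀) {θ : ℝ} (hθ : θ ∈ Ioo 0 π) :
    0 ≤ ψ θ ∧ 0 ≤ -(sin θ ^ (1 - 2 * s) * deriv ψ θ) := by
  have hsys := fun θ hθ => angular_system hsm hode (θ := θ) hθ
  have hw : ∀ θ ∈ Ioo 0 π, 0 < sin θ ^ (1 - 2 * s) := fun θ hθ =>
    rpow_pos_of_pos (sin_pos_of_mem_Ioo hθ) _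
  -- With w = sin^{1-2s}: E' = w(λψ² - ψ'²) ≤ 0 and (ψ²)' = -2E/w.
  set E : ℝ → ℝ := fun θ => -(sin θ ^ (1 - 2 * s) * deriv ψ θ) * ψ θ with hE
  have hEd : ∀ θ ∈ Ioo 0 π, HasDerivAt E (lam * sin θ ^ (1 - 2 * s) * ψ θ * ψ θ +
      -(sin θ ^ (1 - 2 * s) * deriv ψ θ) * deriv ψ θ) θ := fun θ hθ =>
    (hsys θ hθ).2.mul (hsys θ hθ).1
  have hEanti : AntitoneOn E (Ioo 0 π) := by
    refine antitoneOn_of_deriv_nonpos (convex_Ioo 0 π)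
      (fun θ hθ => (hEd θ hθ).continuousAt.continuousWithinAt)
      (fun θ hθ => (hEd θ (interior_subset hθ)).differentiableAt.differentiableWithinAt)
      fun θ hθ => ?_
    have hθ := interior_subset hθ
    rw [(hEd θ hθ).deriv]
    have h1 := mul_nonneg (hw θ hθ).le (mul_self_nonneg (ψ θ))
    have h2 := mul_nonneg (hw θ hθ).le (mul_self_nonneg (deriv ψ θ))
    nlinarith
  have hsq : ∀ θ ∈ Ioo 0 π, HasDerivAt (fun θ => ψ θ ^ 2) (2 * ψ θ * deriv ψ θ) θ := fun θ hθ =>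
    ((hsys θ hθ).1.pow 2).congr_deriv (by simp)
  have hEsq : ∀ θ ∈ Ioo 0 π, sin θ ^ (1 - 2 * s) * (2 * ψ θ * deriv ψ θ) = -2 * E θ :=
    fun θ _ => by simp only [hE]; ring
  -- If E were negative at θ₁ it would stay so up to π, hence ψ² would increase to ψ(π)² = 0. Then
  -- ψ(θ₁) = 0 and E(θ₁) = 0, a contradiction.
  have hE0 : ∀ θ ∈ Ioo 0 π, 0 ≤ E θ := by
    intro θ₁ h1
    by_contra! hneg
    have hmono : MonotoneOn (fun θ => ψ θ ^ 2) (Icc θ₁ π) := by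
      have hsub : Ioo θ₁ π ⊆ Ioo 0 π := Ioo_subset_Ioo_left h1.1.le
      refine monotoneOn_of_deriv_nonneg (convex_Icc θ₁ π)
        ((hcont.mono (Icc_subset_Icc_left h1.1.le)).pow 2) ?_ ?_ <;> rw [interior_Icc]
      · exact fun θ hθ => (hsq θ (hsub hθ)).differentiableAt.differentiableWithinAt
      · intro θ hθ
        rw [(hsq θ (hsub hθ)).deriv]
        have h2 := hEsq θ (hsub hθ)
        have h3 := hEanti h1 (hsub hθ) hθ.1.le
        have h4 := hw θ (hsub hθ)
        by_contra! h5
        nlinarith [mul_pos h4 (neg_pos.2 h5)]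
    have h2 := hmono (left_mem_Icc.2 h1.2.le) (right_mem_Icc.2 h1.2.le) h1.2.le
    simp only [hpi] at h2
    have h3 : ψ θ₁ = 0 := pow_eq_zero_iff two_ne_zero |>.1 (le_antisymm (by simpa using h2)
      (sq_nonneg _))
    simp [hE, h3] at hneg
  have hanti : AntitoneOn (fun θ => ψ θ ^ 2) (Icc 0 π) := by
    refine antitoneOn_of_deriv_nonpos (convex_Icc 0 π) (hcont.pow 2) ?_ ?_ <;> rw [interior_Icc]
    · exact fun θ hθ => (hsq θ hθ).differentiableAt.differentiableWithinAt
    · intro θ hθ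
      rw [(hsq θ hθ).deriv]
      by_contra! h5
      nlinarith [mul_pos (hw θ hθ) h5, hE0 θ hθ, hEsq θ hθ]
  -- ψ² is nonincreasing, so ψ stays zero to the right of any zero and cannot take both signs.
  have hψ0 : ∀ θ ∈ Ioo 0 π, 0 ≤ ψ θ := by
    intro θ₁ h1
    by_contra! hneg
    obtain ⟨ζ, hζ, hζ0⟩ : ∃ ζ ∈ uIcc θ₁ θ₀, ψ ζ = 0 := by
      have hsub : uIcc θ₁ θ₀ ⊆ Icc 0 π :=
        (ordConnected_Icc.uIcc_subset (Ioo_subset_Icc_self h1) (Ioo_subset_Icc_self hθ₀))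
      have := intermediate_value_uIcc (hcont.mono hsub)
      exact this (by rw [mem_uIcc]; left; exact ⟨hneg.le, hpos.le⟩)
    have hζm : ζ ∈ Icc 0 π :=
      (ordConnected_Icc.uIcc_subset (Ioo_subset_Icc_self h1) (Ioo_subset_Icc_self hθ₀)) hζ
    have h2 : ∀ θ ∈ Icc 0 π, ζ ≤ θ → ψ θ = 0 := fun θ hθ hle => by
      have h3 := hanti hζm hθ hle
      simp only [hζ0] at h3
      exact pow_eq_zero_iff two_ne_zero |>.1 (le_antisymm (by simpa using h3) (sq_nonneg _))
    rcases mem_uIcc.1 hζ with h | h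
    · exact hpos.ne' (h2 _ (Ioo_subset_Icc_self hθ₀) h.2)
    · exact hneg.ne (h2 _ (Ioo_subset_Icc_self h1) h.2)
  refine ⟨hψ0 θ hθ, ?_⟩
  rcases (hψ0 θ hθ).eq_or_lt with h | h
  · have : IsLocalMin ψ θ := by
      filter_upwards [isOpen_Ioo.mem_nhds hθ] with φ hφ
      rw [← h]; exact hψ0 φ hφ
    rw [this.deriv_eq_zero]; simp
  · exact nonneg_of_mul_nonneg_left (hE0 θ hθ) h

/-- Reflection at 2s. This root makes λ = 0 an eigenvalue, whose positive eigenfunction `angP s 0`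
serves for comparison. -/
lemma exponentEq_zero {s : ℝ} : ExponentEq s 0 := by
  have h := Gamma_mul_Gamma_one_sub (2 * s)
  have hpi := pi_ne_zero
  rw [ExponentEq, show (0 : ℝ) - 2 * s + 1 = 1 - 2 * s by ring, mul_comm (Gamma (1 - 2 * s)), h,
    show π * (0 - 2 * s) = -(π * (2 * s)) by ring, show π * (0 - s) = -(π * s) by ring, sin_neg,
    sin_neg, zero_add, Gamma_one]
  by_cases h0 : sin (π * s) = 0
  · have : sin (π * (2 * s)) = 0 := by
      rw [show π * (2 * s) = 2 * (π * s) by ring, sin_two_mul, h0]; ring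
    simp [h0, this]
  · field_simp

lemma angular_condition_zero {s : ℝ} (hs0 : 0 < s) (hs1 : s < 1) :
    s * 2 ^ (1 - 2 * s) = extConst s * killConst s * angP s 0 1 := by
  have hn : ∀ n : ℕ, (0 : ℝ) ≠ 2 * s + n := fun n => by positivity
  have e := conormal_const_eq hs0 hs1 (β := 0) (by norm_num) hn
  rwa [(exponentEq_iff hs0 hs1 (by norm_num) hn).2 ⟨exponentEq_zero, by linarith⟩,
    ← mul_div_assoc, div_eq_iff (angP_one_ne_zero hs0 (by norm_num) hn), angQ_base, mul_one] at e

/-- If λ < 0, compare ψ ≥ 0 with the eigenfunction P for λ = 0. Their Wronskian W satisfies W' = λ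
sin^{1-2s} ψ P ≤ 0 and tends to 0 at θ = 0, both functions having the same boundary condition there.
Near π only the sign of the flux of ψ is needed: W ≥ -Kψ → 0. So W vanishes identically, although W'
≠ 0 where ψ > 0. -/
lemma nonneg_of_isAngularEigenvalue {s lam : ℝ} (hs0 : 0 < s) (hs1 : s < 1)
    (h : IsAngularEigenvalue s lam) : 0 ≤ lam := by
  by_contra! hlam
  obtain ⟨ψ, ⟨θ₀, hθ₀, hne⟩, hsm, hcont, -, hode, hcon, hpi⟩ := h
  wlog hpos : 0 < ψ θ₀ generalizing ψ
  · have hd : deriv (fun θ => -ψ θ) = fun θ => -deriv ψ θ := funext fun θ => deriv.fun_neg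
    refine this (fun θ => -ψ θ) (by simpa using hne) hsm.neg hcont.neg (fun θ hθ => ?_) ?_
      (by simp [hpi]) ?_
    · rw [hd]
      have := hode θ hθ
      simp only [mul_neg, deriv.fun_neg]
      linarith
    · rw [hd]
      simpa using hcon.neg
    · rcases lt_or_gt_of_ne hne with h | h
      · simpa using h
      · exact absurd h hpos
  have hnn := fun θ hθ => angular_nonneg hlam hsm hcont hode hpi hθ₀ hpos (θ := θ) hθ
  have hsys := fun θ hθ => angular_system hsm hode (θ := θ) hθ
  have hK : 0 < s * 2 ^ (1 - 2 * s) := by positivity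
  set K := s * 2 ^ (1 - 2 * s) with hKdef
  set P : ℝ → ℝ := fun θ => angP s 0 (angleParam θ) with hP
  have hPd : ∀ θ ∈ Ioo 0 π, HasDerivAt P (-(K * sin θ ^ (2 * s - 1))) θ := fun θ hθ =>
    (hasDerivAt_angP_angle hs0 hs1 0 hθ).congr_deriv (by rw [angQ_base, mul_one])
  have hPc : ContinuousOn P (Icc 0 π) :=
    ((continuousOn_angP hs0 0).comp_continuous continuous_angleParam
      angleParam_mem_Icc).continuousOn
  have hPpi : P π = 0 := by rw [hP]; simp only [angleParam_pi]; exact angP_zero hs0.ne' 0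
  have hPpos : ∀ θ ∈ Ioo 0 π, 0 < P θ := by
    have hanti : StrictAntiOn P (Icc 0 π) := by
      refine strictAntiOn_of_deriv_neg (convex_Icc 0 π) hPc fun θ hθ => ?_
      rw [interior_Icc] at hθ
      rw [(hPd θ hθ).deriv]
      have := rpow_pos_of_pos (sin_pos_of_mem_Ioo hθ) (2 * s - 1)
      exact neg_neg_of_pos (by positivity)
    intro θ hθ
    rw [← hPpi]
    exact hanti (Ioo_subset_Icc_self hθ) (right_mem_Icc.2 pi_pos.le) hθ.2
  set W : ℝ → ℝ := fun θ => -(sin θ ^ (1 - 2 * s) * deriv ψ θ) * P θ - K * ψ θ with hW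
  have hWd : ∀ θ ∈ Ioo 0 π, HasDerivAt W (lam * sin θ ^ (1 - 2 * s) * ψ θ * P θ) θ := fun θ hθ =>
    (((hsys θ hθ).2.mul (hPd θ hθ)).sub ((hsys θ hθ).1.const_mul K)).congr_deriv (by
      linear_combination (K * deriv ψ θ) * sin_rpow_mul_sin_rpow s hθ)
  have hWle : ∀ θ ∈ Ioo 0 π, lam * sin θ ^ (1 - 2 * s) * ψ θ * P θ ≤ 0 := fun θ hθ => by
    have h1 := mul_nonneg (mul_nonneg (rpow_nonneg (sin_pos_of_mem_Ioo hθ).le (1 - 2 * s))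
      (hnn θ hθ).1) (hPpos θ hθ).le
    nlinarith
  have hWanti : AntitoneOn W (Ioo 0 π) := by
    refine antitoneOn_of_deriv_nonpos (convex_Ioo 0 π)
      (fun θ hθ => (hWd θ hθ).continuousAt.continuousWithinAt)
      (fun θ hθ => (hWd θ (interior_subset hθ)).differentiableAt.differentiableWithinAt)
      fun θ hθ => ?_
    rw [(hWd θ (interior_subset hθ)).deriv]
    exact hWle θ (interior_subset hθ)
  have hIr : ∀ᶠ θ in 𝓝[<] π, θ ∈ Ioo 0 π := by
    rw [← nhdsWithin_Ioo_eq_nhdsLT pi_pos]; exact self_mem_nhdsWithin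
  have hIl : ∀ᶠ θ in 𝓝[>] 0, θ ∈ Ioo 0 π := by
    rw [← nhdsWithin_Ioo_eq_nhdsGT pi_pos]; exact self_mem_nhdsWithin
  have hW0 : Tendsto W (𝓝[>] 0) (𝓝 0) := by
    have h1 := (hcon.mul (tendsto_left_of_continuousOn pi_pos hPc)).sub
      ((tendsto_left_of_continuousOn pi_pos hcont).const_mul K)
    have h2 : P 0 = angP s 0 1 := by rw [hP]; simp only [angleParam_zero]
    rw [h2, hKdef, angular_condition_zero hs0 hs1] at h1
    convert h1 using 2
    · rw [hW, hKdef, angular_condition_zero hs0 hs1]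
    · ring
  have hWnonpos : ∀ θ ∈ Ioo 0 π, W θ ≤ 0 := fun θ hθ => by
    refine ge_of_tendsto hW0 ?_
    filter_upwards [hIl, Ioo_mem_nhdsGT hθ.1] with φ hφ hφ'
    exact hWanti hφ hθ hφ'.2.le
  have hWnonneg : ∀ θ ∈ Ioo 0 π, 0 ≤ W θ := fun θ hθ => by
    have h1 : Tendsto (fun θ => -(K * ψ θ)) (𝓝[<] π) (𝓝 0) := by
      have := ((tendsto_right_of_continuousOn pi_pos hcont).const_mul K).neg
      simpa [hpi] using this
    refine le_of_tendsto h1 ?_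
    filter_upwards [hIr, Ioo_mem_nhdsLT hθ.2] with φ hφ hφ'
    refine le_trans ?_ (hWanti hθ hφ hφ'.1.le)
    have := mul_nonneg (hnn φ hφ).2 (hPpos φ hφ).le
    simp only [hW]
    linarith
  have hzero : HasDerivAt W 0 θ₀ := by
    refine (hasDerivAt_const θ₀ (0 : ℝ)).congr_of_eventuallyEq ?_
    filter_upwards [isOpen_Ioo.mem_nhds hθ₀] with θ hθ
      using le_antisymm (hWnonpos θ hθ) (hWnonneg θ hθ)
  have hne0 : lam * sin θ₀ ^ (1 - 2 * s) * ψ θ₀ * P θ₀ ≠ 0 :=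
    mul_ne_zero (mul_ne_zero (mul_ne_zero hlam.ne
      (rpow_pos_of_pos (sin_pos_of_mem_Ioo hθ₀) _).ne') hpos.ne') (hPpos θ₀ hθ₀).ne'
  exact hne0 ((hWd θ₀ hθ₀).unique hzero)

/-- As λ ≥ 0, the square root is at least |2s-1|/2. Hence β ≥ max(2s-1, 0), and on this range the
formula for β inverts λ = β(β+1-2s). -/
theorem isRegionalExponent_iff {s : ℝ} (hs0 : 0 < s) (hs1 : s < 1) (β : ℝ) :
    IsRegionalExponent s β ↔ max (2 * s - 1) 0 ≤ β ∧ ExponentEq s β := by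
  constructor
  · rintro ⟨lam, hev, hβ⟩
    have hlam := nonneg_of_isAngularEigenvalue hs0 hs1 hev
    set q := √(lam + ((2 * s - 1) / 2) ^ 2) with hq
    have hqsq : q ^ 2 = lam + ((2 * s - 1) / 2) ^ 2 := sq_sqrt (by positivity)
    have hge : |(2 * s - 1) / 2| ≤ q := abs_le_sqrt (by linarith)
    have hmax : max (2 * s - 1) 0 ≤ β := by
      rw [abs_le] at hge
      exact max_le (by linarith [le_abs_self ((2 * s - 1) / 2)]) (by linarith)
    have hl : lam = β * (β + 1 - 2 * s) := by rw [hβ]; linear_combination -hqsq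
    rw [hl] at hev
    exact ⟨hmax, (angular_condition_iff hs0 hs1 hmax).1 (condition_of_isAngularEigenvalue hs0 hs1 hev)⟩
  · rintro ⟨hmax, hE⟩
    refine ⟨β * (β + 1 - 2 * s), isAngularEigenvalue_of_condition hs0 hs1
      ((angular_condition_iff hs0 hs1 hmax).2 hE), ?_⟩
    have h1 := (le_max_left _ _).trans hmax
    have h2 := (le_max_right _ _).trans hmax
    rw [show β * (β + 1 - 2 * s) + ((2 * s - 1) / 2) ^ 2 = (β - (2 * s - 1) / 2) ^ 2 by ring,
      sqrt_sq (by linarith)]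
    ring

/-! ### The principal value integral for `-1 < β < 2s` -/

lemma abs_one_sub_rpow_le (b : ℝ) {σ : ℝ} (h0 : 0 < σ) (h1 : σ ≤ 1) :
    |1 - σ ^ b| ≤ max 1 |b| * σ ^ min b 0 * (1 - σ) := by
  have key : ∀ c : ℝ, 0 ≤ c → |1 - σ ^ c| ≤ max 1 c * (1 - σ) := by
    intro c hc
    rw [abs_of_nonneg (sub_nonneg.2 (rpow_le_one h0.le h1 hc))]
    rcases le_total c 1 with h | h
    · rw [max_eq_left h]
      have := rpow_le_rpow_of_exponent_ge h0 h1 h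
      rw [rpow_one] at this
      linarith
    · rw [max_eq_right h]
      have := one_add_mul_self_le_rpow_one_add (s := σ - 1) (by linarith) h
      rw [add_sub_cancel] at this
      linarith
  rcases le_total 0 b with h | h
  · rw [min_eq_right h, rpow_zero, mul_one, abs_of_nonneg h]
    exact key b h
  · rw [min_eq_left h, abs_of_nonpos h]
    have h2 : 1 - σ ^ b = -(σ ^ b * (1 - σ ^ (-b))) := by
      rw [mul_sub, ← rpow_add h0]; simp
    rw [h2, abs_neg, abs_mul, abs_of_pos (rpow_pos_of_pos h0 b)]
    calc σ ^ b * |1 - σ ^ (-b)| ≤ σ ^ b * (max 1 (-b) * (1 - σ)) :=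
          mul_le_mul_of_nonneg_left (key (-b) (by linarith)) (rpow_pos_of_pos h0 b).le
      _ = _ := by ring

lemma ofReal_beta_integrand (p q : ℝ) {x : ℝ} (hx : x ∈ Icc (0 : ℝ) 1) :
    (x : ℂ) ^ ((p : ℂ) - 1) * (1 - (x : ℂ)) ^ ((q : ℂ) - 1) =
      ((x ^ (p - 1) * (1 - x) ^ (q - 1) : ℝ) : ℂ) := by
  rw [Complex.ofReal_mul, Complex.ofReal_cpow hx.1, Complex.ofReal_cpow (by linarith [hx.2])]
  push_cast; rfl

lemma intervalIntegrable_beta {p q : ℝ} (hp : 0 < p) (hq : 0 < q) :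
    IntervalIntegrable (fun x : ℝ => x ^ (p - 1) * (1 - x) ^ (q - 1)) volume 0 1 := by
  have h := Complex.betaIntegral_convergent (u := p) (v := q) (by simpa) (by simpa)
  rw [intervalIntegrable_iff_integrableOn_Ioc_of_le zero_le_one] at h ⊢
  have h2 := h.re
  refine h2.congr ?_
  filter_upwards [ae_restrict_mem measurableSet_Ioc] with x hx
  have := ofReal_beta_integrand p q ⟨hx.1.le, hx.2⟩
  simp only [this]
  exact Complex.ofReal_re _

lemma integral_beta {p q : ℝ} (hp : 0 < p) (hq : 0 < q) :
    ∫ x in (0 : ℝ)..1, x ^ (p - 1) * (1 - x) ^ (q - 1) = Gamma p * Gamma q / Gamma (p + q) := by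
  have h := Complex.betaIntegral_eq_Gamma_mul_div (p : ℂ) q (by simpa) (by simpa)
  rw [Complex.betaIntegral] at h
  have h2 : ∫ x in (0 : ℝ)..1, (x : ℂ) ^ ((p : ℂ) - 1) * (1 - (x : ℂ)) ^ ((q : ℂ) - 1) =
      ∫ x in (0 : ℝ)..1, ((x ^ (p - 1) * (1 - x) ^ (q - 1) : ℝ) : ℂ) :=
    intervalIntegral.integral_congr fun x hx => by
      rw [uIcc_of_le zero_le_one] at hx
      exact ofReal_beta_integrand p q hx
  rw [h2, intervalIntegral.integral_ofReal] at h
  have h3 : (p : ℂ) + q = ((p + q : ℝ) : ℂ) := by push_cast; rfl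
  rw [h3, Complex.Gamma_ofReal, Complex.Gamma_ofReal, Complex.Gamma_ofReal] at h
  exact_mod_cast h

/-- The integrand of the principal value after folding `(1, ∞)` onto `(0, 1)`. -/
def foldedIntegrand (s β σ : ℝ) : ℝ :=
  -- The inner part has numerator 1-σ^β and the folded outer part σ^{2s-1} - σ^{2s-1-β}. Their sum
  -- factors, and the double zero at σ = 1 replaces the principal value by a convergent integral.
  (1 - σ ^ β) * (1 - σ ^ (2 * s - 1 - β)) * (1 - σ) ^ (-1 - 2 * s)

lemma abs_foldedIntegrand_le (s β : ℝ) {σ : ℝ} (h0 : 0 < σ) (h1 : σ < 1) :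
    |foldedIntegrand s β σ| ≤ max 1 |β| * max 1 |2 * s - 1 - β| *
      (σ ^ (min β 0 + min (2 * s - 1 - β) 0) * (1 - σ) ^ (1 - 2 * s)) := by
  have hu : 0 < 1 - σ := by linarith
  have e1 := abs_one_sub_rpow_le β h0 h1.le
  have e2 := abs_one_sub_rpow_le (2 * s - 1 - β) h0 h1.le
  have e3 : (1 - σ) ^ (1 - 2 * s) = (1 - σ) * (1 - σ) * (1 - σ) ^ (-1 - 2 * s) := by
    rw [show 1 - 2 * s = -1 - 2 * s + 1 + 1 by ring, rpow_add_one hu.ne', rpow_add_one hu.ne']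
    ring
  rw [foldedIntegrand, abs_mul, abs_mul, abs_of_pos (rpow_pos_of_pos hu _), e3, rpow_add h0]
  calc |1 - σ ^ β| * |1 - σ ^ (2 * s - 1 - β)| * (1 - σ) ^ (-1 - 2 * s)
      ≤ (max 1 |β| * σ ^ min β 0 * (1 - σ)) *
        (max 1 |2 * s - 1 - β| * σ ^ min (2 * s - 1 - β) 0 * (1 - σ)) * (1 - σ) ^ (-1 - 2 * s) := by
        gcongr
    _ = _ := by ring

lemma measurable_foldedIntegrand (s β : ℝ) : Measurable (foldedIntegrand s β) := by
  unfold foldedIntegrand; fun_prop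

lemma min_add_min_gt {s β : ℝ} (hs0 : 0 < s) (hβ : -1 < β) (hβ' : β < 2 * s) :
    -1 < min β 0 + min (2 * s - 1 - β) 0 := by
  rcases min_choice β 0 with h | h <;> rcases min_choice (2 * s - 1 - β) 0 with h' | h' <;>
    rw [h, h'] <;> linarith

lemma intervalIntegrable_foldedIntegrand {s β : ℝ} (hs0 : 0 < s) (hs1 : s < 1) (hβ : -1 < β)
    (hβ' : β < 2 * s) : IntervalIntegrable (foldedIntegrand s β) volume 0 1 := by
  have h := intervalIntegrable_beta (p := min β 0 + min (2 * s - 1 - β) 0 + 1) (q := 2 - 2 * s)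
    (by linarith [min_add_min_gt hs0 hβ hβ']) (by linarith)
  have h2 := h.const_mul (max 1 |β| * max 1 |2 * s - 1 - β|)
  rw [intervalIntegrable_iff_integrableOn_Ioo_of_le zero_le_one] at h2 ⊢
  refine h2.mono' (measurable_foldedIntegrand s β).aestronglyMeasurable ?_
  filter_upwards [ae_restrict_mem measurableSet_Ioo] with x hx
  have := abs_foldedIntegrand_le s β hx.1 hx.2
  rwa [add_sub_cancel_right, show 2 - 2 * s - 1 = 1 - 2 * s by ring]

/-! ### Reduction to Beta integrals for s ≠ 1/2. -/

/-- A primitive used to integrate `σ^{x-1} (1-σ)^{y-1}` by parts twice. -/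
def betaPrim (y x σ : ℝ) : ℝ :=
  σ ^ x * (1 - σ) ^ y * (-1 / y - (x + y) * (1 - σ) / (y * (y + 1)))

/-- With y = -2s the exponent y-1 is not integrable at σ = 1; this trades it for y+1 = 1-2s > -1.
The condition y+1 ≠ 0 excludes s = 1/2. -/
lemma hasDerivAt_betaPrim {y : ℝ} (hy : y ≠ 0) (hy' : y + 1 ≠ 0) (x : ℝ) {σ : ℝ} (h0 : 0 < σ)
    (h1 : σ < 1) :
    HasDerivAt (betaPrim y x) (σ ^ (x - 1) * (1 - σ) ^ (y - 1) -
      (x + y) * (x + y + 1) / (y * (y + 1)) * (σ ^ (x - 1) * (1 - σ) ^ (y + 1))) σ := by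
  have hu : 0 < 1 - σ := by linarith
  have d1 : HasDerivAt (fun σ : ℝ => σ ^ x) (x * σ ^ (x - 1)) σ :=
    hasDerivAt_rpow_const (Or.inl h0.ne')
  have d0 : HasDerivAt (fun σ : ℝ => 1 - σ) (-1) σ := (hasDerivAt_id σ).const_sub 1
  have d2 : HasDerivAt (fun σ : ℝ => (1 - σ) ^ y) (-1 * y * (1 - σ) ^ (y - 1)) σ :=
    d0.rpow_const (Or.inl hu.ne')
  have d3 : HasDerivAt (fun σ : ℝ => -1 / y - (x + y) * (1 - σ) / (y * (y + 1)))
      ((x + y) / (y * (y + 1))) σ := by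
    refine (((d0.const_mul (x + y)).div_const (y * (y + 1))).const_sub (-1 / y)).congr_deriv ?_
    ring
  refine ((d1.mul d2).mul d3).congr_deriv ?_
  have e1 : σ ^ x = σ ^ (x - 1) * σ := by rw [← rpow_add_one h0.ne', sub_add_cancel]
  have e2 : (1 - σ) ^ y = (1 - σ) ^ (y - 1) * (1 - σ) := by
    rw [← rpow_add_one hu.ne', sub_add_cancel]
  have e3 : (1 - σ) ^ (y + 1) = (1 - σ) ^ (y - 1) * (1 - σ) * (1 - σ) := by
    rw [rpow_add_one hu.ne', e2]
  simp only [Pi.mul_apply]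
  rw [e3, e1, e2]
  generalize σ ^ (x - 1) = A
  generalize (1 - σ) ^ (y - 1) = B
  field_simp
  ring

lemma mul_add_one_div_Gamma (z : ℝ) : z * (z + 1) / Gamma (z + 2) = 1 / Gamma z := by
  by_cases h0 : z = 0
  · simp [h0, Gamma_zero]
  by_cases h1 : z + 1 = 0
  · obtain rfl : z = -1 := by linarith
    have : Gamma (-1) = 0 := (Gamma_eq_zero_iff _).2 ⟨1, by norm_num⟩
    simp [this]
  · rw [show z + 2 = z + 1 + 1 by ring, Gamma_add_one h1, Gamma_add_one h0]
    by_cases h2 : Gamma z = 0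
    · simp [h2]
    field_simp

/-- Combination of `betaPrim` that vanishes at both endpoints. -/
def foldedPrim (s β σ : ℝ) : ℝ :=
  betaPrim (-2 * s) 1 σ - betaPrim (-2 * s) (β + 1) σ - betaPrim (-2 * s) (2 * s - β) σ +
    betaPrim (-2 * s) (2 * s) σ

lemma tendsto_foldedPrim_zero {s β : ℝ} (hs0 : 0 < s) (hβ : -1 < β) (hβ' : β < 2 * s) :
    Tendsto (foldedPrim s β) (𝓝[>] 0) (𝓝 0) := by
  have key : ∀ x : ℝ, 0 < x → Tendsto (betaPrim (-2 * s) x) (𝓝[>] 0) (𝓝 0) := by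
    intro x hx
    have : ContinuousAt (betaPrim (-2 * s) x) 0 := by
      refine ((continuousAt_rpow_const _ _ (Or.inr hx.le)).mul
        (ContinuousAt.rpow_const (by fun_prop) (Or.inl (by norm_num)))).mul (by fun_prop)
    have h := this.tendsto
    rw [betaPrim, zero_rpow hx.ne', zero_mul, zero_mul] at h
    exact h.mono_left nhdsWithin_le_nhds
  have := (((key 1 one_pos).sub (key (β + 1) (by linarith))).sub
    (key (2 * s - β) (by linarith))).add (key (2 * s) (by linarith))
  rw [sub_zero, sub_zero, add_zero] at this
  exact this

lemma isBigO_one_sub_rpow (x : ℝ) :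
    (fun σ : ℝ => 1 - σ ^ x) =O[𝓝[<] 1] fun σ => 1 - σ := by
  have h : HasDerivAt (fun σ : ℝ => σ ^ x) (x * 1 ^ (x - 1)) 1 :=
    hasDerivAt_rpow_const (Or.inl one_ne_zero)
  have h2 := (h.isBigO_sub.mono (nhdsWithin_le_nhds (s := Iio 1))).neg_left.neg_right
  simpa using h2

lemma tendsto_rpow_one_sub_mul {f : ℝ → ℝ} {s : ℝ} (hs1 : s < 1)
    (hf : f =O[𝓝[<] 1] fun σ => (1 - σ) * (1 - σ)) :
    Tendsto (fun σ => (1 - σ) ^ (-2 * s) * f σ) (𝓝[<] 1) (𝓝 0) := by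
  have h1 : (fun σ => (1 - σ) ^ (-2 * s) * f σ) =O[𝓝[<] 1]
      fun σ => (1 - σ) ^ (-2 * s) * ((1 - σ) * (1 - σ)) :=
    (Asymptotics.isBigO_refl _ _).mul hf
  refine h1.trans_tendsto ?_
  have h2 : Tendsto (fun σ : ℝ => (1 - σ) ^ (2 - 2 * s)) (𝓝[<] 1) (𝓝 0) := by
    have : ContinuousAt (fun σ : ℝ => (1 - σ) ^ (2 - 2 * s)) 1 :=
      ContinuousAt.rpow_const (by fun_prop) (Or.inr (by linarith))
    have h := this.tendsto
    rw [sub_self, zero_rpow (by linarith)] at h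
    exact h.mono_left nhdsWithin_le_nhds
  refine h2.congr' ?_
  filter_upwards [self_mem_nhdsWithin] with σ hσ
  have hu : 0 < 1 - σ := sub_pos.2 hσ
  rw [show 2 - 2 * s = -2 * s + 1 + 1 by ring, rpow_add_one hu.ne', rpow_add_one hu.ne']
  ring

lemma one_sub_rpow_mul_one_sub_rpow {σ : ℝ} (h0 : 0 < σ) (β γ : ℝ) :
    σ * ((1 - σ ^ β) * (1 - σ ^ γ)) = σ - σ ^ (β + 1) - σ ^ (γ + 1) + σ ^ (β + γ + 1) := by
  rw [rpow_add_one h0.ne', rpow_add_one h0.ne', rpow_add_one h0.ne', rpow_add h0]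
  ring

lemma isBigO_one_sub_rpow_mul (β γ : ℝ) :
    (fun σ : ℝ => σ - σ ^ (β + 1) - σ ^ (γ + 1) + σ ^ (β + γ + 1)) =O[𝓝[<] 1]
      fun σ => (1 - σ) * (1 - σ) := by
  have h := (isBigO_one_sub_rpow β).mul (isBigO_one_sub_rpow γ)
  have h2 : (fun σ : ℝ => σ) =O[𝓝[<] 1] fun _ => (1 : ℝ) :=
    (continuous_id.tendsto (1 : ℝ)).mono_left nhdsWithin_le_nhds |>.isBigO_one ℝ
  have h3 := h2.mul h
  simp only [one_mul] at h3
  refine h3.congr' ?_ (by rfl)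
  filter_upwards [Ioo_mem_nhdsLT (zero_lt_one' ℝ)] with σ hσ
    using one_sub_rpow_mul_one_sub_rpow hσ.1 β γ

lemma tendsto_foldedPrim_one {s β : ℝ} (hs1 : s < 1) :
    Tendsto (foldedPrim s β) (𝓝[<] 1) (𝓝 0) := by
  set y := -2 * s
  -- Singly, the four primitives blow up like (1-σ)^{-2s}. The first group is
  -- σ(1-σ^β)(1-σ^{2s-1-β}). In the second, the four coefficients have alternating sum 0, so each
  -- power σ^x may be replaced by -(1-σ^x). Both groups are O((1-σ)²).
  set f : ℝ → ℝ := fun σ =>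
    -1 / y * (σ - σ ^ (β + 1) - σ ^ (2 * s - 1 - β + 1) + σ ^ (β + (2 * s - 1 - β) + 1)) +
      1 / (y * (y + 1)) * ((1 - σ) * ((1 + y) * (1 - σ ^ (1 : ℝ)) - (β + 1 + y) * (1 - σ ^ (β + 1))
        - (2 * s - β + y) * (1 - σ ^ (2 * s - β)) + (2 * s + y) * (1 - σ ^ (2 * s))))
  have hf : f =O[𝓝[<] 1] fun σ => (1 - σ) * (1 - σ) := by
    refine ((isBigO_one_sub_rpow_mul β (2 * s - 1 - β)).const_mul_left _).add
      (((Asymptotics.isBigO_refl _ _).mul ?_).const_mul_left _)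
    exact ((((isBigO_one_sub_rpow 1).const_mul_left _).sub
      ((isBigO_one_sub_rpow _).const_mul_left _)).sub
      ((isBigO_one_sub_rpow _).const_mul_left _)).add ((isBigO_one_sub_rpow _).const_mul_left _)
  refine (tendsto_rpow_one_sub_mul hs1 hf).congr fun σ => ?_
  simp only [f, foldedPrim, betaPrim, rpow_one,
    show 2 * s - 1 - β + 1 = 2 * s - β by ring, show β + (2 * s - 1 - β) + 1 = 2 * s by ring]
  change (1 - σ) ^ y * _ = _
  simp only [show (-2 * s) = y from rfl, show 2 * s = - y by simp [y]]
  ring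

/-- Only three Beta integrands remain: the factor x+y vanishes for the term x = 2s. -/
lemma hasDerivAt_foldedPrim {s β : ℝ} (hs0 : 0 < s) (hs : s ≠ 1 / 2) {σ : ℝ} (h0 : 0 < σ)
    (h1 : σ < 1) :
    HasDerivAt (foldedPrim s β) (foldedIntegrand s β σ -
      ((1 + -2 * s) * (1 + -2 * s + 1) / (-2 * s * (-2 * s + 1)) *
          (σ ^ ((1 : ℝ) - 1) * (1 - σ) ^ (2 - 2 * s - 1)) -
        (β + 1 + -2 * s) * (β + 1 + -2 * s + 1) / (-2 * s * (-2 * s + 1)) *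
          (σ ^ (β + 1 - 1) * (1 - σ) ^ (2 - 2 * s - 1)) -
        (2 * s - β + -2 * s) * (2 * s - β + -2 * s + 1) / (-2 * s * (-2 * s + 1)) *
          (σ ^ (2 * s - β - 1) * (1 - σ) ^ (2 - 2 * s - 1)))) σ := by
  have hy : -2 * s ≠ 0 := by linarith [hs0]
  have hy' : -2 * s + 1 ≠ 0 := fun h => hs (by linarith)
  refine ((((hasDerivAt_betaPrim hy hy' 1 h0 h1).sub (hasDerivAt_betaPrim hy hy' _ h0 h1)).sub
    (hasDerivAt_betaPrim hy hy' _ h0 h1)).add (hasDerivAt_betaPrim hy hy' _ h0 h1)).congr_deriv ?_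
  have e : foldedIntegrand s β σ = (σ ^ ((1 : ℝ) - 1) - σ ^ (β + 1 - 1) - σ ^ (2 * s - β - 1) +
      σ ^ (2 * s - 1)) * (1 - σ) ^ (-2 * s - 1) := by
    rw [foldedIntegrand, show 2 * s - β - 1 = 2 * s - 1 - β by ring, add_sub_cancel_right,
      show 2 * s - 1 = β + (2 * s - 1 - β) by ring, rpow_add h0, sub_self, rpow_zero,
      show β + (2 * s - 1 - β) - β = 2 * s - 1 - β by ring, show -1 - 2 * s = -2 * s - 1 by ring]
    ring
  rw [e, show -2 * s + 1 = 2 - 2 * s - 1 by ring]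
  ring


/-- The principal value of `∫ (1 - (y_+)^β) |1 - y|^{-1-2s} dy` for `-1 < β < 2s`. -/
def pvConst (s β : ℝ) : ℝ := 1 / (2 * s) + ∫ σ in (0 : ℝ)..1, foldedIntegrand s β σ

lemma integral_foldedIntegrand {s β : ℝ} (hs0 : 0 < s) (hs1 : s < 1) (hs : s ≠ 1 / 2)
    (hβ : -1 < β) (hβ' : β < 2 * s) :
    ∫ σ in (0 : ℝ)..1, foldedIntegrand s β σ =
      -(1 / (2 * s)) - Gamma (2 - 2 * s) / (2 * s * (2 * s - 1)) *
        (Gamma (β + 1) * (1 / Gamma (β - 2 * s + 1)) + Gamma (2 * s - β) * (1 / Gamma (-β))) := by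
  have i0 := intervalIntegrable_foldedIntegrand hs0 hs1 hβ hβ'
  have hq : 0 < 2 - 2 * s := by linarith
  have h1 : 0 < β + 1 := by linarith
  have h2 : 0 < 2 * s - β := by linarith
  have i1 := (intervalIntegrable_beta one_pos hq).const_mul
    ((1 + -2 * s) * (1 + -2 * s + 1) / (-2 * s * (-2 * s + 1)))
  have i2 := (intervalIntegrable_beta h1 hq).const_mul
    ((β + 1 + -2 * s) * (β + 1 + -2 * s + 1) / (-2 * s * (-2 * s + 1)))
  have i3 := (intervalIntegrable_beta h2 hq).const_mul
    ((2 * s - β + -2 * s) * (2 * s - β + -2 * s + 1) / (-2 * s * (-2 * s + 1)))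
  have h := intervalIntegral.integral_eq_sub_of_hasDerivAt_of_tendsto (zero_lt_one' ℝ)
    (fun σ hσ => hasDerivAt_foldedPrim (β := β) hs0 hs hσ.1 hσ.2) (i0.sub ((i1.sub i2).sub i3))
    (tendsto_foldedPrim_zero hs0 hβ hβ') (tendsto_foldedPrim_one hs1)
  rw [intervalIntegral.integral_sub i0 ((i1.sub i2).sub i3),
    intervalIntegral.integral_sub (i1.sub i2) i3, intervalIntegral.integral_sub i1 i2,
    intervalIntegral.integral_const_mul, intervalIntegral.integral_const_mul,
    intervalIntegral.integral_const_mul, integral_beta one_pos hq, integral_beta h1 hq,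
    integral_beta h2 hq] at h
  have e1 := mul_add_one_div_Gamma (1 + -2 * s)
  have e2 := mul_add_one_div_Gamma (β + 1 + -2 * s)
  have e3 := mul_add_one_div_Gamma (2 * s - β + -2 * s)
  rw [show 1 + -2 * s + 2 = 1 + (2 - 2 * s) by ring] at e1
  rw [show β + 1 + -2 * s + 2 = β + 1 + (2 - 2 * s) by ring,
    show Gamma (β + 1 + -2 * s) = Gamma (β - 2 * s + 1) by ring_nf] at e2
  rw [show 2 * s - β + -2 * s + 2 = 2 * s - β + (2 - 2 * s) by ring,
    show Gamma (2 * s - β + -2 * s) = Gamma (-β) by ring_nf] at e3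
  have hy : 1 + -2 * s ≠ 0 := fun h => hs (by linarith)
  have hg : Gamma (1 + -2 * s) ≠ 0 := Gamma_ne_zero fun m hm => by
    rcases m with _ | _ | m
    · exact hs (by norm_num at hm; linarith)
    · norm_num at hm; linarith
    · push_cast at hm; have : (0 : ℝ) ≤ m := m.cast_nonneg; linarith
  -- The term x = 1 contributes -1/(2s), which cancels the tail 1/(2s) in `pvConst`.
  have e4 : Gamma (2 - 2 * s) * (1 / Gamma (1 + -2 * s)) = 1 - 2 * s := by
    rw [show 2 - 2 * s = 1 + -2 * s + 1 by ring, Gamma_add_one hy, mul_assoc,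
      mul_one_div_cancel hg]; ring
  have e5 : -2 * s * (-2 * s + 1) = 2 * s * (2 * s - 1) := by ring
  rw [e5, Gamma_one] at h
  have e6 : 1 / (2 * s) = (2 * s - 1) * (2 * s * (2 * s - 1))⁻¹ := by
    have : 2 * s - 1 ≠ 0 := fun h => hs (by linarith)
    field_simp
  rw [← e2, ← e3]
  rw [← e1] at e4
  rw [e6]
  linear_combination h + (2 * s * (2 * s - 1))⁻¹ * e4

/-- After reflection the two Gamma terms add up to a multiple of sin(π(β-2s)) + sin(πβ) = 2
sin(π(β-s)) cos(πs). The factor cos(πs) cancels against Γ(2s)Γ(1-2s) = π/sin(2πs). -/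
lemma pvConst_eq_of_ne_half {s β : ℝ} (hs0 : 0 < s) (hs1 : s < 1) (hs : s ≠ 1 / 2)
    (hβ : -1 < β) (hβ' : β < 2 * s) : 2 * s * killConst s * pvConst s β = powConst s β := by
  have hn : ∀ n : ℕ, β ≠ 2 * s + n := fun n hn => by
    have : (0 : ℝ) ≤ n := n.cast_nonneg
    linarith
  have e1 := one_div_Gamma_reflection hn
  have e2 := one_div_Gamma_reflection (s := 0) (β := -β - 1) fun n hn => by
    have : (0 : ℝ) ≤ n := n.cast_nonneg
    linarith
  rw [show -β - 1 - 2 * 0 + 1 = -β by ring, show 2 * 0 - (-β - 1) = β + 1 by ring] at e2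
  rw [pvConst, integral_foldedIntegrand hs0 hs1 hs hβ hβ', e1, e2, killConst_eq hs0 hs1, powConst]
  have hy : 1 - 2 * s ≠ 0 := fun h => hs (by linarith)
  have t1 : sin (π * (-β - 1 - 2 * 0)) = sin (π * (β - s) + π * s) := by
    rw [show π * (-β - 1 - 2 * 0) = -(π * (β - s) + π * s + π) by ring, sin_neg, sin_add_pi, neg_neg]
  have t2 : sin (π * (β - 2 * s)) = sin (π * (β - s) - π * s) := by ring_nf
  rw [t1, t2, sin_add, sin_sub]
  have g1 := Gamma_mul_Gamma_one_sub (2 * s)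
  have g2 : Gamma (2 - 2 * s) = (1 - 2 * s) * Gamma (1 - 2 * s) := by
    rw [← Gamma_add_one hy]; ring_nf
  have hsin2 : sin (π * (2 * s)) ≠ 0 := by
    refine sin_pi_mul_ne_zero_of_ne_int fun n hn => ?_
    have h1 : (0 : ℝ) < n := by linarith
    have h2 : (n : ℝ) < 2 := by linarith
    have h3 : 0 < n := by exact_mod_cast h1
    have h4 : n < 2 := by exact_mod_cast h2
    obtain rfl : n = 1 := by omega
    exact hy (by push_cast at hn; linarith)
  have g3 : Gamma (2 * s) * Gamma (1 - 2 * s) * (2 * sin (π * s) * cos (π * s)) = π := by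
    rw [← sin_two_mul, show 2 * (π * s) = π * (2 * s) by ring, g1,
      div_mul_cancel₀ _ hsin2]
  rw [g2]
  have hs' : 2 * s - 1 ≠ 0 := fun h => hs (by linarith)
  have hpi := pi_ne_zero
  have k1 : 2 * s * ((1 - 2 * s) * Gamma (1 - 2 * s) / (2 * s * (2 * s - 1))) =
      -Gamma (1 - 2 * s) := by field_simp; ring
  linear_combination (-(Gamma (β + 1) * Gamma (2 * s - β) * sin (π * (β - s)) / π ^ 2)) * g3 +
    (Gamma (2 * s) * sin (π * s) * (Gamma (β + 1) * Gamma (2 * s - β) *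
      (2 * sin (π * (β - s)) * cos (π * s))) / π ^ 2) * k1 -
    (Gamma (β + 1) * Gamma (2 * s - β) * sin (π * (β - s)) / π) * mul_inv_cancel₀ hpi

/-! ### The value s = 1/2, by continuity in s. -/

lemma continuousAt_integral_foldedIntegrand {β : ℝ} (hβ : -1 < β) (hβ' : β < 1) :
    ContinuousAt (fun s => ∫ σ in (0 : ℝ)..1, foldedIntegrand s β σ) (1 / 2) := by
  have hβa : |β| < 1 := abs_lt.2 ⟨hβ, hβ'⟩
  refine intervalIntegral.continuousAt_of_dominated_interval
    -- The exponent at 0 comes from |2s-1| < (1-|β|)/2 and the one at 1 from s < 3/4; both exceed -1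
    -- since |β| < 1.
    (bound := fun σ => 1 * 2 * (σ ^ ((1 - |β|) / 2 - 1) * (1 - σ) ^ ((1 : ℝ) / 2 - 1)))
    (Eventually.of_forall fun s => (measurable_foldedIntegrand s β).aestronglyMeasurable) ?_
    ((intervalIntegrable_beta (by linarith) (by norm_num)).const_mul _) ?_
  · have h1 : ∀ᶠ s : ℝ in 𝓝 (1 / 2), s < 3 / 4 := gt_mem_nhds (by norm_num)
    have h2 : ∀ᶠ s : ℝ in 𝓝 (1 / 2), |2 * s - 1| < (1 - |β|) / 2 := by
      have : ContinuousAt (fun s : ℝ => |2 * s - 1|) (1 / 2) := by fun_prop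
      exact this.eventually_lt_const (by norm_num; linarith)
    filter_upwards [h1, h2] with s hs hs'
    have hne : ∀ᵐ σ : ℝ, σ ≠ 1 := (ae_iff.2 (by simp))
    filter_upwards [hne] with σ h3 h4
    rw [uIoc_of_le zero_le_one] at h4
    have h5 : σ < 1 := lt_of_le_of_ne h4.2 h3
    have hu : 0 < 1 - σ := by linarith
    rw [norm_eq_abs]
    refine (abs_foldedIntegrand_le s β h4.1 h5).trans ?_
    have b0 := neg_abs_le (2 * s - 1)
    have b0' := le_abs_self (2 * s - 1)
    have b1 : max 1 |β| = 1 := max_eq_left hβa.le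
    have b2 : max 1 |2 * s - 1 - β| ≤ 2 := max_le (by norm_num)
      (by have := abs_sub (2 * s - 1) β; have := abs_nonneg β; linarith)
    have b3 : (1 - |β|) / 2 - 1 ≤ min β 0 + min (2 * s - 1 - β) 0 := by
      have c1 := le_abs_self β
      have c2 := neg_abs_le β
      rcases min_choice β 0 with h | h <;> rcases min_choice (2 * s - 1 - β) 0 with h' | h' <;>
        rw [h, h'] <;> linarith
    rw [b1]
    have b4 := rpow_le_rpow_of_exponent_ge h4.1 h5.le b3
    have b5 := rpow_le_rpow_of_exponent_ge hu (by linarith [h4.1])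
      (show (1 : ℝ) / 2 - 1 ≤ 1 - 2 * s by linarith)
    have c1 := rpow_nonneg h4.1.le (min β 0 + min (2 * s - 1 - β) 0)
    have c2 := rpow_nonneg hu.le (1 - 2 * s)
    have c3 := rpow_nonneg h4.1.le ((1 - |β|) / 2 - 1)
    gcongr
  · have hne : ∀ᵐ σ : ℝ, σ ≠ 1 := (ae_iff.2 (by simp))
    filter_upwards [hne] with σ h3 h4
    rw [uIoc_of_le zero_le_one] at h4
    have hu : 1 - σ ≠ 0 := sub_ne_zero.2 (Ne.symm h3)
    have e0 := h4.1.ne'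
    have c1 : ContinuousAt (fun s : ℝ => σ ^ (2 * s - 1 - β)) (1 / 2) :=
      ContinuousAt.rpow continuousAt_const (by fun_prop) (Or.inl e0)
    have c2 : ContinuousAt (fun s : ℝ => (1 - σ) ^ (-1 - 2 * s)) (1 / 2) :=
      ContinuousAt.rpow continuousAt_const (by fun_prop) (Or.inl hu)
    exact (continuousAt_const.mul (continuousAt_const.sub c1)).mul c2

lemma fracConst_eq {s : ℝ} (hs0 : 0 < s) : fracConst s = 2 * s * killConst s := by
  rw [killConst]; field_simp

theorem fracConst_mul_pvConst {s β : ℝ} (hs0 : 0 < s) (hs1 : s < 1)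
    (hβ : -1 < β) (hβ' : β < 2 * s) : fracConst s * pvConst s β = powConst s β := by
  rw [fracConst_eq hs0]
  by_cases hs : s ≠ 1 / 2
  · exact pvConst_eq_of_ne_half hs0 hs1 hs hβ hβ'
  obtain rfl : s = 1 / 2 := not_not.1 hs
  have c1 : ContinuousAt (fun s => 2 * s * (Gamma (2 * s) * sin (π * s) / π) * pvConst s β)
      (1 / 2) := by
    have g : ContinuousAt (fun s : ℝ => Gamma (2 * s)) (1 / 2) :=
      ContinuousAt.comp (g := Gamma) (differentiableAt_Gamma fun m hm => by
        have : (0 : ℝ) ≤ m := m.cast_nonneg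
        linarith).continuousAt (by fun_prop)
    have p : ContinuousAt (fun s : ℝ => 1 / (2 * s)) (1 / 2) :=
      continuousAt_const.div (by fun_prop) (by norm_num)
    exact (ContinuousAt.mul (by fun_prop) ((g.mul (by fun_prop)).div_const π)).mul
      (p.add (continuousAt_integral_foldedIntegrand hβ (by linarith)))
  have c2 : ContinuousAt (fun s => powConst s β) (1 / 2) := by
    have g : ContinuousAt (fun s : ℝ => Gamma (2 * s - β)) (1 / 2) :=
      ContinuousAt.comp (g := Gamma) (differentiableAt_Gamma fun m hm => by
        have : (0 : ℝ) ≤ m := m.cast_nonneg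
        linarith).continuousAt (by fun_prop)
    exact (((continuousAt_const.mul g).mul (by fun_prop)).div_const π).neg
  have e : (fun s => 2 * s * (Gamma (2 * s) * sin (π * s) / π) * pvConst s β) =ᶠ[𝓝[≠] (1 / 2)]
      fun s => powConst s β := by
    have h1 : ∀ᶠ s : ℝ in 𝓝[≠] (1 / 2), s ∈ Ioo (max 0 (β / 2)) 1 :=
      mem_nhdsWithin_of_mem_nhds (Ioo_mem_nhds (max_lt (by norm_num) (by linarith)) hs1)
    filter_upwards [h1, self_mem_nhdsWithin] with s hs hne
    have h2 : 0 < s := (le_max_left _ _).trans_lt hs.1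
    have h3 : β / 2 < s := (le_max_right _ _).trans_lt hs.1
    rw [← killConst_eq h2 hs.2]
    exact pvConst_eq_of_ne_half h2 hs.2 hne hβ (by linarith)
  rw [killConst_eq hs0 hs1]
  exact tendsto_nhds_unique ((c1.tendsto.mono_left nhdsWithin_le_nhds).congr' e)
    (c2.tendsto.mono_left nhdsWithin_le_nhds)

/-! ### Finite parts for general exponents -/

/-- The coefficients of `(1 - σ)^{-a}`. -/
def binCoeff (a : ℝ) : ℕ → ℝ
  | 0 => 1
  | j + 1 => binCoeff a j * (a + j) / (j + 1)

/-- The partial sums of the power series of `(1 - σ)^{-a}`. -/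
def binSum (a : ℝ) (k : ℕ) (σ : ℝ) : ℝ := ∑ j ∈ Finset.range k, binCoeff a j * σ ^ j

lemma binCoeff_add_one (a : ℝ) (j : ℕ) : binCoeff a j * (a + j) = a * binCoeff (a + 1) j := by
  induction j with
  | zero => simp [binCoeff]
  | succ j ih =>
    have : (j : ℝ) + 1 ≠ 0 := by positivity
    rw [binCoeff, binCoeff, ih]
    push_cast
    ring

lemma hasDerivAt_binSum (a : ℝ) (k : ℕ) (σ : ℝ) :
    HasDerivAt (binSum a (k + 1)) (a * binSum (a + 1) k σ) σ := by
  have h : HasDerivAt (fun σ : ℝ => ∑ j ∈ Finset.range (k + 1), binCoeff a j * σ ^ j)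
      (∑ j ∈ Finset.range (k + 1), binCoeff a j * (j * σ ^ (j - 1))) σ :=
    HasDerivAt.fun_sum fun j _ => (hasDerivAt_pow j σ).const_mul _
  refine h.congr_deriv ?_
  rw [Finset.sum_range_succ', binSum, Finset.mul_sum]
  simp only [Nat.cast_zero, zero_mul, mul_zero, add_zero, Nat.add_sub_cancel]
  refine Finset.sum_congr rfl fun j _ => ?_
  have : (j : ℝ) + 1 ≠ 0 := by positivity
  rw [← mul_assoc a, ← binCoeff_add_one, binCoeff]
  push_cast
  field_simp

/-- Taylor remainder by induction on k for all a at once: the derivative of the remainder for (a,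
k+1) is a times the remainder for (a+1, k), and it vanishes at 0. -/
lemma exists_abs_rpow_sub_binSum_le (k : ℕ) : ∀ a : ℝ, 0 < a → ∃ C, 0 ≤ C ∧
    ∀ σ ∈ Icc (0 : ℝ) (1 / 2), |(1 - σ) ^ (-a) - binSum a k σ| ≤ C * σ ^ k := by
  induction k with
  | zero =>
    intro a ha
    refine ⟨2 ^ a, by positivity, fun σ hσ => ?_⟩
    have h : (0 : ℝ) < 1 - σ := by linarith [hσ.2]
    rw [binSum, Finset.sum_range_zero, sub_zero, pow_zero, mul_one, abs_of_pos (by positivity),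
      rpow_neg h.le, ← inv_rpow h.le]
    refine rpow_le_rpow (by positivity) ?_ ha.le
    rw [inv_le_comm₀ h two_pos]
    linarith [hσ.2]
  | succ k ih =>
    intro a ha
    obtain ⟨C, hC, h⟩ := ih (a + 1) (by linarith)
    refine ⟨a * C, by positivity, fun σ hσ => ?_⟩
    have hd : ∀ τ ∈ Icc 0 σ, HasDerivWithinAt (fun τ => (1 - τ) ^ (-a) - binSum a (k + 1) τ)
        (a * ((1 - τ) ^ (-(a + 1)) - binSum (a + 1) k τ)) (Icc 0 σ) τ := by
      intro τ hτ
      have hu : 1 - τ ≠ 0 := by linarith [hτ.2, hσ.2]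
      have d0 : HasDerivAt (fun τ : ℝ => 1 - τ) (-1) τ := (hasDerivAt_id τ).const_sub 1
      refine (((d0.rpow_const (p := -a) (Or.inl hu)).sub
        (hasDerivAt_binSum a k τ)).congr_deriv ?_).hasDerivWithinAt
      rw [show -a - 1 = -(a + 1) by ring]
      ring
    have hb : ∀ τ ∈ Icc 0 σ, ‖a * ((1 - τ) ^ (-(a + 1)) - binSum (a + 1) k τ)‖ ≤ a * (C * σ ^ k) := by
      intro τ hτ
      rw [norm_mul, norm_eq_abs, norm_eq_abs, abs_of_pos ha]
      have h0 := hτ.1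
      have h1 := hτ.2
      refine mul_le_mul_of_nonneg_left ((h τ ⟨h0, h1.trans hσ.2⟩).trans ?_) ha.le
      gcongr
    have := (convex_Icc 0 σ).norm_image_sub_le_of_norm_hasDerivWithin_le hd hb
      (left_mem_Icc.2 hσ.1) (right_mem_Icc.2 hσ.1)
    have e : binSum a (k + 1) 0 = 1 := by
      rw [binSum, Finset.sum_range_succ']; simp [binCoeff]
    rw [e] at this
    simp only [sub_zero, one_rpow, sub_self, norm_eq_abs, abs_of_nonneg hσ.1] at this
    calc _ ≤ _ := this
      _ = _ := by ring

/-- The folded integrand near `0`, with the first `k` terms of its singular part removed. -/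
def regIntegrand (s β : ℝ) (k : ℕ) (σ : ℝ) : ℝ :=
  (1 - σ ^ β + σ ^ (2 * s - 1)) * (1 - σ) ^ (-1 - 2 * s) -
    σ ^ (2 * s - 1 - β) * ((1 - σ) ^ (-1 - 2 * s) - binSum (1 + 2 * s) k σ)

/-- The primitive of the terms removed in `regIntegrand`. -/
def regSum (s β : ℝ) (k : ℕ) (δ : ℝ) : ℝ :=
  ∑ j ∈ Finset.range k, binCoeff (1 + 2 * s) j * (δ ^ (2 * s - β + j) / (2 * s - β + j))

/-- Hadamard's finite part of the principal value integral of a power. -/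
def regConst (s β : ℝ) (k : ℕ) (δ : ℝ) : ℝ :=
  1 / (2 * s) + (∫ σ in (0 : ℝ)..δ, regIntegrand s β k σ) +
    (∫ σ in δ..1, foldedIntegrand s β σ) - regSum s β k δ

lemma foldedIntegrand_eq (s β : ℝ) {σ : ℝ} (h0 : 0 < σ) :
    foldedIntegrand s β σ =
      (1 - σ ^ β - σ ^ (2 * s - 1 - β) + σ ^ (2 * s - 1)) * (1 - σ) ^ (-1 - 2 * s) := by
  have : σ ^ (2 * s - 1) = σ ^ β * σ ^ (2 * s - 1 - β) := by rw [← rpow_add h0]; ring_nf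
  rw [foldedIntegrand, this]
  ring

lemma regIntegrand_eq (s β : ℝ) (k : ℕ) {σ : ℝ} (h0 : 0 < σ) :
    regIntegrand s β k σ =
      foldedIntegrand s β σ + σ ^ (2 * s - 1 - β) * binSum (1 + 2 * s) k σ := by
  rw [foldedIntegrand_eq s β h0, regIntegrand]
  ring

lemma hasDerivAt_regSum {s β : ℝ} (h : ∀ n : ℕ, β ≠ 2 * s + n) (k : ℕ) {σ : ℝ} (h0 : 0 < σ) :
    HasDerivAt (regSum s β k) (σ ^ (2 * s - 1 - β) * binSum (1 + 2 * s) k σ) σ := by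
  have h1 : HasDerivAt (fun δ : ℝ => ∑ j ∈ Finset.range k,
      binCoeff (1 + 2 * s) j * (δ ^ (2 * s - β + j) / (2 * s - β + j)))
      (∑ j ∈ Finset.range k, binCoeff (1 + 2 * s) j *
        ((2 * s - β + j) * σ ^ (2 * s - β + j - 1) / (2 * s - β + j))) σ :=
    HasDerivAt.fun_sum fun j _ =>
      ((hasDerivAt_rpow_const (Or.inl h0.ne')).div_const _).const_mul _
  refine h1.congr_deriv ?_
  rw [binSum, Finset.mul_sum]
  refine Finset.sum_congr rfl fun j _ => ?_
  have hj : 2 * s - β + j ≠ 0 := fun e => h j (by linarith)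
  rw [mul_div_cancel_left₀ _ hj, show 2 * s - β + j - 1 = 2 * s - 1 - β + j by ring,
    rpow_add_natCast h0.ne']
  ring

/-- The removed terms satisfy the recurrence in β up to boundary terms that telescope in k. The one
left over has exponent 2s-1-β+k, positive once k > β+1-2s. -/
lemma regSum_identity {s β : ℝ} (h : ∀ n : ℕ, β ≠ 2 * s + n) (h' : ∀ n : ℕ, β + 1 ≠ 2 * s + n)
    (k : ℕ) {σ : ℝ} (h0 : 0 < σ) :
    (β + 1 - 2 * s) * regSum s (β + 1) k σ - (β + 1) * regSum s β k σ +
      σ ^ (2 * s - 1 - β) * ((1 - σ) * binSum (1 + 2 * s) k σ) =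
    -(k * binCoeff (1 + 2 * s) k * (σ ^ (2 * s - 1 - β + k) / (2 * s - 1 - β + k))) := by
  induction k with
  | zero => simp [regSum, binSum]
  | succ k ih =>
    rw [regSum, regSum, binSum, Finset.sum_range_succ, Finset.sum_range_succ,
      Finset.sum_range_succ, ← regSum, ← regSum, ← binSum, binCoeff]
    have e1 : 2 * s - 1 - β + k ≠ 0 := fun e => h' k (by linarith)
    have e2 : 2 * s - β + k ≠ 0 := fun e => h k (by linarith)
    have e3 : (k : ℝ) + 1 ≠ 0 := by positivity
    have p1 : σ ^ (2 * s - β + k) = σ ^ (2 * s - 1 - β + k) * σ := by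
      rw [← rpow_add_one h0.ne']; ring_nf
    have p2 : σ ^ (2 * s - 1 - β + k) = σ ^ (2 * s - 1 - β) * σ ^ k := rpow_add_natCast h0.ne' _ _
    have p3 : 2 * s - 1 - β + ((k + 1 : ℕ) : ℝ) = 2 * s - β + k := by push_cast; ring
    rw [p3, show 2 * s - (β + 1) + k = 2 * s - 1 - β + k by ring, p1]
    push_cast
    have key : binCoeff (1 + 2 * s) k * ((β + 1 - 2 * s) *
        (σ ^ (2 * s - 1 - β + k) / (2 * s - 1 - β + k)) - (β + 1) *
        (σ ^ (2 * s - 1 - β + k) * σ / (2 * s - β + k)) + (1 - σ) * σ ^ (2 * s - 1 - β + k)) =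
        k * binCoeff (1 + 2 * s) k * (σ ^ (2 * s - 1 - β + k) / (2 * s - 1 - β + k)) -
        (k + 1) * (binCoeff (1 + 2 * s) k * (1 + 2 * s + k) / (k + 1)) *
          (σ ^ (2 * s - 1 - β + k) * σ / (2 * s - β + k)) := by
      generalize σ ^ (2 * s - 1 - β + k) = A
      field_simp
      ring
    rw [p2] at key ih ⊢
    linear_combination ih + key

lemma measurable_binSum (a : ℝ) (k : ℕ) : Measurable (binSum a k) := by
  unfold binSum; fun_prop

lemma measurable_regIntegrand (s β : ℝ) (k : ℕ) : Measurable (regIntegrand s β k) := by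
  have := measurable_binSum (1 + 2 * s) k
  unfold regIntegrand; fun_prop

lemma rpow_one_sub_le {s σ : ℝ} (hs0 : 0 < s) (hσ : σ ≤ 1 / 2) :
    (1 - σ) ^ (-1 - 2 * s) ≤ 2 ^ (1 + 2 * s) := by
  have h : (0 : ℝ) < 1 - σ := by linarith
  rw [show -1 - 2 * s = -(1 + 2 * s) by ring, rpow_neg h.le, ← inv_rpow h.le]
  refine rpow_le_rpow (by positivity) ?_ (by linarith)
  rw [inv_le_comm₀ h two_pos]
  linarith

lemma exists_abs_remainder_le {s : ℝ} (hs0 : 0 < s) (k : ℕ) : ∃ C, 0 ≤ C ∧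
    ∀ σ ∈ Icc (0 : ℝ) (1 / 2), |(1 - σ) ^ (-1 - 2 * s) - binSum (1 + 2 * s) k σ| ≤ C * σ ^ k := by
  have := exists_abs_rpow_sub_binSum_le k (1 + 2 * s) (by linarith)
  rwa [show -(1 + 2 * s) = -1 - 2 * s by ring] at this

lemma intervalIntegrable_regIntegrand {s β δ : ℝ} {k : ℕ} (hs0 : 0 < s) (hβ : -1 < β)
    (hk : β - 2 * s < k) (h0 : 0 < δ) (h1 : δ ≤ 1 / 2) :
    IntervalIntegrable (regIntegrand s β k) volume 0 δ := by
  obtain ⟨C, hC, hrem⟩ := exists_abs_remainder_le hs0 k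
  have i1 : ∀ r : ℝ, -1 < r → IntervalIntegrable (fun σ : ℝ => σ ^ r) volume 0 δ := fun r hr =>
    intervalIntegral.intervalIntegrable_rpow' hr
  have h2 := ((((i1 0 (by norm_num)).add (i1 β hβ)).add (i1 (2 * s - 1) (by linarith))).mul_const
    (2 ^ (1 + 2 * s))).add ((i1 (2 * s - 1 - β + k) (by linarith)).const_mul C)
  rw [intervalIntegrable_iff_integrableOn_Ioo_of_le h0.le] at h2 ⊢
  refine h2.mono' (measurable_regIntegrand s β k).aestronglyMeasurable ?_
  filter_upwards [ae_restrict_mem measurableSet_Ioo] with σ hσ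
  have hσ1 : σ ≤ 1 / 2 := hσ.2.le.trans h1
  have p1 := rpow_pos_of_pos hσ.1 β
  have p2 := rpow_pos_of_pos hσ.1 (2 * s - 1)
  have p3 := rpow_pos_of_pos hσ.1 (2 * s - 1 - β)
  have hu : 0 < 1 - σ := by linarith
  simp only [rpow_zero]
  rw [regIntegrand, norm_eq_abs]
  refine (abs_sub _ _).trans (add_le_add ?_ ?_)
  · rw [abs_mul, abs_of_pos (rpow_pos_of_pos hu _)]
    refine mul_le_mul ?_ (rpow_one_sub_le hs0 hσ1) (by positivity) (by positivity)
    rw [abs_le]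
    constructor <;> linarith
  · rw [abs_mul, abs_of_pos p3, rpow_add_natCast hσ.1.ne']
    calc _ ≤ σ ^ (2 * s - 1 - β) * (C * σ ^ k) :=
          mul_le_mul_of_nonneg_left (hrem σ ⟨hσ.1.le, hσ1⟩) p3.le
      _ = _ := by ring

lemma intervalIntegrable_foldedIntegrand_of_pos {s β δ : ℝ} (hs1 : s < 1) (h0 : 0 < δ)
    (h1 : δ < 1) : IntervalIntegrable (foldedIntegrand s β) volume δ 1 := by
  have i1 := (intervalIntegrable_beta one_pos (show 0 < 2 - 2 * s by linarith)).mono_set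
    (c := δ) (d := 1) (by rw [uIcc_of_le zero_le_one, uIcc_of_le h1.le]; exact Icc_subset_Icc_left h0.le)
  have h2 := i1.const_mul
    (max 1 |β| * max 1 |2 * s - 1 - β| * δ ^ (min β 0 + min (2 * s - 1 - β) 0))
  rw [intervalIntegrable_iff_integrableOn_Ioo_of_le h1.le] at h2 ⊢
  refine h2.mono' (measurable_foldedIntegrand s β).aestronglyMeasurable ?_
  filter_upwards [ae_restrict_mem measurableSet_Ioo] with σ hσ
  have hσ0 : 0 < σ := h0.trans hσ.1
  have hu : 0 < 1 - σ := by linarith [hσ.2]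
  have := abs_foldedIntegrand_le s β hσ0 hσ.2
  rw [norm_eq_abs, sub_self, rpow_zero, one_mul, show 2 - 2 * s - 1 = 1 - 2 * s by ring]
  refine this.trans ?_
  rw [mul_assoc (max 1 |β| * max 1 |2 * s - 1 - β|)]
  gcongr ?_ * (?_ * ?_)
  exact rpow_le_rpow_of_nonpos h0 hσ.1.le (by
    have := min_le_right β 0
    have := min_le_right (2 * s - 1 - β) 0
    linarith)

/-! ### The recurrence in β for the finite part. -/

/-- Boundary term of the recurrence in `β`. -/
def recPrim (s β σ : ℝ) : ℝ :=
  -((1 - σ) ^ (-2 * s) * (1 - σ ^ (β + 1) - σ ^ (2 * s - 1 - β) + σ ^ (2 * s)))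

lemma hasDerivAt_recPrim (s β : ℝ) {σ : ℝ} (h0 : 0 < σ) (h1 : σ < 1) :
    HasDerivAt (recPrim s β)
      ((β + 1 - 2 * s) * foldedIntegrand s (β + 1) σ - (β + 1) * foldedIntegrand s β σ) σ := by
  have hu : 0 < 1 - σ := by linarith
  have d : ∀ x : ℝ, HasDerivAt (fun σ : ℝ => σ ^ x) (x * σ ^ (x - 1)) σ := fun x =>
    hasDerivAt_rpow_const (Or.inl h0.ne')
  have d0 : HasDerivAt (fun σ : ℝ => 1 - σ) (-1) σ := (hasDerivAt_id σ).const_sub 1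
  have d2 : HasDerivAt (fun σ : ℝ => (1 - σ) ^ (-2 * s)) (-1 * (-2 * s) * (1 - σ) ^ (-2 * s - 1)) σ :=
    d0.rpow_const (Or.inl hu.ne')
  refine (d2.mul ((((d (β + 1)).const_sub 1).sub (d (2 * s - 1 - β))).add
    (d (2 * s)))).neg.congr_deriv ?_
  simp only [Pi.add_apply, Pi.sub_apply]
  rw [foldedIntegrand_eq _ _ h0, foldedIntegrand_eq _ _ h0, add_sub_cancel_right,
    show (1 - σ) ^ (-2 * s) = (1 - σ) ^ (-1 - 2 * s) * (1 - σ) by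
      rw [← rpow_add_one hu.ne']; ring_nf,
    show -2 * s - 1 = -1 - 2 * s by ring, show 2 * s - 1 - (β + 1) = 2 * s - 1 - β - 1 by ring,
    show σ ^ (2 * s) = σ ^ (2 * s - 1) * σ by rw [← rpow_add_one h0.ne']; ring_nf,
    rpow_add_one h0.ne' β,
    show σ ^ (2 * s - 1 - β) = σ ^ (2 * s - 1 - β - 1) * σ by rw [← rpow_add_one h0.ne']; ring_nf]
  ring

lemma tendsto_recPrim_one {s β : ℝ} (hs1 : s < 1) :
    Tendsto (recPrim s β) (𝓝[<] 1) (𝓝 0) := by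
  have h := tendsto_rpow_one_sub_mul hs1
    ((isBigO_one_sub_rpow (β + 1)).mul (isBigO_one_sub_rpow (2 * s - 1 - β)))
  rw [← neg_zero]
  refine h.neg.congr' ?_
  filter_upwards [Ioo_mem_nhdsLT (zero_lt_one' ℝ)] with σ hσ
  rw [recPrim, show σ ^ (2 * s) = σ ^ (β + 1) * σ ^ (2 * s - 1 - β) by
    rw [← rpow_add hσ.1]; ring_nf]
  ring

lemma tendsto_rpow_nhdsGT_zero {r : ℝ} (hr : 0 < r) :
    Tendsto (fun σ : ℝ => σ ^ r) (𝓝[>] 0) (𝓝 0) := by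
  have h := (continuousAt_rpow_const 0 r (Or.inr hr.le)).tendsto
  rw [zero_rpow hr.ne'] at h
  exact h.mono_left nhdsWithin_le_nhds

/-- `recPrim` contains a term σ^{2s-1-β}, possibly divergent. The removed terms cancel it up to a
Taylor remainder that vanishes; the limit -1 is the constant term. -/
lemma tendsto_recPrim_add_regSum_zero {s β : ℝ} {k : ℕ} (hs0 : 0 < s) (hβ : -1 < β)
    (h : ∀ n : ℕ, β ≠ 2 * s + n) (h' : ∀ n : ℕ, β + 1 ≠ 2 * s + n) (hk : β + 1 - 2 * s < k) :
    Tendsto (fun σ => recPrim s β σ + ((β + 1 - 2 * s) * regSum s (β + 1) k σ -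
      (β + 1) * regSum s β k σ)) (𝓝[>] 0) (𝓝 (-1)) := by
  obtain ⟨C, hC, hrem⟩ := exists_abs_remainder_le hs0 k
  have hr : 0 < 2 * s - 1 - β + k := by linarith
  have t1 : Tendsto (fun σ : ℝ => -((1 - σ) ^ (-2 * s) * (1 - σ ^ (β + 1) + σ ^ (2 * s))))
      (𝓝[>] 0) (𝓝 (-(1 * (1 - 0 + 0)))) := by
    have c : ContinuousAt (fun σ : ℝ => (1 - σ) ^ (-2 * s)) 0 :=
      ContinuousAt.rpow_const (by fun_prop) (Or.inl (by norm_num))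
    have c' := c.tendsto.mono_left (nhdsWithin_le_nhds (s := Ioi 0))
    rw [sub_zero, one_rpow] at c'
    exact (c'.mul (((tendsto_rpow_nhdsGT_zero (by linarith)).const_sub 1).add
      (tendsto_rpow_nhdsGT_zero (by linarith)))).neg
  have t2 : Tendsto (fun σ : ℝ => σ ^ (2 * s - 1 - β) * ((1 - σ) *
      ((1 - σ) ^ (-1 - 2 * s) - binSum (1 + 2 * s) k σ))) (𝓝[>] 0) (𝓝 0) := by
    have := (tendsto_rpow_nhdsGT_zero hr).const_mul C
    rw [mul_zero] at this
    refine squeeze_zero_norm' ?_ this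
    filter_upwards [Ioo_mem_nhdsGT (show (0 : ℝ) < 1 / 2 by norm_num)] with σ hσ
    have p3 := rpow_pos_of_pos hσ.1 (2 * s - 1 - β)
    have hu : 0 < 1 - σ := by linarith [hσ.2]
    rw [norm_mul, norm_mul, norm_eq_abs, norm_eq_abs, norm_eq_abs, abs_of_pos p3, abs_of_pos hu,
      rpow_add_natCast hσ.1.ne']
    calc _ ≤ σ ^ (2 * s - 1 - β) * (1 * (C * σ ^ k)) := by
          gcongr
          · linarith [hσ.1]
          · exact hrem σ ⟨hσ.1.le, hσ.2.le⟩
      _ = _ := by ring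
  have t3 := ((tendsto_rpow_nhdsGT_zero hr).div_const (2 * s - 1 - β + k)).const_mul
    (k * binCoeff (1 + 2 * s) k) |>.neg
  have t := (t1.add t2).add t3
  norm_num at t
  refine t.congr' ?_
  filter_upwards [Ioo_mem_nhdsGT (show (0 : ℝ) < 1 / 2 by norm_num)] with σ hσ
  have hu : 0 < 1 - σ := by linarith [hσ.2]
  have e := regSum_identity h h' k hσ.1
  have e2 : (1 - σ) ^ (-2 * s) = (1 - σ) ^ (-1 - 2 * s) * (1 - σ) := by
    rw [← rpow_add_one hu.ne']; ring_nf
  rw [recPrim, e2]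
  rw [show -(2 * s) = -2 * s by ring, e2]
  linear_combination -e

/-- The fundamental theorem of calculus on (0, δ) and (δ, 1). The boundary contribution 1 from σ = 0
cancels (β+1-2s)/(2s) - (β+1)/(2s) = -1 from the tails. -/
lemma regConst_recurrence {s β δ : ℝ} {k : ℕ} (hs0 : 0 < s) (hs1 : s < 1) (hβ : -1 < β)
    (h : ∀ n : ℕ, β ≠ 2 * s + n) (h' : ∀ n : ℕ, β + 1 ≠ 2 * s + n) (hk : β + 1 - 2 * s < k)
    (h0 : 0 < δ) (h1 : δ ≤ 1 / 2) :
    (β + 1 - 2 * s) * regConst s (β + 1) k δ = (β + 1) * regConst s β k δ := by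
  have hδ1 : δ < 1 := by linarith
  have i1 := (intervalIntegrable_regIntegrand hs0 (show -1 < β + 1 by linarith) hk h0
    h1).const_mul (β + 1 - 2 * s)
  have i2 := (intervalIntegrable_regIntegrand hs0 hβ (show β - 2 * s < k by linarith) h0
    h1).const_mul (β + 1)
  have j1 := (intervalIntegrable_foldedIntegrand_of_pos (s := s) (β := β + 1) hs1 h0
    hδ1).const_mul (β + 1 - 2 * s)
  have j2 := (intervalIntegrable_foldedIntegrand_of_pos (s := s) (β := β) hs1 h0 hδ1).const_mul
    (β + 1)
  have hd : ∀ σ ∈ Ioc 0 δ, HasDerivAt (fun σ => recPrim s β σ +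
      ((β + 1 - 2 * s) * regSum s (β + 1) k σ - (β + 1) * regSum s β k σ))
      ((β + 1 - 2 * s) * regIntegrand s (β + 1) k σ - (β + 1) * regIntegrand s β k σ) σ := by
    intro σ hσ
    refine ((hasDerivAt_recPrim s β hσ.1 (hσ.2.trans_lt hδ1)).add
      (((hasDerivAt_regSum (by exact_mod_cast h') k hσ.1).const_mul (β + 1 - 2 * s)).sub
      ((hasDerivAt_regSum h k hσ.1).const_mul (β + 1)))).congr_deriv ?_
    rw [regIntegrand_eq _ _ _ hσ.1, regIntegrand_eq _ _ _ hσ.1]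
    ring
  have k1 := intervalIntegral.integral_eq_sub_of_hasDerivAt_of_tendsto h0
    (fun σ hσ => hd σ ⟨hσ.1, hσ.2.le⟩) (i1.sub i2)
    (tendsto_recPrim_add_regSum_zero hs0 hβ h h' hk)
    ((hd δ ⟨h0, le_rfl⟩).continuousAt.tendsto.mono_left nhdsWithin_le_nhds)
  have k2 := intervalIntegral.integral_eq_sub_of_hasDerivAt_of_tendsto hδ1
    (fun σ hσ => hasDerivAt_recPrim s β (h0.trans hσ.1) hσ.2) (j1.sub j2)
    ((hasDerivAt_recPrim s β h0 hδ1).continuousAt.tendsto.mono_left nhdsWithin_le_nhds)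
    (tendsto_recPrim_one hs1)
  rw [intervalIntegral.integral_sub i1 i2, intervalIntegral.integral_const_mul,
    intervalIntegral.integral_const_mul] at k1
  rw [intervalIntegral.integral_sub j1 j2, intervalIntegral.integral_const_mul,
    intervalIntegral.integral_const_mul] at k2
  have e : 1 / (2 * s) * (2 * s) = 1 := by field_simp
  rw [regConst, regConst]
  linear_combination k1 + k2 - e

/-- For β < 2s the removed terms are integrable at 0, so the finite part is the ordinary integral.
-/
lemma regConst_eq_pvConst {s β δ : ℝ} {k : ℕ} (hs0 : 0 < s) (hs1 : s < 1) (hβ : -1 < β)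
    (hβ' : β < 2 * s) (h0 : 0 < δ) (h1 : δ < 1) : regConst s β k δ = pvConst s β := by
  have i0 := intervalIntegrable_foldedIntegrand hs0 hs1 hβ hβ'
  have ia := i0.mono_set (c := 0) (d := δ)
    (by rw [uIcc_of_le zero_le_one, uIcc_of_le h0.le]; exact Icc_subset_Icc_right h1.le)
  have ib := i0.mono_set (c := δ) (d := 1)
    (by rw [uIcc_of_le zero_le_one, uIcc_of_le h1.le]; exact Icc_subset_Icc_left h0.le)
  have hj : ∀ j : ℕ, (0 : ℝ) < 2 * s - β + j := fun j => by
    have : (0 : ℝ) ≤ j := j.cast_nonneg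
    linarith
  have ij : ∀ j : ℕ, IntervalIntegrable
      (fun σ : ℝ => binCoeff (1 + 2 * s) j * σ ^ (2 * s - β + j - 1)) volume 0 δ := fun j =>
    (intervalIntegral.intervalIntegrable_rpow' (by linarith [hj j])).const_mul _
  have e : ∫ σ in (0 : ℝ)..δ, regIntegrand s β k σ =
      (∫ σ in (0 : ℝ)..δ, foldedIntegrand s β σ) + regSum s β k δ := by
    have e1 : ∫ σ in (0 : ℝ)..δ, regIntegrand s β k σ = ∫ σ in (0 : ℝ)..δ, (foldedIntegrand s β σ +
        ∑ j ∈ Finset.range k, binCoeff (1 + 2 * s) j * σ ^ (2 * s - β + j - 1)) := by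
      refine intervalIntegral.integral_congr_ae (Eventually.of_forall fun σ hσ => ?_)
      rw [uIoc_of_le h0.le] at hσ
      rw [regIntegrand_eq _ _ _ hσ.1, binSum, Finset.mul_sum]
      congr 1
      refine Finset.sum_congr rfl fun j _ => ?_
      rw [show 2 * s - β + j - 1 = 2 * s - 1 - β + j by ring, rpow_add_natCast hσ.1.ne']
      ring
    rw [e1, intervalIntegral.integral_add ia (by
        rw [← Finset.sum_fn]; exact IntervalIntegrable.sum _ fun j _ => ij j),
      intervalIntegral.integral_finsetSum fun j _ => ij j]
    congr 1
    refine Finset.sum_congr rfl fun j _ => ?_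
    rw [intervalIntegral.integral_const_mul, integral_rpow (Or.inl (by linarith [hj j])),
      sub_add_cancel, zero_rpow (hj j).ne', sub_zero]
  rw [regConst, pvConst, e, ← intervalIntegral.integral_add_adjacent_intervals ia ib]
  ring

lemma powConst_recurrence {s β : ℝ} (hβ : -1 < β) (h : ∀ n : ℕ, β + 1 ≠ 2 * s + n) :
    (β + 1 - 2 * s) * powConst s (β + 1) = (β + 1) * powConst s β := by
  have h1 : 2 * s - β - 1 ≠ 0 := fun e => h 0 (by push_cast; linarith)
  have g1 : Gamma (β + 1 + 1) = (β + 1) * Gamma (β + 1) := Gamma_add_one (by linarith)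
  have g2 : Gamma (2 * s - β) = (2 * s - β - 1) * Gamma (2 * s - β - 1) := by
    rw [← Gamma_add_one h1, sub_add_cancel]
  have t : sin (π * (β + 1 - s)) = -sin (π * (β - s)) := by
    rw [← sin_add_pi]; ring_nf
  rw [powConst, powConst, g1, g2, t, show 2 * s - (β + 1) = 2 * s - β - 1 by ring]
  ring

/-- Both sides satisfy the same recurrence in β and agree for β < 2s. Stepping from β-1 to β divides
by β-2s, nonzero for the admitted exponents. -/
theorem fracConst_mul_regConst {s δ : ℝ} {k : ℕ} (hs0 : 0 < s) (hs1 : s < 1) (h0 : 0 < δ)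
    (h1 : δ ≤ 1 / 2) {β : ℝ} (hβ : -1 < β) (h : ∀ n : ℕ, β ≠ 2 * s + n) (hk : β - 2 * s < k) :
    fracConst s * regConst s β k δ = powConst s β := by
  have key : ∀ m : ℕ, ∀ β : ℝ, -1 < β → (∀ n : ℕ, β ≠ 2 * s + n) → β - 2 * s < k →
      β < 2 * s + m → fracConst s * regConst s β k δ = powConst s β := by
    intro m
    induction m with
    | zero =>
      intro β hβ _ _ hm
      have hm' : β < 2 * s := by simpa using hm
      rw [regConst_eq_pvConst hs0 hs1 hβ hm' h0 (by linarith),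
        fracConst_mul_pvConst hs0 hs1 hβ hm']
    | succ m ih =>
      intro β hβ h hk hm
      rcases lt_or_ge β (2 * s) with hb | hb
      · rw [regConst_eq_pvConst hs0 hs1 hβ hb h0 (by linarith),
          fracConst_mul_pvConst hs0 hs1 hβ hb]
      by_cases hb1 : β < 2 * s + m
      · exact ih β hβ h hk hb1
      have h2 : ∀ n : ℕ, β - 1 ≠ 2 * s + n := fun n hn => h (n + 1) (by push_cast; linarith)
      have e1 := ih (β - 1) (by linarith) h2 (by linarith) (by push_cast at hm; linarith)
      have e2 := regConst_recurrence (δ := δ) (k := k) (β := β - 1) hs0 hs1 (by linarith) h2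
        (by simpa using h) (by linarith) h0 h1
      have e3 := powConst_recurrence (s := s) (β := β - 1) (by linarith) (by simpa using h)
      rw [sub_add_cancel] at e2 e3
      have h3 : β - 2 * s ≠ 0 := fun e => h 0 (by push_cast; linarith)
      refine mul_left_cancel₀ h3 ?_
      rw [e3, ← e1]
      linear_combination fracConst s * e2
  obtain ⟨m, hm⟩ := exists_nat_gt (β - 2 * s)
  exact key m β hβ h hk (by linarith)

/-! ### The principal value of a cut-off power -/

/-- The integrand on `(0, x)`, after scaling `x` to `1`. -/
def innerIntegrand (s β σ : ℝ) : ℝ := (1 - σ ^ β) * (1 - σ) ^ (-1 - 2 * s)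

/-- The integrand on `(x, ∞)`, after scaling `x` to `1` and folding `(1, ∞)` onto `(0, 1)`. -/
def outerIntegrand (s β : ℝ) (η : ℝ → ℝ) (σ : ℝ) : ℝ :=
  (σ ^ (2 * s - 1) - σ ^ (2 * s - 1 - β) * η σ) * (1 - σ) ^ (-1 - 2 * s)

/-- A folded cut-off function: `1` on `(δ, 1)` and `0` near `0`. -/
structure IsFoldedCutoff (η : ℝ → ℝ) (δ : ℝ) : Prop where
  pos : 0 < δ
  le_half : δ ≤ 1 / 2
  measurable : Measurable η
  nonneg : ∀ σ, 0 ≤ η σ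
  le_one : ∀ σ, η σ ≤ 1
  eq_one : ∀ σ ∈ Ioo δ 1, η σ = 1
  eq_zero : ∀ σ ∈ Ioo 0 (δ / 2), η σ = 0

lemma IsFoldedCutoff.intervalIntegrable_rpow_mul {η : ℝ → ℝ} {δ : ℝ} (hη : IsFoldedCutoff η δ)
    (r : ℝ) {c : ℝ} (hc : 0 < c) :
    IntervalIntegrable (fun σ => σ ^ r * η σ) volume 0 c := by
  have hδ := hη.pos
  have h1 : IntervalIntegrable (fun _ : ℝ => (δ / 2) ^ r + c ^ r) volume 0 c :=
    intervalIntegrable_const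
  rw [intervalIntegrable_iff_integrableOn_Ioo_of_le hc.le] at h1 ⊢
  have hm := hη.measurable
  refine h1.mono' (by fun_prop) ?_
  filter_upwards [ae_restrict_mem measurableSet_Ioo] with σ hσ
  have p := rpow_nonneg hσ.1.le r
  have p1 : 0 ≤ (δ / 2) ^ r := by positivity
  have p2 : 0 ≤ c ^ r := by positivity
  rw [norm_eq_abs, abs_of_nonneg (mul_nonneg p (hη.nonneg σ))]
  rcases lt_or_ge σ (δ / 2) with h | h
  · rw [hη.eq_zero σ ⟨hσ.1, h⟩, mul_zero]; positivity
  · refine (mul_le_of_le_one_right p (hη.le_one σ)).trans ?_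
    rcases le_total r 0 with hr | hr
    · have := rpow_le_rpow_of_nonpos (by positivity) h hr
      linarith
    · have := rpow_le_rpow hσ.1.le hσ.2.le hr
      linarith

lemma continuousOn_rpow_one_sub (s : ℝ) {c : ℝ} (h0 : 0 < c) (hc : c < 1) :
    ContinuousOn (fun σ : ℝ => (1 - σ) ^ (-1 - 2 * s)) (uIcc 0 c) := by
  rw [uIcc_of_le h0.le]
  exact ContinuousOn.rpow_const (by fun_prop) fun σ hσ => Or.inl (by linarith [hσ.2])

lemma intervalIntegrable_innerIntegrand {s β c : ℝ} (hβ : -1 < β) (h0 : 0 < c) (hc : c < 1) :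
    IntervalIntegrable (innerIntegrand s β) volume 0 c :=
  (intervalIntegrable_const.sub (intervalIntegral.intervalIntegrable_rpow' hβ)).mul_continuousOn
    (continuousOn_rpow_one_sub s h0 hc)

lemma IsFoldedCutoff.intervalIntegrable_outerIntegrand {η : ℝ → ℝ} {δ : ℝ}
    (hη : IsFoldedCutoff η δ) {s c : ℝ} (β : ℝ) (hs0 : 0 < s) (h0 : 0 < c) (hc : c < 1) :
    IntervalIntegrable (outerIntegrand s β η) volume 0 c :=
  ((intervalIntegral.intervalIntegrable_rpow' (by linarith)).sub
    (hη.intervalIntegrable_rpow_mul _ h0)).mul_continuousOn (continuousOn_rpow_one_sub s h0 hc)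

/-- The error made by cutting off, after the singular part has been removed. -/
def cutoffError (s β : ℝ) (k : ℕ) (η : ℝ → ℝ) (δ : ℝ) : ℝ :=
  ∫ σ in (0 : ℝ)..δ, σ ^ (2 * s - 1 - β) *
    ((1 - η σ) * ((1 - σ) ^ (-1 - 2 * s) - binSum (1 + 2 * s) k σ))

/-- The Taylor remainder is O(σ^k). C precedes β, η and δ in the quantifiers, which makes the final
convergence uniform in x. -/
lemma exists_cutoffError_bound {s : ℝ} (hs0 : 0 < s) (k : ℕ) : ∃ C, 0 ≤ C ∧
    ∀ (β : ℝ) (η : ℝ → ℝ) (δ : ℝ), β - 2 * s < k → IsFoldedCutoff η δ →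
      IntervalIntegrable (fun σ : ℝ => σ ^ (2 * s - 1 - β) *
        ((1 - η σ) * ((1 - σ) ^ (-1 - 2 * s) - binSum (1 + 2 * s) k σ))) volume 0 δ ∧
      |cutoffError s β k η δ| ≤ C * (δ ^ (2 * s - β + k) / (2 * s - β + k)) := by
  obtain ⟨C, hC, hrem⟩ := exists_abs_remainder_le hs0 k
  refine ⟨C, hC, fun β η δ hk hη => ?_⟩
  have hδ := hη.pos
  have hr : -1 < 2 * s - 1 - β + k := by linarith
  have h1 := (intervalIntegral.intervalIntegrable_rpow' (a := 0) (b := δ) hr).const_mul C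
  have hb : ∀ σ ∈ Ioc 0 δ, ‖σ ^ (2 * s - 1 - β) *
      ((1 - η σ) * ((1 - σ) ^ (-1 - 2 * s) - binSum (1 + 2 * s) k σ))‖ ≤
      C * σ ^ (2 * s - 1 - β + k) := by
    intro σ hσ
    have p3 := rpow_pos_of_pos hσ.1 (2 * s - 1 - β)
    have q1 := hη.nonneg σ
    have q2 := hη.le_one σ
    rw [norm_mul, norm_mul, norm_eq_abs, norm_eq_abs, norm_eq_abs, abs_of_pos p3,
      abs_of_nonneg (sub_nonneg.2 q2), rpow_add_natCast hσ.1.ne']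
    calc _ ≤ σ ^ (2 * s - 1 - β) * (1 * (C * σ ^ k)) := by
          gcongr
          · linarith
          · exact hrem σ ⟨hσ.1.le, hσ.2.trans hη.le_half⟩
      _ = _ := by ring
  constructor
  · have h2 := h1
    rw [intervalIntegrable_iff_integrableOn_Ioc_of_le hδ.le] at h2 ⊢
    have hm := hη.measurable
    have hm2 := measurable_binSum (1 + 2 * s) k
    refine h2.mono' (by fun_prop) ?_
    filter_upwards [ae_restrict_mem measurableSet_Ioc] with σ hσ using hb σ hσ
  · have := intervalIntegral.norm_integral_le_of_norm_le hδ.le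
      (Eventually.of_forall fun σ hσ => hb σ hσ) h1
    rw [intervalIntegral.integral_const_mul, integral_rpow (Or.inl hr),
      show 2 * s - 1 - β + k + 1 = 2 * s - β + k by ring, zero_rpow (by linarith), sub_zero] at this
    exact this

/-- The coefficients of the polynomial discarded in the generalized sense. -/
def cutoffCoeff (s β : ℝ) (η : ℝ → ℝ) (δ : ℝ) (j : ℕ) : ℝ :=
  binCoeff (1 + 2 * s) j *
    (δ ^ (2 * s - β + j) / (2 * s - β + j) - ∫ σ in (0 : ℝ)..δ, σ ^ (2 * s - 1 - β + j) * η σ)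

/-- On (δ, 1) the cut-off is 1. On (0, δ) the kernel is split into its Taylor polynomial and the
remainder: the polynomial part yields the moments in `cutoffCoeff`, the rest the finite part and the
error. -/
lemma IsFoldedCutoff.integral_inner_add_outer {η : ℝ → ℝ} {δ s β : ℝ} {k : ℕ}
    (hη : IsFoldedCutoff η δ) (hs0 : 0 < s) (hs1 : s < 1) (hβ : -1 < β) (hk : β - 2 * s < k) :
    IntervalIntegrable (fun σ => innerIntegrand s β σ + outerIntegrand s β η σ) volume 0 1 ∧
    1 / (2 * s) + ∫ σ in (0 : ℝ)..1, (innerIntegrand s β σ + outerIntegrand s β η σ) =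
      regConst s β k δ + cutoffError s β k η δ +
        ∑ j ∈ Finset.range k, cutoffCoeff s β η δ j := by
  have hδ := hη.pos
  have hδ1 : δ < 1 := by linarith [hη.le_half]
  obtain ⟨_, -, hE⟩ := exists_cutoffError_bound hs0 k
  have iE := (hE β η δ hk hη).1
  have iR := intervalIntegrable_regIntegrand hs0 hβ hk hδ hη.le_half
  have iF := intervalIntegrable_foldedIntegrand_of_pos (β := β) hs1 hδ hδ1
  have ij : ∀ j : ℕ, IntervalIntegrable (fun σ : ℝ => binCoeff (1 + 2 * s) j *
      (σ ^ (2 * s - 1 - β + j) * η σ)) volume 0 δ := fun j =>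
    (hη.intervalIntegrable_rpow_mul _ hδ).const_mul _
  have iS : IntervalIntegrable (fun σ : ℝ => ∑ j ∈ Finset.range k, binCoeff (1 + 2 * s) j *
      (σ ^ (2 * s - 1 - β + j) * η σ)) volume 0 δ := by
    rw [← Finset.sum_fn]; exact IntervalIntegrable.sum _ fun j _ => ij j
  have e1 : EqOn (fun σ => regIntegrand s β k σ + σ ^ (2 * s - 1 - β) *
      ((1 - η σ) * ((1 - σ) ^ (-1 - 2 * s) - binSum (1 + 2 * s) k σ)) -
      ∑ j ∈ Finset.range k, binCoeff (1 + 2 * s) j * (σ ^ (2 * s - 1 - β + j) * η σ))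
      (fun σ => innerIntegrand s β σ + outerIntegrand s β η σ) (uIoc 0 δ) := by
    intro σ hσ
    rw [uIoc_of_le hδ.le] at hσ
    have : ∑ j ∈ Finset.range k, binCoeff (1 + 2 * s) j * (σ ^ (2 * s - 1 - β + j) * η σ) =
        σ ^ (2 * s - 1 - β) * η σ * binSum (1 + 2 * s) k σ := by
      rw [binSum, Finset.mul_sum]
      refine Finset.sum_congr rfl fun j _ => ?_
      rw [rpow_add_natCast hσ.1.ne']
      ring
    simp only [this, regIntegrand, innerIntegrand, outerIntegrand]
    ring
  have e2 : EqOn (foldedIntegrand s β)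
      (fun σ => innerIntegrand s β σ + outerIntegrand s β η σ) (Ioo δ 1) := by
    intro σ hσ
    simp only [foldedIntegrand_eq s β (hδ.trans hσ.1), innerIntegrand, outerIntegrand,
      hη.eq_one σ hσ]
    ring
  have ia := ((iR.add iE).sub iS).congr e1
  have ib : IntervalIntegrable (fun σ => innerIntegrand s β σ + outerIntegrand s β η σ)
      volume δ 1 := iF.congr_uIoo (by rwa [uIoo_of_le hδ1.le])
  refine ⟨ia.trans ib, ?_⟩
  have v2 : ∫ σ in δ..1, (innerIntegrand s β σ + outerIntegrand s β η σ) =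
      ∫ σ in δ..1, foldedIntegrand s β σ :=
    (intervalIntegral.integral_congr_Ioo_of_le hδ1.le e2).symm
  have v1 := intervalIntegral.integral_congr_Ioo_of_le (μ := volume) hδ.le
    (e1.mono (by rw [uIoc_of_le hδ.le]; exact Ioo_subset_Ioc_self))
  rw [intervalIntegral.integral_sub (iR.add iE) iS, intervalIntegral.integral_add iR iE,
    intervalIntegral.integral_finsetSum fun j _ => ij j] at v1
  simp only [intervalIntegral.integral_const_mul] at v1
  rw [← intervalIntegral.integral_add_adjacent_intervals ia ib, ← v1, v2, regConst, regSum,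
    cutoffError]
  simp only [cutoffCoeff, mul_sub, Finset.sum_sub_distrib]
  ring

/-- Removing |y-x| ≤ xe gives the inner endpoint 1-e but, after folding, the outer endpoint 1/(1+e).
The mismatch has length at most e² and the integrand there is O(e^{-2s}), so the contribution is
O(e^{2-2s}). -/
lemma IsFoldedCutoff.tendsto_integral_outer {η : ℝ → ℝ} {δ : ℝ} (hη : IsFoldedCutoff η δ)
    {s : ℝ} (β : ℝ) (hs0 : 0 < s) (hs1 : s < 1) :
    Tendsto (fun e : ℝ => ∫ σ in (1 - e)..1 / (1 + e), outerIntegrand s β η σ) (𝓝[>] 0)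
      (𝓝 0) := by
  set K := max 1 |-β| * (1 / 2) ^ min (-β) 0 * 2 with hK
  have hlim : Tendsto (fun e : ℝ => K * (1 / 2) ^ (-2 * s) * e ^ (2 - 2 * s)) (𝓝[>] 0) (𝓝 0) := by
    have := (tendsto_rpow_nhdsGT_zero (show 0 < 2 - 2 * s by linarith)).const_mul
      (K * (1 / 2) ^ (-2 * s))
    rwa [mul_zero] at this
  refine squeeze_zero_norm' ?_ hlim
  filter_upwards [Ioo_mem_nhdsGT (show (0 : ℝ) < 1 / 2 by norm_num)] with e he
  have he0 := he.1
  have hle : 1 - e ≤ 1 / (1 + e) := by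
    rw [le_div_iff₀ (by linarith)]; nlinarith
  have hb : ∀ σ ∈ uIoc (1 - e) (1 / (1 + e)), ‖outerIntegrand s β η σ‖ ≤ K * (e / 2) ^ (-2 * s) := by
    intro σ hσ
    rw [uIoc_of_le hle] at hσ
    have h1 : 1 / 2 < σ := by linarith [hσ.1, he.2]
    have h0 : 0 < σ := by linarith
    have h2 : e / 2 ≤ 1 - σ := by
      have : 1 / (1 + e) ≤ 1 - e / 2 := by
        rw [div_le_iff₀ (by linarith)]; nlinarith [he.2]
      linarith [hσ.2]
    have hu : 0 < 1 - σ := by linarith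
    have p1 : σ ^ (2 * s - 1 - β) = σ ^ (2 * s - 1) * σ ^ (-β) := by
      rw [← rpow_add h0]; ring_nf
    have p2 : σ ^ (2 * s - 1) ≤ 2 := by
      calc σ ^ (2 * s - 1) ≤ σ ^ (-1 : ℝ) :=
            rpow_le_rpow_of_exponent_ge h0 (by linarith) (by linarith)
        _ = σ⁻¹ := rpow_neg_one σ
        _ ≤ 2 := by rw [inv_le_comm₀ h0 two_pos]; linarith
    have p3 := abs_one_sub_rpow_le (-β) h0 (by linarith)
    have p4 : σ ^ min (-β) 0 ≤ (1 / 2) ^ min (-β) 0 :=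
      rpow_le_rpow_of_nonpos (by norm_num) h1.le (min_le_right _ _)
    have p5 : (1 - σ) ^ (-2 * s) = (1 - σ) * (1 - σ) ^ (-1 - 2 * s) := by
      rw [mul_comm (1 - σ) (_ ^ _), ← rpow_add_one hu.ne']; ring_nf
    have p6 : (1 - σ) ^ (-2 * s) ≤ (e / 2) ^ (-2 * s) :=
      rpow_le_rpow_of_nonpos (by linarith) h2 (by linarith)
    rw [outerIntegrand, hη.eq_one σ ⟨by linarith [hη.le_half], by linarith⟩, p1, mul_one,
      show σ ^ (2 * s - 1) - σ ^ (2 * s - 1) * σ ^ (-β) = σ ^ (2 * s - 1) * (1 - σ ^ (-β)) by ring,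
      norm_mul, norm_mul, norm_eq_abs, norm_eq_abs, norm_eq_abs,
      abs_of_pos (rpow_pos_of_pos hu _), abs_of_pos (rpow_pos_of_pos h0 _)]
    calc σ ^ (2 * s - 1) * |1 - σ ^ (-β)| * (1 - σ) ^ (-1 - 2 * s)
        ≤ 2 * (max 1 |-β| * (1 / 2) ^ min (-β) 0 * (1 - σ)) * (1 - σ) ^ (-1 - 2 * s) := by
          gcongr
          exact p3.trans (by gcongr)
      _ = K * (1 - σ) ^ (-2 * s) := by rw [p5, hK]; ring
      _ ≤ _ := by gcongr
  refine (intervalIntegral.norm_integral_le_of_norm_le_const hb).trans ?_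
  have h3 : |1 / (1 + e) - (1 - e)| ≤ e * e := by
    rw [abs_of_nonneg (by linarith), sub_le_iff_le_add, div_le_iff₀ (by linarith)]
    nlinarith [mul_pos he0 he0, mul_pos (mul_pos he0 he0) he0]
  have h4 : (e / 2) ^ (-2 * s) = (1 / 2) ^ (-2 * s) * e ^ (-2 * s) := by
    rw [← mul_rpow (by norm_num) he0.le]; ring_nf
  have h5 : e ^ (2 - 2 * s) = e ^ (-2 * s) * (e * e) := by
    rw [show 2 - 2 * s = -2 * s + 1 + 1 by ring, rpow_add_one he0.ne', rpow_add_one he0.ne']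
    ring
  calc _ ≤ K * (e / 2) ^ (-2 * s) * (e * e) := by gcongr
    _ = _ := by rw [h4, h5]; ring

lemma IsFoldedCutoff.tendsto_integral_inner_add_outer {η : ℝ → ℝ} {δ : ℝ}
    (hη : IsFoldedCutoff η δ) {s β : ℝ} (hs0 : 0 < s) (hs1 : s < 1) (hβ : -1 < β)
    (hi : IntervalIntegrable (fun σ => innerIntegrand s β σ + outerIntegrand s β η σ) volume 0 1) :
    Tendsto (fun e : ℝ => (∫ σ in (0 : ℝ)..1 - e, innerIntegrand s β σ) +
      ∫ σ in (0 : ℝ)..1 / (1 + e), outerIntegrand s β η σ) (𝓝[>] 0)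
      (𝓝 (∫ σ in (0 : ℝ)..1, (innerIntegrand s β σ + outerIntegrand s β η σ))) := by
  have c := (intervalIntegral.continuousOn_primitive_interval' hi left_mem_uIcc) 1 right_mem_uIcc
  have t1 : Tendsto (fun e : ℝ => 1 - e) (𝓝[>] 0) (𝓝[uIcc 0 1] 1) := by
    refine tendsto_nhdsWithin_iff.2 ⟨?_, ?_⟩
    · have := (continuous_sub_left (1 : ℝ)).tendsto 0
      rw [sub_zero] at this
      exact this.mono_left nhdsWithin_le_nhds
    · filter_upwards [Ioo_mem_nhdsGT (zero_lt_one' ℝ)] with e he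
      rw [uIcc_of_le zero_le_one]
      exact ⟨by linarith [he.2], by linarith [he.1]⟩
  have t2 := (c.tendsto.comp t1).add (hη.tendsto_integral_outer β hs0 hs1)
  rw [add_zero] at t2
  refine t2.congr' ?_
  filter_upwards [Ioo_mem_nhdsGT (zero_lt_one' ℝ)] with e he
  have h0 : 0 < 1 - e := by linarith [he.2]
  have h1 : 1 - e < 1 := by linarith [he.1]
  have h2 : 0 < 1 / (1 + e) := by have := he.1; positivity
  have h3 : 1 / (1 + e) < 1 := by rw [div_lt_one (by linarith [he.1])]; linarith [he.1]
  have i1 := hη.intervalIntegrable_outerIntegrand β hs0 h0 h1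
  have i2 := hη.intervalIntegrable_outerIntegrand β hs0 h2 h3
  simp only [Function.comp_apply]
  rw [intervalIntegral.integral_add (intervalIntegrable_innerIntegrand hβ h0 h1) i1,
    ← intervalIntegral.integral_add_adjacent_intervals i1 (i1.symm.trans i2)]
  ring

/-! ### The fractional Laplacian of a cut-off power -/

lemma posPow_of_pos {β x : ℝ} (hx : 0 < x) : posPow β x = x ^ β := if_pos hx

lemma posPow_of_nonpos {β x : ℝ} (hx : x ≤ 0) : posPow β x = 0 := if_neg hx.not_gt

lemma integral_Iic_tail {s x : ℝ} (hs0 : 0 < s) (hx : 0 < x) :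
    IntegrableOn (fun y => 1 / |x - y| ^ (1 + 2 * s)) (Iic 0) ∧
    ∫ y in Iic 0, 1 / |x - y| ^ (1 + 2 * s) = x ^ (-2 * s) / (2 * s) := by
  have himg : (fun z => x - z) '' Ici x = Iic 0 := by rw [image_const_sub_Ici, sub_self]
  have hd : ∀ z ∈ Ici x, HasDerivWithinAt (fun z => x - z) (-1) (Ici x) z := fun z _ =>
    ((hasDerivAt_id z).const_sub x).hasDerivWithinAt
  have hinj : InjOn (fun z => x - z) (Ici x) := sub_right_injective.injOn
  have e : EqOn (fun z => |(-1 : ℝ)| • (1 / |x - (x - z)| ^ (1 + 2 * s)))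
      (fun z => z ^ (-2 * s - 1)) (Ici x) := by
    intro z hz
    have h : 0 < z := hx.trans_le hz
    simp only [sub_sub_cancel, abs_neg, abs_one, one_smul]
    rw [abs_of_pos h, show -2 * s - 1 = -(1 + 2 * s) by ring, rpow_neg h.le, one_div]
  constructor
  · rw [← himg, integrableOn_image_iff_integrableOn_abs_deriv_smul measurableSet_Ici hd hinj,
      integrableOn_congr_fun e measurableSet_Ici, integrableOn_Ici_iff_integrableOn_Ioi]
    exact integrableOn_Ioi_rpow_of_lt (by linarith) hx
  · rw [← himg, integral_image_eq_integral_abs_deriv_smul measurableSet_Ici hd hinj,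
      setIntegral_congr_fun measurableSet_Ici e, integral_Ici_eq_integral_Ioi,
      integral_Ioi_rpow_of_lt (by linarith) hx, sub_add_cancel, neg_mul, div_neg, neg_div, neg_neg]

lemma integral_truncated_inner {s β x c : ℝ} {φ : ℝ → ℝ} (hβ : -1 < β) (hx : 0 < x) (h0 : 0 < c)
    (h1 : c < 1) (hφ : ∀ y ∈ Ioc 0 x, φ y = 1) :
    IntegrableOn (fun y => (x ^ β - posPow β y * φ y) / |x - y| ^ (1 + 2 * s)) (Ioo 0 (x * c)) ∧
    ∫ y in Ioo 0 (x * c), (x ^ β - posPow β y * φ y) / |x - y| ^ (1 + 2 * s) =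
      x ^ (β - 2 * s) * ∫ σ in (0 : ℝ)..c, innerIntegrand s β σ := by
  have himg : (fun σ => x * σ) '' Ioo 0 c = Ioo 0 (x * c) := by
    rw [image_mul_left_Ioo hx, mul_zero]
  have hd : ∀ σ ∈ Ioo 0 c, HasDerivWithinAt (fun σ => x * σ) x (Ioo 0 c) σ := fun σ _ => by
    simpa using ((hasDerivAt_id σ).const_mul x).hasDerivWithinAt
  have hinj : InjOn (fun σ => x * σ) (Ioo 0 c) := (mul_right_injective₀ hx.ne').injOn
  have e : EqOn (fun σ => |x| • ((x ^ β - posPow β (x * σ) * φ (x * σ)) /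
      |x - x * σ| ^ (1 + 2 * s))) (fun σ => x ^ (β - 2 * s) * innerIntegrand s β σ) (Ioo 0 c) := by
    intro σ hσ
    have hσ1 : σ < 1 := hσ.2.trans h1
    have hu : 0 < 1 - σ := by linarith
    have hxσ : 0 < x * σ := mul_pos hx hσ.1
    have q1 : |x - x * σ| = x * (1 - σ) := by
      rw [show x - x * σ = x * (1 - σ) by ring, abs_of_pos (mul_pos hx hu)]
    have q2 : x ^ (1 + 2 * s) = x * x ^ (2 * s) := by rw [rpow_add hx, rpow_one]
    have q3 : (1 - σ) ^ (-1 - 2 * s) = ((1 - σ) ^ (1 + 2 * s))⁻¹ := by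
      rw [← rpow_neg hu.le]; ring_nf
    have q4 : (0 : ℝ) < (1 - σ) ^ (1 + 2 * s) := by positivity
    have q5 : 0 < x ^ (2 * s) := by positivity
    simp only [smul_eq_mul]
    rw [posPow_of_pos hxσ, hφ _ ⟨hxσ, by nlinarith⟩, q1, mul_rpow hx.le hu.le,
      mul_rpow hx.le hσ.1.le, abs_of_pos hx, q2, innerIntegrand, q3, rpow_sub hx]
    generalize x ^ (2 * s) = A at *
    generalize (1 - σ) ^ (1 + 2 * s) = B at *
    field_simp
  have i0 := (intervalIntegrable_innerIntegrand (s := s) hβ h0 h1).const_mul (x ^ (β - 2 * s))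
  rw [intervalIntegrable_iff_integrableOn_Ioo_of_le h0.le] at i0
  constructor
  · rw [← himg, integrableOn_image_iff_integrableOn_abs_deriv_smul measurableSet_Ioo hd hinj,
      integrableOn_congr_fun e measurableSet_Ioo]
    exact i0
  · rw [← himg, integral_image_eq_integral_abs_deriv_smul measurableSet_Ioo hd hinj,
      setIntegral_congr_fun measurableSet_Ioo e, intervalIntegral.integral_of_le h0.le,
      integral_Ioc_eq_integral_Ioo, integral_const_mul]

lemma image_div_Ioo {x c : ℝ} (hx : 0 < x) (h0 : 0 < c) :
    (fun σ => x / σ) '' Ioo 0 c = Ioi (x / c) := by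
  ext y
  constructor
  · rintro ⟨σ, hσ, rfl⟩
    exact div_lt_div_of_pos_left hx hσ.1 hσ.2
  · intro hy
    have hy0 : 0 < y := (div_pos hx h0).trans hy
    refine ⟨x / y, ⟨div_pos hx hy0, ?_⟩, by field_simp⟩
    rw [div_lt_iff₀ hy0, mul_comm, ← div_lt_iff₀ h0]
    exact hy

lemma IsFoldedCutoff.integral_outer {s β x c δ : ℝ} {φ : ℝ → ℝ}
    (hη : IsFoldedCutoff (fun σ => φ (x / σ)) δ) (hs0 : 0 < s) (hx : 0 < x) (h0 : 0 < c)
    (h1 : c < 1) :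
    IntegrableOn (fun y => (x ^ β - posPow β y * φ y) / |x - y| ^ (1 + 2 * s)) (Ioi (x / c)) ∧
    ∫ y in Ioi (x / c), (x ^ β - posPow β y * φ y) / |x - y| ^ (1 + 2 * s) =
      x ^ (β - 2 * s) * ∫ σ in (0 : ℝ)..c, outerIntegrand s β (fun σ => φ (x / σ)) σ := by
  have himg := image_div_Ioo hx h0
  have hd : ∀ σ ∈ Ioo 0 c, HasDerivWithinAt (fun σ => x / σ) (-(x / σ ^ 2)) (Ioo 0 c) σ :=
    fun σ hσ => by
      have := ((hasDerivAt_inv hσ.1.ne').const_mul x).hasDerivWithinAt (s := Ioo 0 c)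
      refine (this.congr_deriv ?_)
      rw [mul_neg, div_eq_mul_inv]
  have hinj : InjOn (fun σ => x / σ) (Ioo 0 c) := fun a ha b hb hab => by
    have ha' := ha.1.ne'
    have hb' := hb.1.ne'
    simp only at hab
    field_simp at hab
    exact hab.symm
  have e : EqOn (fun σ => |-(x / σ ^ 2)| • ((x ^ β - posPow β (x / σ) * φ (x / σ)) /
      |x - x / σ| ^ (1 + 2 * s)))
      (fun σ => x ^ (β - 2 * s) * outerIntegrand s β (fun σ => φ (x / σ)) σ) (Ioo 0 c) := by
    intro σ hσ
    have hσ1 : σ < 1 := hσ.2.trans h1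
    have hσ0 := hσ.1
    have hu : 0 < 1 - σ := by linarith
    have hxσ : 0 < x / σ := div_pos hx hσ.1
    have q1 : |x - x / σ| = x / σ * (1 - σ) := by
      rw [abs_sub_comm, show x / σ - x = x / σ * (1 - σ) by field_simp,
        abs_of_pos (mul_pos hxσ hu)]
    have q2 : x ^ (1 + 2 * s) = x * x ^ (2 * s) := by rw [rpow_add hx, rpow_one]
    have q2' : σ ^ (1 + 2 * s) = σ * σ ^ (2 * s) := by rw [rpow_add hσ0, rpow_one]
    have q3 : (1 - σ) ^ (-1 - 2 * s) = ((1 - σ) ^ (1 + 2 * s))⁻¹ := by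
      rw [← rpow_neg hu.le]; ring_nf
    have q4 : (0 : ℝ) < (1 - σ) ^ (1 + 2 * s) := by positivity
    have q5 : 0 < x ^ (2 * s) := by positivity
    have q6 : 0 < σ ^ (2 * s) := by positivity
    have q7 : 0 < σ ^ β := by positivity
    simp only [smul_eq_mul]
    rw [posPow_of_pos hxσ, q1, mul_rpow hxσ.le hu.le, div_rpow hx.le hσ0.le,
      div_rpow hx.le hσ0.le, abs_neg, abs_of_pos (by positivity), q2, q2', outerIntegrand, q3,
      rpow_sub hx, rpow_sub hσ0 _ β, rpow_sub_one hσ0.ne']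
    generalize x ^ (2 * s) = A at *
    generalize σ ^ (2 * s) = D at *
    generalize σ ^ β = E at *
    generalize (1 - σ) ^ (1 + 2 * s) = B at *
    field_simp
  have i0 := (hη.intervalIntegrable_outerIntegrand β hs0 h0 h1).const_mul (x ^ (β - 2 * s))
  rw [intervalIntegrable_iff_integrableOn_Ioo_of_le h0.le] at i0
  constructor
  · rw [← himg, integrableOn_image_iff_integrableOn_abs_deriv_smul measurableSet_Ioo hd hinj,
      integrableOn_congr_fun e measurableSet_Ioo]
    exact i0
  · rw [← himg, integral_image_eq_integral_abs_deriv_smul measurableSet_Ioo hd hinj,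
      setIntegral_congr_fun measurableSet_Ioo e, intervalIntegral.integral_of_le h0.le,
      integral_Ioc_eq_integral_Ioo, integral_const_mul]

lemma setOf_lt_abs_sub_eq {x e : ℝ} (hx : 0 < x) (he0 : 0 < e) (he1 : e < 1) :
    {y | x * e < |x - y|} = Iic 0 ∪ (Ioo 0 (x * (1 - e)) ∪ Ioi (x / (1 / (1 + e)))) := by
  have hxe : x * e < x := by nlinarith
  have hxe0 : 0 < x * e := by positivity
  have h : x / (1 / (1 + e)) = x + x * e := by field_simp
  rw [h]
  ext y
  simp only [mem_ofPred_eq, mem_union, mem_Iic, mem_Ioo, mem_Ioi, lt_abs]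
  constructor
  · rintro (h | h)
    · rcases le_or_gt y 0 with h' | h'
      · exact Or.inl h'
      · exact Or.inr (Or.inl ⟨h', by linarith⟩)
    · exact Or.inr (Or.inr (by linarith))
  · rintro (h | ⟨-, h⟩ | h)
    · left; linarith
    · left; linarith
    · right; linarith

lemma IsFoldedCutoff.integral_truncated {s β x e δ : ℝ} {φ : ℝ → ℝ}
    (hη : IsFoldedCutoff (fun σ => φ (x / σ)) δ) (hφ : ∀ y ∈ Ioc 0 x, φ y = 1) (hs0 : 0 < s)
    (hβ : -1 < β) (hx : 0 < x) (he0 : 0 < e) (he1 : e < 1) :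
    IntegrableOn (fun y => (posPow β x * φ x - posPow β y * φ y) / |x - y| ^ (1 + 2 * s))
      {y | x * e < |x - y|} ∧
    ∫ y in {y | x * e < |x - y|},
      (posPow β x * φ x - posPow β y * φ y) / |x - y| ^ (1 + 2 * s) =
      x ^ (β - 2 * s) * (1 / (2 * s) + ((∫ σ in (0 : ℝ)..1 - e, innerIntegrand s β σ) +
        ∫ σ in (0 : ℝ)..1 / (1 + e), outerIntegrand s β (fun σ => φ (x / σ)) σ)) := by
  have h0 : 0 < 1 - e := by linarith
  have h2 : 0 < 1 / (1 + e) := by positivity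
  have h3 : 1 / (1 + e) < 1 := by rw [div_lt_one (by linarith)]; linarith
  obtain ⟨a1, a2⟩ := integral_Iic_tail hs0 hx
  obtain ⟨b1, b2⟩ := integral_truncated_inner (s := s) hβ hx h0 (by linarith) hφ
  obtain ⟨c1, c2⟩ := hη.integral_outer (β := β) hs0 hx h2 h3
  rw [posPow_of_pos hx, hφ x ⟨hx, le_rfl⟩, mul_one, setOf_lt_abs_sub_eq hx he0 he1]
  have ea : EqOn (fun y => x ^ β * (1 / |x - y| ^ (1 + 2 * s)))
      (fun y => (x ^ β - posPow β y * φ y) / |x - y| ^ (1 + 2 * s)) (Iic 0) := by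
    intro y hy
    simp only [posPow_of_nonpos hy]
    ring
  have a1' := (integrableOn_congr_fun ea measurableSet_Iic).1 (a1.const_mul (x ^ β))
  have hlt : x * (1 - e) < x / (1 / (1 + e)) := by
    rw [show x / (1 / (1 + e)) = x + x * e by field_simp]; nlinarith [mul_pos hx he0]
  have d1 : Disjoint (Ioo 0 (x * (1 - e))) (Ioi (x / (1 / (1 + e)))) :=
    Set.disjoint_left.2 fun y hy hy' => by
      have := hy.2; have := mem_Ioi.1 hy'; linarith
  have d2 : Disjoint (Iic 0) (Ioo 0 (x * (1 - e)) ∪ Ioi (x / (1 / (1 + e)))) :=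
    Set.disjoint_left.2 fun y hy hy' => by
      have := mem_Iic.1 hy
      have h4 : 0 < x / (1 / (1 + e)) := by positivity
      rcases hy' with h | h
      · linarith [h.1]
      · linarith [mem_Ioi.1 h]
  refine ⟨a1'.union (b1.union c1), ?_⟩
  rw [setIntegral_union d2 (measurableSet_Ioo.union measurableSet_Ioi) a1' (b1.union c1),
    setIntegral_union d1 measurableSet_Ioi b1 c1, b2, c2,
    ← setIntegral_congr_fun measurableSet_Iic ea, integral_const_mul, a2, rpow_sub hx,
    show -2 * s = -(2 * s) by ring, rpow_neg hx.le]
  ring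

lemma IsFoldedCutoff.hasFracLaplacian {s β x δ : ℝ} {k : ℕ} {φ : ℝ → ℝ}
    (hη : IsFoldedCutoff (fun σ => φ (x / σ)) δ) (hφ : ∀ y ∈ Ioc 0 x, φ y = 1) (hs0 : 0 < s)
    (hs1 : s < 1) (hβ : -1 < β) (hk : β - 2 * s < k) (hx : 0 < x) :
    HasFracLaplacian s (fun y => posPow β y * φ y) x (fracConst s * (x ^ (β - 2 * s) *
      (regConst s β k δ + cutoffError s β k (fun σ => φ (x / σ)) δ +
        ∑ j ∈ Finset.range k, cutoffCoeff s β (fun σ => φ (x / σ)) δ j))) := by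
  constructor
  · intro ε hε
    -- The explicit truncated integral needs e < 1; for large ε the set is merely a subset.
    set e := min (ε / x) (1 / 2)
    have he0 : 0 < e := lt_min (by positivity) (by norm_num)
    have he1 : e < 1 := (min_le_right _ _).trans_lt (by norm_num)
    refine (hη.integral_truncated hφ hs0 hβ hx he0 he1).1.mono_set fun y hy => ?_
    have h1 : x * e ≤ ε := by
      have := mul_le_mul_of_nonneg_left (min_le_left (ε / x) (1 / 2)) hx.le
      rwa [mul_div_cancel₀ _ hx.ne'] at this
    exact h1.trans_lt hy
  · obtain ⟨hi, hv⟩ := hη.integral_inner_add_outer hs0 hs1 hβ hk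
    have t := ((hη.tendsto_integral_inner_add_outer hs0 hs1 hβ hi).const_add
      (1 / (2 * s))).const_mul (x ^ (β - 2 * s)) |>.const_mul (fracConst s)
    rw [hv] at t
    have hdiv : Tendsto (fun ε : ℝ => ε / x) (𝓝[>] 0) (𝓝[>] 0) := by
      refine tendsto_nhdsWithin_iff.2 ⟨?_, ?_⟩
      · have := (continuous_id.div_const x).tendsto (0 : ℝ)
        simp only [id, zero_div] at this
        exact this.mono_left nhdsWithin_le_nhds
      · filter_upwards [self_mem_nhdsWithin] with ε hε using div_pos hε hx
    refine (t.comp hdiv).congr' ?_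
    filter_upwards [Ioo_mem_nhdsGT hx] with ε hε
    have := (hη.integral_truncated (β := β) (e := ε / x) hφ hs0 hβ hx (div_pos hε.1 hx)
      ((div_lt_one hx).2 hε.2)).2
    rw [mul_div_cancel₀ _ hx.ne'] at this
    simp only [Function.comp_apply]
    rw [this]

lemma integrable_posPow_div {s β : ℝ} {k : ℕ} (hs0 : 0 < s) (hβ : -1 < β) (hk : β - 2 * s < k) :
    Integrable (fun x => |posPow β x| / (1 + |x| ^ (1 + 2 * s + k))) := by
  have hq : 0 < 1 + 2 * s + k := by positivity
  have hm : Measurable (fun x => |posPow β x| / (1 + |x| ^ (1 + 2 * s + k))) := by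
    have : Measurable (posPow β) :=
      Measurable.ite measurableSet_Ioi (by fun_prop) measurable_const
    fun_prop
  have ha : IntegrableOn (fun x => |posPow β x| / (1 + |x| ^ (1 + 2 * s + k))) (Iic 0) := by
    refine (integrableOn_congr_fun (g := fun _ => (0 : ℝ)) (fun x hx => ?_) measurableSet_Iic).2
      integrableOn_zero
    simp [posPow_of_nonpos hx]
  have hb : IntegrableOn (fun x => |posPow β x| / (1 + |x| ^ (1 + 2 * s + k))) (Ioc 0 1) := by
    have i := intervalIntegral.intervalIntegrable_rpow' (a := 0) (b := 1) hβ
    rw [intervalIntegrable_iff_integrableOn_Ioc_of_le zero_le_one] at i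
    refine i.mono' hm.aestronglyMeasurable ?_
    filter_upwards [ae_restrict_mem measurableSet_Ioc] with x hx
    have p := rpow_pos_of_pos hx.1 β
    have q : 0 ≤ |x| ^ (1 + 2 * s + k) := by positivity
    rw [posPow_of_pos hx.1, norm_eq_abs, abs_of_pos p, abs_of_nonneg (by positivity)]
    exact div_le_self p.le (by linarith)
  have hc : IntegrableOn (fun x => |posPow β x| / (1 + |x| ^ (1 + 2 * s + k))) (Ioi 1) := by
    have i := integrableOn_Ioi_rpow_of_lt (a := β - (1 + 2 * s + k)) (by linarith) one_pos
    refine i.mono' hm.aestronglyMeasurable ?_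
    filter_upwards [ae_restrict_mem measurableSet_Ioi] with x hx
    have hx0 : 0 < x := one_pos.trans hx
    have p := rpow_pos_of_pos hx0 β
    have q := rpow_pos_of_pos hx0 (1 + 2 * s + k)
    rw [posPow_of_pos hx0, abs_of_pos p, abs_of_pos hx0, norm_eq_abs, abs_of_nonneg (by positivity),
      rpow_sub hx0]
    gcongr
    linarith
  rw [← integrableOn_univ, ← Iic_union_Ioi (a := (0 : ℝ)),
    ← Ioc_union_Ioi_eq_Ioi (zero_le_one' ℝ)]
  exact ha.union (hb.union hc)

/-- Under y = x/σ the radii R and 2R become δ = x/R and δ/2, and x < R/2 gives δ ≤ 1/2. -/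
lemma IsCutoffFamily.isFoldedCutoff {χ : ℝ → ℝ → ℝ} (hχ : IsCutoffFamily χ) {R x : ℝ}
    (hx : 0 < x) (hxR : x < R / 2) : IsFoldedCutoff (fun σ => χ R (x / σ)) (x / R) := by
  have hR : 0 < R := by linarith
  obtain ⟨h1, -, h3, h4, h5⟩ := hχ R hR
  refine ⟨div_pos hx hR, ?_, ?_, fun σ => (h5 _).1, fun σ => (h5 _).2, fun σ hσ => ?_,
    fun σ hσ => ?_⟩
  · rw [div_le_iff₀ hR]; linarith
  · have := h1.continuous.measurable
    fun_prop
  · have hσ0 : 0 < σ := (div_pos hx hR).trans hσ.1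
    refine h4 _ ?_
    rw [mem_ball_zero_iff, norm_eq_abs, abs_of_pos (div_pos hx hσ0), div_lt_iff₀ hσ0, mul_comm,
      ← div_lt_iff₀ hR]
    exact hσ.1
  · refine image_eq_zero_of_notMem_tsupport fun hmem => ?_
    have := h3 hmem
    rw [mem_ball_zero_iff, norm_eq_abs, abs_of_pos (div_pos hx hσ.1), div_lt_iff₀ hσ.1] at this
    have h6 := hσ.2
    rw [div_div, lt_div_iff₀ (by positivity)] at h6
    linarith

/-- The j-th moment scales like x^{2s-β+j}; the prefactor x^{β-2s} leaves x^j with a coefficient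
independent of x. Hence the discarded part is a polynomial. -/
lemma rpow_mul_cutoffCoeff {s β x R : ℝ} (φ : ℝ → ℝ) (hx : 0 < x) (hR : 0 < R) (j : ℕ) :
    x ^ (β - 2 * s) * cutoffCoeff s β (fun σ => φ (x / σ)) (x / R) j =
      cutoffCoeff s β (fun σ => φ (1 / σ)) (1 / R) j * x ^ j := by
  have e1 : x ^ (β - 2 * s) * x ^ (2 * s - β + j) = x ^ j := by
    rw [← rpow_add hx, ← rpow_natCast]; ring_nf
  have e2 : (x / R) ^ (2 * s - β + j) = x ^ (2 * s - β + j) * (1 / R) ^ (2 * s - β + j) := by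
    rw [← mul_rpow hx.le (by positivity), mul_one_div]
  have e3 : ∫ σ in (0 : ℝ)..x / R, σ ^ (2 * s - 1 - β + j) * φ (x / σ) =
      x ^ (2 * s - β + j) * ∫ σ in (0 : ℝ)..1 / R, σ ^ (2 * s - 1 - β + j) * φ (1 / σ) := by
    have h := intervalIntegral.mul_integral_comp_mul_left (a := 0) (b := 1 / R)
      (f := fun σ => σ ^ (2 * s - 1 - β + j) * φ (x / σ)) (c := x)
    rw [mul_zero, mul_one_div] at h
    have h2 : ∫ σ in (0 : ℝ)..1 / R, (x * σ) ^ (2 * s - 1 - β + j) * φ (x / (x * σ)) =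
        ∫ σ in (0 : ℝ)..1 / R, x ^ (2 * s - 1 - β + j) *
          (σ ^ (2 * s - 1 - β + j) * φ (1 / σ)) := by
      refine intervalIntegral.integral_congr fun σ hσ => ?_
      rw [uIcc_of_le (by positivity)] at hσ
      rw [mul_rpow hx.le hσ.1, mul_assoc, show x / (x * σ) = 1 / σ by
        rw [← div_div, div_self hx.ne']]
    rw [← h, h2, intervalIntegral.integral_const_mul,
      show 2 * s - β + j = 2 * s - 1 - β + j + 1 by ring, rpow_add_one hx.ne']
    ring
  rw [cutoffCoeff, cutoffCoeff, e2, e3, ← e1]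
  ring

/-- The polynomial discarded in the generalized sense. -/
def cutoffPoly (χ : ℝ → ℝ → ℝ) (s β : ℝ) (k : ℕ) (R : ℝ) : Polynomial ℝ :=
  ∑ j ∈ Finset.range k, Polynomial.C
    (fracConst s * cutoffCoeff s β (fun σ => χ R (1 / σ)) (1 / R) j) * Polynomial.X ^ j

lemma degree_cutoffPoly_lt (χ : ℝ → ℝ → ℝ) (s β : ℝ) (k : ℕ) (R : ℝ) :
    (cutoffPoly χ s β k R).degree < k := by
  refine Polynomial.mem_degreeLT.1 (Submodule.sum_mem _ fun j hj => Polynomial.mem_degreeLT.2 ?_)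
  exact (Polynomial.degree_C_mul_X_pow_le j _).trans_lt
    (Nat.cast_lt.2 (Finset.mem_range.1 hj))

lemma eval_cutoffPoly {χ : ℝ → ℝ → ℝ} {s β : ℝ} (k : ℕ) {x R : ℝ} (hx : 0 < x) (hR : 0 < R) :
    (cutoffPoly χ s β k R).eval x = fracConst s * (x ^ (β - 2 * s) *
      ∑ j ∈ Finset.range k, cutoffCoeff s β (fun σ => χ R (x / σ)) (x / R) j) := by
  rw [cutoffPoly, Polynomial.eval_finsetSum, Finset.mul_sum, Finset.mul_sum]
  refine Finset.sum_congr rfl fun j _ => ?_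
  rw [rpow_mul_cutoffCoeff (χ R) hx hR]
  simp
  ring

theorem hasFracLaplacianMod_posPow {s β : ℝ} (hs0 : 0 < s) (hs1 : s < 1) (hβ : -1 < β)
    (h : ∀ n : ℕ, β ≠ 2 * s + n) {χ : ℝ → ℝ → ℝ} (hχ : IsCutoffFamily χ) {k : ℕ}
    (hk : β - 2 * s < k) :
    HasFracLaplacianMod χ s k (posPow β) (fun x => powConst s β * posPow (β - 2 * s) x)
      (Ioi 0) := by
  refine ⟨integrable_posPow_div hs0 hβ hk, cutoffPoly χ s β k,
    fun R x => powConst s β * posPow (β - 2 * s) x + fracConst s * (x ^ (β - 2 * s) *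
      cutoffError s β k (fun σ => χ R (x / σ)) (x / R)),
    fun R _ => degree_cutoffPoly_lt χ s β k R, fun R hR x hx => ?_, fun M hM => ?_⟩
  · have hx0 : 0 < x := hx.1
    have hx1 : x < R / 2 := by
      have := hx.2
      rwa [mem_ball_zero_iff, norm_eq_abs, abs_of_pos hx0] at this
    have hη := hχ.isFoldedCutoff hx0 hx1
    have hφ : ∀ y ∈ Ioc 0 x, χ R y = 1 := fun y hy => by
      refine (hχ R hR).2.2.2.1 y ?_
      rw [mem_ball_zero_iff, norm_eq_abs, abs_of_pos hy.1]
      linarith [hy.2]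
    convert hη.hasFracLaplacian hφ hs0 hs1 hβ hk hx0 using 1
    simp only [eval_cutoffPoly k hx0 hR]
    rw [posPow_of_pos hx0,
      ← fracConst_mul_regConst hs0 hs1 hη.pos hη.le_half hβ h hk]
    ring
  · obtain ⟨C, hC, hE⟩ := exists_cutoffError_bound hs0 k
    have hr : 0 < 2 * s - β + k := by linarith
    have hlim : Tendsto (fun R : ℝ => |fracConst s| * (C * M ^ k / (2 * s - β + k)) *
        R ^ (-(2 * s - β + k))) atTop (𝓝 0) := by
      have := (tendsto_rpow_neg_atTop hr).const_mul (|fracConst s| * (C * M ^ k / (2 * s - β + k)))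
      rwa [mul_zero] at this
    rw [Metric.tendstoUniformlyOn_iff]
    intro ε hε
    filter_upwards [hlim.eventually_lt_const hε, eventually_gt_atTop (2 * M)] with R hR hRM x hx
    have hx0 : 0 < x := hx.1
    have hxM : x < M := by
      have := hx.2
      rwa [mem_ball_zero_iff, norm_eq_abs, abs_of_pos hx0] at this
    have hR0 : 0 < R := by linarith
    have hb := (hE β _ _ hk (hχ.isFoldedCutoff hx0 (show x < R / 2 by linarith))).2
    have p := rpow_pos_of_pos hx0 (β - 2 * s)
    have q := rpow_pos_of_pos hR0 (-(2 * s - β + k))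
    -- The prefactor x^{β-2s}, possibly singular at 0, is absorbed by the error bound at δ = x/R, so
    -- the convergence is uniform down to x = 0.
    have e1 : x ^ (β - 2 * s) * (x / R) ^ (2 * s - β + k) = x ^ k * R ^ (-(2 * s - β + k)) := by
      rw [div_rpow hx0.le hR0.le, rpow_neg hR0.le, ← mul_div_assoc, ← rpow_add hx0,
        ← rpow_natCast x k, div_eq_mul_inv]
      ring_nf
    rw [dist_eq_norm, sub_add_cancel_left, norm_neg, norm_mul, norm_mul, norm_eq_abs, norm_eq_abs,
      norm_eq_abs, abs_of_pos p]
    refine lt_of_le_of_lt ?_ hR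
    calc |fracConst s| * (x ^ (β - 2 * s) * |cutoffError s β k (fun σ => χ R (x / σ)) (x / R)|)
        ≤ |fracConst s| * (x ^ (β - 2 * s) *
          (C * ((x / R) ^ (2 * s - β + k) / (2 * s - β + k)))) := by gcongr
      _ = |fracConst s| * (C * x ^ k / (2 * s - β + k)) * R ^ (-(2 * s - β + k)) := by
          linear_combination (|fracConst s| * C / (2 * s - β + k)) * e1
      _ ≤ _ := by gcongr

end

/-! ### The theorem assembled. -/

theorem mainTheorem6 (s : ℝ) (hs0 : 0 < s) (hs1 : s < 1) :
    (∀ β : ℝ, -1 < β → (∀ n : ℕ, β ≠ 2 * s + n) →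
      ∃ (v : ℝ × ℝ → ℝ) (C : ℝ),
        -- `v` is the unique homogeneous extension of `(x_+)^β`
        IsHomogExtension s β v ∧
        (∀ w : ℝ × ℝ → ℝ, IsHomogExtension s β w → EqOn w v closedHalfPlane) ∧
        -- `C` is the Gamma quotient, extended by continuity
        Tendsto (powQuot s) (𝓝[≠] β) (𝓝 C) ∧
        ((∀ n : ℤ, β - 2 * s ≠ n) → C = powQuot s β) ∧
        -- conormal derivative of `v`
        (∀ x : ℝ, 0 < x → HasConormal s v x (extConst s * C * posPow (β - 2 * s) x)) ∧
        -- fractional Laplacian of `(x_+)^β` in the generalized sense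
        (∀ χ : ℝ → ℝ → ℝ, IsCutoffFamily χ → ∀ k : ℕ, β - 2 * s < k →
          HasFracLaplacianMod χ s k (posPow β) (fun x => C * posPow (β - 2 * s) x) (Ioi 0)) ∧
        -- the exponent equation
        (SolvesExtendedRegional s v ↔ ExponentEq s β ∧ β ≠ 2 * s - 2)) ∧
    (∀ β : ℝ, IsRegionalExponent s β ↔ max (2 * s - 1) 0 ≤ β ∧ ExponentEq s β) := by
  refine ⟨fun β hβ h => ?_, isRegionalExponent_iff hs0 hs1⟩
  have hA := angP_one_ne_zero hs0 hβ h
  have hv := isHomogExtension_homogSol hs0 hs1 hA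
  have hcon : ∀ x : ℝ, 0 < x → HasConormal s (homogSol s β) x
      (extConst s * powConst s β * posPow (β - 2 * s) x) := fun x hx => by
    rw [posPow_of_pos hx, ← conormal_const_eq hs0 hs1 hβ h]
    exact hasConormal_homogSol hs0 hs1 β hx
  refine ⟨homogSol s β, powConst s β, hv, fun w hw => hw.eq_homogSol hs0 hs1 hA,
    tendsto_powQuot hβ h, fun hn => (powQuot_eq_powConst hn).symm, hcon,
    fun χ hχ k hk => hasFracLaplacianMod_posPow hs0 hs1 hβ h hχ hk, ?_⟩
  rw [← exponentEq_iff hs0 hs1 hβ h]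
  constructor
  · intro hsol
    -- Both conormal expressions are multiples of x^{β-2s}, so x = 1 decides.
    have e := tendsto_nhds_unique (hcon 1 one_pos) (hsol.conormal 1 one_pos)
    rw [hv.trace, posPow_of_pos one_pos, posPow_of_pos one_pos, one_rpow, one_rpow, one_rpow,
      mul_one, mul_one, div_one] at e
    exact mul_left_cancel₀ (extConst_pos hs0 hs1).ne' e
  · intro e
    refine ⟨hv.equation, hv.continuousOn, fun x hx => ?_, fun x hx => ?_⟩
    · have := hcon x hx
      rw [e, posPow_of_pos hx, rpow_sub hx] at this
      rw [hv.trace, posPow_of_pos hx]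
      convert this using 1
      ring
    · rw [hv.trace, posPow_of_nonpos hx]
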